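/- Let $\hbar,\xi,k>0$ be real, $r=\xi+k$, $1/\eta=\hbar\xi$, $1/\eta'=\hbar(\xi+k)$, $\eta''=2\eta\eta'/(\eta+\eta')$. **Bosons.** Let $a_0(t),a_1(t),a_2(t)$ ($t\in\mathbb R$) be independent bosons with $[a_j(t),a_j(t')]=c_j(t)\,\delta(t+t')$, $$c_0(t)=\frac{\sinh\hbar t\,\sinh\frac{\hbar kt}2\,\sinh\frac{\hbar(\xi+k)t}2}{\hbar^2\,t\,\sinh\frac{\hbar\xi t}2},\quad c_1(t)=\frac{\sinh\hbar t\,\sinh\frac{\hbar(k+2)t}2}{\hbar^2 t},\quad c_2(t)=-\frac{\sinh\hbar t\,\sinh\frac{\hbar kt}2}{\hbar^2t},$$ and $a_0'(t)=\frac{\sinh(\hbar\xi t/2)}{\sinh(\hbar(\xi+k)t/2)}a_0(t)$. They act on the Fock space generated from a vacuum that is annihilated by the modes with $t>0$, by the modes with $t<0$ smeared with continuous functions of compact support in $\mathbb R\setminus\{0\}$. Normal ordering $:\ :$ puts modes with $t<0$ to the left. In a product of normal ordered exponentials the contraction $\int_0^\infty\sum_j c_j(t)f_j(t)g_j(-t)\,dt$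 of exponents $\sum_j\int f_ja_j$ and $\sum_j\int g_ja_j$ is taken as a (Hadamard) finite part at $t=0$. Put $$\tilde\phi_j(A;B,C|\alpha;D)=\hbar\int_{-\infty}^\infty\frac{\sinh\frac{\hbar At}2}{\sinh\frac{\hbar Bt}2\sinh\frac{\hbar Ct}2}\,a_j(t)\,e^{i\alpha t+\frac{\hbar D}2|t|}\,dt,$$ $$\tilde\phi^{(\pm)}_j(A;B|\alpha;C)=2\hbar\int_0^\infty\frac{\sinh\frac{\hbar At}2}{\sinh\frac{\hbar Bt}2}\,a_j(\pm t)\,e^{\pm i\alpha t+\frac{\hbar C}2t}\,dt,$$ let $\tilde\phi'_0$ be $\tilde\phi_0$ with $a'_0$ in place of $a_0$, and $\tilde\phi_j(C|\alpha;D)=\tilde\phi_j(1;1,C|\alpha;D)$; an omitted $D$ is $0$. **Scaling limit.** Let $a_{j,m}$ ($m\in\mathbb Z\setminus\{0\}$) be discrete bosons with $[a_{j,m},a_{j,n}]=d_j(m)\delta_{m+n,0}$, $d_0(m)=\frac{[2m][km]}m\frac{[rm]}{[(r-k)m]}$, $d_1(m)=\frac{[2m][(k+2)m]}m$, $d_2(m)=-\frac{[2m][km]}m$,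 $[x]=\frac{q^x-q^{-x}}{q-q^{-1}}$. Put $q=e^{\hbar\varepsilon/2}$, $z=e^{-i\alpha\varepsilon}$ and let $\varepsilon\to0^+$, $m\varepsilon\to t\neq0$. Then $\frac\varepsilon4d_j(m)\to c_j(t)$, $\frac{[(r-k)m]}{[rm]}\to\frac{\sinh(\hbar\xi t/2)}{\sinh(\hbar(\xi+k)t/2)}$, and $\frac2\varepsilon$ times the coefficient $\frac{[Am]}{[Bm][Cm]}z^{-m}q^{D|m|}$, respectively $(q-q^{-1})\frac{[A|m|]}{[B|m|]}z^{-m}q^{C|m|}$ ($\pm m>0$), of $a_{j,m}$ in the discrete field tends to the coefficient of $a_j(t)$ in $\tilde\phi_j(A;B,C|\alpha;D)$, respectively $\tilde\phi_j^{(\pm)}(A;B|\alpha;C)$ ($B,C\ne0$); and $\frac{\varepsilon}{q-q^{-1}}\to\frac1\hbar$. (Zero modes are dropped.) **Realization.** Define $$k(\alpha)=\,:\!e^{-\tilde\phi_0(1;2,\xi+k|\alpha)}\!:,\qquad E(\alpha)=\Psi^-(\alpha):\!e^{-\tilde\phi_0(k|\alpha)}\!:,\qquad F(\alpha)=\Psi^+(\alpha):\!e^{\tilde\phi_0'(k|\alpha)}\!:,$$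 $$\Psi^\pm(\alpha)=\mp\frac1\hbar:\!e^{\pm\tilde\phi_2(k|\alpha;\pm\frac k2)}\Bigl(e^{-\tilde\phi_2^{(+)}(1;2|\alpha;\mp\frac{k+2}2)\pm\tilde\phi_1^{(+)}(1;2|\alpha;\mp\frac k2)}-e^{\tilde\phi_2^{(-)}(1;2|\alpha;\mp\frac{k+2}2)\mp\tilde\phi_1^{(-)}(1;2|\alpha;\mp\frac k2)}\Bigr)\!:,$$ $$H^\pm(\alpha)=\kappa\,k\bigl(\alpha+\tfrac{i\hbar}2(\pm(r-\tfrac k2)+1)\bigr)\,k\bigl(\alpha+\tfrac{i\hbar}2(\pm(r-\tfrac k2)-1)\bigr),$$ where the constant $\kappa$ is $\frac i{2\pi}$ divided by the exponential of the contraction of the two factors (so that $H^\pm$ is $\frac{i}{2\pi}$ times the normal ordered product of these). Then $E,F,H^\pm$ satisfy the relations of the currents of $\mathcal A_{\hbar,\eta}(\widehat{sl_2})$ at level $c=k$: their matrix elements are entire in $\alpha$; there are distributions $\hat e_\lambda,\hat f_\lambda,\hat t_\lambda$ with $E(\alpha)=\int e^{i\lambda\alpha}\hat e_\lambda d\lambda$,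 $F(\alpha)=\int e^{i\lambda\alpha}\hat f_\lambda d\lambda$, $H^\pm(\alpha)=-\frac\hbar2\int e^{i\lambda\alpha}\hat t_\lambda e^{\mp\lambda/2\eta''}d\lambda$; there is a $\sigma$ such that the contractions in all products $X(\alpha)Y(\beta)$ of two currents converge for $\mathrm{Im}(\alpha-\beta)>\sigma$; and, as identities between meromorphic continuations of matrix elements on the Fock space, with $d=\alpha-\beta$, $$H^+(\alpha)H^-(\beta)=\frac{\mathrm{sh}\,\pi\eta(d-i\hbar(1-\frac c2))\ \mathrm{sh}\,\pi\eta'(d+i\hbar(1-\frac c2))}{\mathrm{sh}\,\pi\eta(d+i\hbar(1+\frac c2))\ \mathrm{sh}\,\pi\eta'(d-i\hbar(1+\frac c2))}H^-(\beta)H^+(\alpha),$$ $$H^\pm(\alpha)H^\pm(\beta)=\frac{\mathrm{sh}\,\pi\eta(d-i\hbar)\ \mathrm{sh}\,\pi\eta'(d+i\hbar)}{\mathrm{sh}\,\pi\eta(d+i\hbar)\ \mathrm{sh}\,\pi\eta'(d-i\hbar)}H^\pm(\beta)H^\pm(\alpha),$$ $$H^\pm(\alpha)E(\beta)=\frac{\mathrm{sh}\,\pi\eta(d-i\hbar(1\mp\frac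 c4))}{\mathrm{sh}\,\pi\eta(d+i\hbar(1\pm\frac c4))}E(\beta)H^\pm(\alpha),\qquad H^\pm(\alpha)F(\beta)=\frac{\mathrm{sh}\,\pi\eta'(d+i\hbar(1\mp\frac c4))}{\mathrm{sh}\,\pi\eta'(d-i\hbar(1\pm\frac c4))}F(\beta)H^\pm(\alpha),$$ $$E(\alpha)E(\beta)=\frac{\mathrm{sh}\,\pi\eta(d-i\hbar)}{\mathrm{sh}\,\pi\eta(d+i\hbar)}E(\beta)E(\alpha),\qquad F(\alpha)F(\beta)=\frac{\mathrm{sh}\,\pi\eta'(d+i\hbar)}{\mathrm{sh}\,\pi\eta'(d-i\hbar)}F(\beta)F(\alpha),$$ $$E(\alpha)F(\beta)=F(\beta)E(\alpha)=\frac{2\pi}\hbar\Bigl(\frac{H^+(\alpha-\frac{i\hbar c}4)}{\alpha-\beta-\frac{i\hbar c}2}-\frac{H^-(\beta-\frac{i\hbar c}4)}{\alpha-\beta+\frac{i\hbar c}2}\Bigr)+(\text{entire in }\alpha,\beta).$$ -/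

import Mathlib

open Filter Topology MeasureTheory Set
open scoped SchwartzMap

noncomputable section

namespace FreeField

/-! ### Three continuous-mode bosons and their Fock space -/

/-- A coefficient function `f` stands for the linear combination
`∑ j, ∫ f j t • a_j(t) dt` of the bosons `a_0(t), a_1(t), a_2(t)`, `t ∈ ℝ`.
The modes with `t > 0` annihilate the vacuum, those with `t < 0` create. -/
abbrev Modes : Type := Fin 3 → ℝ → ℂ

/-- The functions `c_j` in `[a_j(t), a_l(t')] = δ_{jl} c_j(t) δ(t + t')`. -/
def commutator (ħ ξ k : ℝ) : Fin 3 → ℝ → ℝ :=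
  ![fun t => 1 / ħ ^ 2 *
      (Real.sinh (ħ * t) * Real.sinh (ħ * k * t / 2) * Real.sinh (ħ * (ξ + k) * t / 2) /
        (t * Real.sinh (ħ * ξ * t / 2))),
    fun t => 1 / ħ ^ 2 * (Real.sinh (ħ * t) * Real.sinh (ħ * (k + 2) * t / 2) / t),
    fun t => -(1 / ħ ^ 2 * (Real.sinh (ħ * t) * Real.sinh (ħ * k * t / 2) / t))]

/-- The limit of `t * F t` as `t → 0+`. -/
def residueAtZero (F : ℝ → ℂ) : ℂ :=
  limUnder (𝓝[>] (0 : ℝ)) (fun t => (t : ℂ) * F t)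

/-- `F` with its simple pole at `0` removed on `(0, 1)`. -/
def regularized (F : ℝ → ℂ) (t : ℝ) : ℂ :=
  F t - (Ioo (0 : ℝ) 1).indicator (fun s => residueAtZero F / (s : ℂ)) t

/-- Hadamard's finite part of `∫_0^∞ F(t) dt`, i.e. the limit as `δ → 0+` of
`∫_δ^∞ F(t) dt + c log δ`, where `F(t) = c / t + ⋯` at `0`. For `F` meromorphic near `[0, ∞)`
with a pole at `0` only, it is the contour integral `∫_C F(t) log(-t) / (2πi) dt` around
`[0, ∞)`. For `F` integrable at `0` it is the plain integral. -/
def finitePart (F : ℝ → ℂ) : ℂ :=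
  ∫ t in Ioi (0 : ℝ), regularized F t

/-- The finite part of `∫_0^∞ F(t) dt` exists (with absolute convergence). -/
def HasFinitePart (F : ℝ → ℂ) : Prop :=
  (∃ c : ℂ, Tendsto (fun t : ℝ => (t : ℂ) * F t) (𝓝[>] (0 : ℝ)) (𝓝 c)) ∧
    IntegrableOn (regularized F) (Ioi (0 : ℝ))

/-- The integrand of the contraction of `f` with `g`. -/
def contractionIntegrand (ħ ξ k : ℝ) (f g : Modes) (t : ℝ) : ℂ :=
  ∑ j, (commutator ħ ξ k j t : ℂ) * f j t * g j (-t)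

/-- The contraction `⟨f, g⟩`: the commutator of the annihilation part (`t > 0`) of `f` with the
creation part (`t < 0`) of `g`, as a finite part. -/
def contraction (ħ ξ k : ℝ) (f g : Modes) : ℂ :=
  finitePart (contractionIntegrand ħ ξ k f g)

/-- Test modes: continuous with compact support in `ℝ \ {0}`. -/
def IsTest (f : Modes) : Prop :=
  ∀ j, Continuous (f j) ∧ HasCompactSupport (f j) ∧ tsupport (f j) ⊆ {0}ᶜ

/-- The completed Fock space in the coherent state picture: a vector `Φ` is given by the
function `v ↦ ⟨vac| exp(∑ j, ∫_{t>0} v_j(t) a_j(t) dt) Φ`. Only the values of `v` at `t > 0`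
matter for the vectors below. -/
abbrev State : Type := Modes → ℂ

abbrev Op : Type := Module.End ℂ State

/-- The part of the boson `f` with `t < 0`. -/
def create (ħ ξ k : ℝ) (f : Modes) (Φ : State) : State :=
  fun v => contraction ħ ξ k v f * Φ v

/-- The part of the boson `f` with `t > 0`. -/
def annihilate (f : Modes) (Φ : State) : State :=
  fun v => lineDeriv ℂ Φ v f

/-- The operator `∑ j, ∫ f j t • a_j(t) dt`. -/
def boson (ħ ξ k : ℝ) (f : Modes) (Φ : State) : State :=
  annihilate f Φ + create ħ ξ k f Φ

/-- The Fock space: polynomials in the creation operators of test modes, applied to the vacuum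
(the constant function `1`). -/
def Fock (ħ ξ k : ℝ) : Subalgebra ℂ State :=
  Algebra.adjoin ℂ {Φ | ∃ u, IsTest u ∧ Φ = fun v => contraction ħ ξ k v u}

/-- The normal ordered exponential `:exp f: = exp(creation part of f) exp(annihilation part of f)`;
the first factor is a multiplication operator, the second one is a translation. -/
def normalExp (ħ ξ k : ℝ) (f : Modes) : Op where
  toFun Φ := fun v => Complex.exp (contraction ħ ξ k v f) * Φ (v + f)
  map_add' Φ Φ' := by funext v; simp [mul_add]
  map_smul' c Φ := by funext v; simp; ring

/-- The bosons satisfy their commutation relations (smeared with test modes) on the Fock space,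
the vacuum is annihilated by the modes with `t > 0`, and `normalExp` is the normal ordered
exponential series. -/
structure IsBosonicFockSpace (ħ ξ k : ℝ) : Prop where
  comm : ∀ f g v : Modes, IsTest f → IsTest g → IsTest v → ∀ Φ ∈ Fock ħ ξ k,
    boson ħ ξ k f (boson ħ ξ k g Φ) v - boson ħ ξ k g (boson ħ ξ k f Φ) v =
      (∫ t : ℝ, ∑ j, (commutator ħ ξ k j t : ℂ) * f j t * g j (-t)) * Φ v
  vacuum : ∀ f : Modes, IsTest f → (∀ j t, t < 0 → f j t = 0) → boson ħ ξ k f 1 = 0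
  normalExp_hasSum : ∀ f v : Modes, (∀ j, ContinuousOn (f j) {0}ᶜ) → IsTest v →
    ∀ Φ ∈ Fock ħ ξ k,
      HasSum (fun n : ℕ × ℕ =>
          (create ħ ξ k f)^[n.1] ((annihilate f)^[n.2] Φ) v / (n.1.factorial * n.2.factorial : ℂ))
        (normalExp ħ ξ k f Φ v)

/-! ### The boson fields -/

/-- The coefficient function of `φ̃_j(A; B, C | α; D)`. -/
def fieldCoeff (ħ A B C : ℝ) (α : ℂ) (D t : ℝ) : ℂ :=
  ħ * (Real.sinh (ħ * A * t / 2) / (Real.sinh (ħ * B * t / 2) * Real.sinh (ħ * C * t / 2)) : ℝ) *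
    Complex.exp (Complex.I * α * t + ħ * D / 2 * |t|)

/-- `φ̃_j(A; B, C | α; D)`. -/
def field (ħ : ℝ) (j : Fin 3) (A B C : ℝ) (α : ℂ) (D : ℝ) : Modes :=
  Pi.single j (fieldCoeff ħ A B C α D)

/-- The ratio in `a'_0(t) = ratio * a_0(t)`. -/
def primeRatio (ħ ξ k t : ℝ) : ℝ :=
  Real.sinh (ħ * ξ * t / 2) / Real.sinh (ħ * (ξ + k) * t / 2)

/-- `φ̃'_0(A; B, C | α; D)`. -/
def fieldPrime (ħ ξ k A B C : ℝ) (α : ℂ) (D : ℝ) : Modes :=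
  Pi.single 0 (fun t => (primeRatio ħ ξ k t : ℂ) * fieldCoeff ħ A B C α D t)

/-- The coefficient function of `φ̃_j^{(s)}(A; B | α; C)`; it is supported in `s t > 0`. -/
def halfFieldCoeff (ħ : ℝ) (s : ℤˣ) (A B : ℝ) (α : ℂ) (C t : ℝ) : ℂ :=
  if 0 < ((s : ℤ) : ℝ) * t then
    2 * ħ * (Real.sinh (ħ * A * |t| / 2) / Real.sinh (ħ * B * |t| / 2) : ℝ) *
      Complex.exp (Complex.I * α * t + ħ * C / 2 * |t|)
  else 0

/-- `φ̃_j^{(s)}(A; B | α; C)`. -/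
def halfField (ħ : ℝ) (s : ℤˣ) (j : Fin 3) (A B : ℝ) (α : ℂ) (C : ℝ) : Modes :=
  Pi.single j (halfFieldCoeff ħ s A B α C)

/-! ### The currents -/

/-- The exponent of `k(α)`. -/
def kExponent (ħ ξ k : ℝ) (α : ℂ) : Modes := -field ħ 0 1 2 (ξ + k) α 0

/-- `k(α) = :exp(-φ̃_0(1; 2, ξ + k | α)):`. -/
def kCurrent (ħ ξ k : ℝ) (α : ℂ) : Op := normalExp ħ ξ k (kExponent ħ ξ k α)

/-- The exponents of the two terms (`u = 1` and `u = -1`) of the parafermion current `Ψ^s(α)`. -/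
def paraExponent (ħ k : ℝ) (s u : ℤˣ) (α : ℂ) : Modes :=
  ((s : ℤ) : ℂ) • field ħ 2 1 1 k α (((s : ℤ) : ℝ) * k / 2)
    - ((u : ℤ) : ℂ) • halfField ħ u 2 1 2 α (-(((s : ℤ) : ℝ) * (k + 2) / 2))
    + (((u * s : ℤˣ) : ℤ) : ℂ) • halfField ħ u 1 1 2 α (-(((s : ℤ) : ℝ) * k / 2))

/-- The parafermion currents `Ψ^±(α)`. -/
def paraCurrent (ħ ξ k : ℝ) (s : ℤˣ) (α : ℂ) : Op :=
  (-((s : ℤ) : ℂ) / ħ) •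
    (normalExp ħ ξ k (paraExponent ħ k s 1 α) - normalExp ħ ξ k (paraExponent ħ k s (-1) α))

/-- `E(α) = Ψ^-(α) :exp(-φ̃_0(k | α)):`. -/
def eCurrent (ħ ξ k : ℝ) (α : ℂ) : Op :=
  paraCurrent ħ ξ k (-1) α * normalExp ħ ξ k (-field ħ 0 1 1 k α 0)

/-- `F(α) = Ψ^+(α) :exp(φ̃'_0(k | α)):`. -/
def fCurrent (ħ ξ k : ℝ) (α : ℂ) : Op :=
  paraCurrent ħ ξ k 1 α * normalExp ħ ξ k (fieldPrime ħ ξ k 1 1 k α 0)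

/-- The normalization of `H^±`; it turns the product of the two factors `k` in `hCurrent` into
`i / (2π)` times their normal ordered product. -/
def hConst (ħ ξ k : ℝ) : ℂ :=
  Complex.I / (2 * Real.pi) *
    Complex.exp (-contraction ħ ξ k (kExponent ħ ξ k (Complex.I * ħ / 2))
      (kExponent ħ ξ k (-(Complex.I * ħ / 2))))

/-- `H^±(α) = κ k(α + (iħ/2)(±(r - k/2) + 1)) k(α + (iħ/2)(±(r - k/2) - 1))` with `r = ξ + k`. -/
def hCurrent (ħ ξ k : ℝ) (s : ℤˣ) (α : ℂ) : Op :=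
  hConst ħ ξ k •
    (kCurrent ħ ξ k (α + Complex.I * ħ / 2 * (((s : ℤ) : ℂ) * (ξ + k - k / 2) + 1)) *
      kCurrent ħ ξ k (α + Complex.I * ħ / 2 * (((s : ℤ) : ℂ) * (ξ + k - k / 2) - 1)))

/-- The exponents, as functions of `α`, of all the normal ordered exponentials from which the
currents are composed. -/
def exponents (ħ ξ k : ℝ) : Set (ℂ → Modes) :=
  {kExponent ħ ξ k, fun α => -field ħ 0 1 1 k α 0, fun α => fieldPrime ħ ξ k 1 1 k α 0} ∪
    {f | ∃ s u : ℤˣ, f = paraExponent ħ k s u}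

/-- The contractions in the products of two currents `X(α) Y(β)` with `Im (α - β) > σ`, and the
one inside `H^±`, converge. -/
def ContractionsConverge (ħ ξ k σ : ℝ) : Prop :=
  (∀ f ∈ exponents ħ ξ k, ∀ g ∈ exponents ħ ξ k, ∀ α β : ℂ, σ < (α - β).im →
    HasFinitePart (contractionIntegrand ħ ξ k (f α) (g β))) ∧
  HasFinitePart (contractionIntegrand ħ ξ k (kExponent ħ ξ k (Complex.I * ħ / 2))
    (kExponent ħ ξ k (-(Complex.I * ħ / 2))))

/-- The bra vectors `⟨vac| exp(∑ j, ∫_{t>0} v_j(t) a_j(t) dt)` for test modes `v`. -/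
def bras : Set (Module.Dual ℂ State) := {b | ∃ v, IsTest v ∧ b = LinearMap.proj v}

end FreeField

/-! ### The current algebra `A_{ħ,η}(sl₂^)` -/

namespace CurrentAlgebra

/-- `J(x) = ∫ exp(i l x) T_l dl` on the real line, as tempered distributions. -/
def IsGeneratingFunction (T : 𝓢(ℝ, ℂ) →L[ℂ] ℂ) (J : ℂ → ℂ) : Prop :=
  ∀ φ ψ : 𝓢(ℝ, ℂ), (∀ l : ℝ, ψ l = ∫ x : ℝ, Complex.exp (Complex.I * l * x) * φ x) →
    Integrable (fun x : ℝ => J x * φ x) ∧ ∫ x : ℝ, J x * φ x = T ψ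

section

variable {W : Type*} [AddCommGroup W] [Module ℂ W]

/-- `X(α) Y(β) = (num/den)(α - β) Y(β) X(α)` in the sense of analytic continuation: the matrix
elements of `X(α) Y(β)`, given for `Im (α - β) > σ`, continue to meromorphic functions `N / D`
on `ℂ²`, with a denominator `D` that depends on `α - β` only and not on the matrix element. For
`Im (β - α) > σ` they are `num/den` times the matrix elements of `Y(β) X(α)`. -/
def Exchange (bra : Set (Module.Dual ℂ W)) (ket : Set W) (σ : ℝ)
    (X Y : ℂ → Module.End ℂ W) (num den : ℂ → ℂ) : Prop :=
  ∃ D : ℂ → ℂ, Differentiable ℂ D ∧ (∀ d : ℂ, σ < d.im → D d ≠ 0) ∧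
    ∀ b ∈ bra, ∀ w ∈ ket, ∃ N : ℂ × ℂ → ℂ, Differentiable ℂ N ∧
      (∀ α β : ℂ, σ < (α - β).im → b ((X α * Y β) w) = N (α, β) / D (α - β)) ∧
      (∀ α β : ℂ, σ < (β - α).im →
        den (α - β) * N (α, β) = num (α - β) * D (α - β) * b ((Y β * X α) w))

/-- The operator valued functions `E`, `F`, `H 1 = H^+`, `H (-1) = H^-` satisfy, in their matrix
elements between `bra` and `ket`, the defining relations of the currents of `A_{ħ,η}(sl₂^)`,
where the central element acts as the number `c`. Products `X(α) Y(β)` are given for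
`Im (α - β) > σ` and elsewhere by analytic continuation. -/
structure Realizes (ħ η η' c σ : ℝ) (bra : Set (Module.Dual ℂ W)) (ket : Set W)
    (E F : ℂ → Module.End ℂ W) (H : ℤˣ → ℂ → Module.End ℂ W) : Prop where
  entire_E : ∀ b ∈ bra, ∀ w ∈ ket, Differentiable ℂ fun α => b (E α w)
  entire_F : ∀ b ∈ bra, ∀ w ∈ ket, Differentiable ℂ fun α => b (F α w)
  entire_H : ∀ s, ∀ b ∈ bra, ∀ w ∈ ket, Differentiable ℂ fun α => b (H s α w)
  /-- `E(α) = ∫ exp(i l α) e_l dl`. -/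
  modes_E : ∀ b ∈ bra, ∀ w ∈ ket, ∃ e, IsGeneratingFunction e fun α => b (E α w)
  /-- `F(α) = ∫ exp(i l α) f_l dl`. -/
  modes_F : ∀ b ∈ bra, ∀ w ∈ ket, ∃ f, IsGeneratingFunction f fun α => b (F α w)
  /-- `H^±(α) = -(ħ/2) ∫ exp(i l α) t_l exp(∓ l / (2 η'')) dl`, `η'' = 2 η η' / (η + η')`, with one
  `t` for both signs. The equality of distributions is tested on functions of compact support. -/
  modes_H : ∀ b ∈ bra, ∀ w ∈ ket, ∃ t : 𝓢(ℝ, ℂ) →ₗ[ℂ] ℂ, ∀ s : ℤˣ,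
    ∃ T : 𝓢(ℝ, ℂ) →L[ℂ] ℂ, IsGeneratingFunction T (fun α => b (H s α w)) ∧
      ∀ χ ψ : 𝓢(ℝ, ℂ), HasCompactSupport χ →
        (∀ l : ℝ, ψ l =
          Complex.exp (-(((s : ℤ) : ℂ) * l / (2 * (2 * η * η' / (η + η'))))) * χ l) →
        T χ = -(ħ / 2) * t ψ
  rel_H_pos_neg : Exchange bra ket σ (H 1) (H (-1))
    (fun d => Complex.sinh (Real.pi * η * (d - Complex.I * ħ * (1 - c / 2))) *
      Complex.sinh (Real.pi * η' * (d + Complex.I * ħ * (1 - c / 2))))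
    (fun d => Complex.sinh (Real.pi * η * (d + Complex.I * ħ * (1 + c / 2))) *
      Complex.sinh (Real.pi * η' * (d - Complex.I * ħ * (1 + c / 2))))
  rel_H_same : ∀ s, Exchange bra ket σ (H s) (H s)
    (fun d => Complex.sinh (Real.pi * η * (d - Complex.I * ħ)) *
      Complex.sinh (Real.pi * η' * (d + Complex.I * ħ)))
    (fun d => Complex.sinh (Real.pi * η * (d + Complex.I * ħ)) *
      Complex.sinh (Real.pi * η' * (d - Complex.I * ħ)))
  rel_H_E : ∀ s : ℤˣ, Exchange bra ket σ (H s) E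
    (fun d => Complex.sinh (Real.pi * η * (d - Complex.I * ħ * (1 - ((s : ℤ) : ℂ) * c / 4))))
    (fun d => Complex.sinh (Real.pi * η * (d + Complex.I * ħ * (1 + ((s : ℤ) : ℂ) * c / 4))))
  rel_H_F : ∀ s : ℤˣ, Exchange bra ket σ (H s) F
    (fun d => Complex.sinh (Real.pi * η' * (d + Complex.I * ħ * (1 - ((s : ℤ) : ℂ) * c / 4))))
    (fun d => Complex.sinh (Real.pi * η' * (d - Complex.I * ħ * (1 + ((s : ℤ) : ℂ) * c / 4))))
  rel_E_E : Exchange bra ket σ E E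
    (fun d => Complex.sinh (Real.pi * η * (d - Complex.I * ħ)))
    (fun d => Complex.sinh (Real.pi * η * (d + Complex.I * ħ)))
  rel_F_F : Exchange bra ket σ F F
    (fun d => Complex.sinh (Real.pi * η' * (d + Complex.I * ħ)))
    (fun d => Complex.sinh (Real.pi * η' * (d - Complex.I * ħ)))
  /-- `E(α) F(β)` and `F(β) E(α)` have the same continuation, whose only singularities are the
  two displayed poles. -/
  rel_E_F : ∀ b ∈ bra, ∀ w ∈ ket, ∃ R : ℂ × ℂ → ℂ, Differentiable ℂ R ∧
    ∀ α β G : ℂ,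
      G = 2 * Real.pi / ħ *
          (1 / (α - β - Complex.I * ħ * c / 2) * b (H 1 (α - Complex.I * ħ * c / 4) w) -
            1 / (α - β + Complex.I * ħ * c / 2) * b (H (-1) (β - Complex.I * ħ * c / 4) w)) +
        R (α, β) →
      (σ < (α - β).im → b ((E α * F β) w) = G) ∧ (σ < (β - α).im → b ((F β * E α) w) = G)

end

end CurrentAlgebra

/-! ### The discrete bosons and the scaling limit -/

namespace ScalingLimit

/-- The `q`-number `[x] = (q^x - q^{-x}) / (q - q^{-1})`. -/
def qNum (q x : ℝ) : ℝ := (q ^ x - q ^ (-x)) / (q - q⁻¹)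

/-- The numbers `d_j(m)` in `[a_{j,m}, a_{l,n}] = δ_{jl} d_j(m) δ_{m+n,0}`. -/
def qCommutator (q r k : ℝ) : Fin 3 → ℤ → ℝ :=
  ![fun m => qNum q (2 * m) * qNum q (k * m) / m * (qNum q (r * m) / qNum q ((r - k) * m)),
    fun m => qNum q (2 * m) * qNum q ((k + 2) * m) / m,
    fun m => -(qNum q (2 * m) * qNum q (k * m) / m)]

/-- The coefficient of `a_{j,m}` in `φ_j(A; B, C | z; D)`. -/
def qFieldCoeff (q A B C : ℝ) (z : ℂ) (D : ℝ) (m : ℤ) : ℂ :=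
  (qNum q (A * m) / (qNum q (B * m) * qNum q (C * m)) : ℝ) * z ^ (-m) *
    (q ^ (D * |(m : ℝ)|) : ℝ)

/-- The coefficient of `a_{j,m}` in `φ_j^{(s)}(A; B | z; C)`. -/
def qHalfFieldCoeff (q : ℝ) (s : ℤˣ) (A B : ℝ) (z : ℂ) (C : ℝ) (m : ℤ) : ℂ :=
  if 0 < (s : ℤ) * m then
    ((q - q⁻¹) * (qNum q (A * |(m : ℝ)|) / qNum q (B * |(m : ℝ)|)) : ℝ) * z ^ (-m) *
      (q ^ (C * |(m : ℝ)|) : ℝ)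
  else 0

/-- With `q = exp(ħε/2)`, `z = exp(-iαε)`, `r = ξ + k`, `mε → t` and `ε → 0+`, the bosons
`a_j(t) = a_{j,m} / 2` and the fields composed of them become the continuous ones. A sum over `m`
becomes `ε⁻¹ ∫ dt` and `δ_{m+n,0}` becomes `ε δ(t + t')`, so commutators are scaled by `ε / 4` and
the coefficients of fields by `2 / ε`. The parafermion prefactor is scaled by `ε`. -/
def Holds (ħ ξ k : ℝ) : Prop :=
  Tendsto (fun ε : ℝ => ε * (1 / (Real.exp (ħ * ε / 2) - (Real.exp (ħ * ε / 2))⁻¹)))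
    (𝓝[>] 0) (𝓝 (1 / ħ)) ∧
  ∀ t : ℝ, t ≠ 0 → ∀ m : ℝ → ℤ, Tendsto (fun ε : ℝ => m ε * ε) (𝓝[>] 0) (𝓝 t) →
    (∀ j, Tendsto (fun ε : ℝ => ε / 4 * qCommutator (Real.exp (ħ * ε / 2)) (ξ + k) k j (m ε))
      (𝓝[>] 0) (𝓝 (FreeField.commutator ħ ξ k j t))) ∧
    Tendsto (fun ε : ℝ => qNum (Real.exp (ħ * ε / 2)) ((ξ + k - k) * m ε) /
        qNum (Real.exp (ħ * ε / 2)) ((ξ + k) * m ε))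
      (𝓝[>] 0) (𝓝 (FreeField.primeRatio ħ ξ k t)) ∧
    (∀ A B C D : ℝ, B ≠ 0 → C ≠ 0 → ∀ α : ℂ,
      Tendsto (fun ε : ℝ => 2 / (ε : ℂ) *
          qFieldCoeff (Real.exp (ħ * ε / 2)) A B C (Complex.exp (-(Complex.I * α * ε))) D (m ε))
        (𝓝[>] 0) (𝓝 (FreeField.fieldCoeff ħ A B C α D t))) ∧
    (∀ s : ℤˣ, ∀ A B C : ℝ, B ≠ 0 → ∀ α : ℂ,
      Tendsto (fun ε : ℝ => 2 / (ε : ℂ) *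
          qHalfFieldCoeff (Real.exp (ħ * ε / 2)) s A B (Complex.exp (-(Complex.I * α * ε))) C
            (m ε))
        (𝓝[>] 0) (𝓝 (FreeField.halfFieldCoeff ħ s A B α C t)))

end ScalingLimit

end

namespace FreeField

/-! ### Finite parts -/

/-! Every current is a finite linear combination of exponentials `:exp f(α):` whose coefficient
functions depend on `α` only through `exp(iαt)`. In the coherent state picture such an exponential
multiplies by `exp⟨v, f⟩` and translates `v` by `f`. A product of two of them is therefore the
normal ordered product times the scalar `exp⟨f(α), g(β)⟩` (Wick's theorem,
`IsVertexCurrent.mul_apply`). The normal ordered matrix elements are entire in both variables and do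
not depend on the order of the factors, so all relations become statements about scalars that depend
on `α - β` alone.

To compute the scalars, the integrands are written as rational functions of exponentials divided by
`t`. Two kinds of terms occur. Terms `(exp(-at) - exp(-bt)) / t` are Frullani integrals, with
exponential `b / a`. Terms with a further denominator `1 - exp(-ωt)`, where `ω` is `1/η = ħξ` or
`1/η' = ħ(ξ + k)`, give quotients of Gamma functions (`hasExpFinitePart_gammaIntegrand`): a
geometric sum reduces them to Frullani integrals and Euler's limit for `Γ` appears. Since `1/Γ` is
entire, each scalar continues to a quotient of entire functions. Comparing the two orders of a
product is then the reflection formula, which produces the ratios of hyperbolic sines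
(`gamma_reflect`, `gamma_reflect_half`, `exchange_HH`).

For `E` with `F` the Gamma functions cancel and a rational function remains, the same for both
orders. Only the two terms with equal signs have a pole, at `α - β = ±iħk/2`. There the bosons
`a_1`, `a_2` cancel in the sum of the exponents and the `a_0` parts combine to the exponent of `H^±`
(`eExponent_add_fExponent_one`, `eExponent_add_fExponent_neg_one`). Subtracting the residues leaves
an entire function, because the matrix elements are built from functions of one variable and divided
differences apply (`exists_factor_of_mem_splitAlgebra`).

The Fourier representations hold because test modes have compact support: matrix elements are
bounded on horizontal strips, hence tempered on the real line. The currents `H^+` and `H^-` are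
translates of one entire function in the imaginary direction; a shift of contour turns the
translation into an exponential weight, so a single `t` serves both
(`EntireOnStrips.integral_shift`). In the scaling limit every `q`-number is a quotient of hyperbolic
sines, and the limits are termwise. -/

theorem eventuallyEq_nhdsGT {F G : ℝ → ℂ} (h : EqOn F G (Ioi 0)) : F =ᶠ[𝓝[>] (0 : ℝ)] G :=
  eventually_nhdsWithin_of_forall h

theorem residueAtZero_congr {F G : ℝ → ℂ} (h : EqOn F G (Ioi 0)) :
    residueAtZero F = residueAtZero G := by
  unfold residueAtZero limUnder
  congr 1
  refine Filter.map_congr ?_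
  filter_upwards [eventuallyEq_nhdsGT h] with t ht
  rw [ht]

theorem regularized_congr {F G : ℝ → ℂ} (h : EqOn F G (Ioi 0)) :
    EqOn (regularized F) (regularized G) (Ioi 0) := by
  intro t ht
  simp only [regularized, residueAtZero_congr h, h ht]

theorem finitePart_congr {F G : ℝ → ℂ} (h : EqOn F G (Ioi 0)) : finitePart F = finitePart G :=
  setIntegral_congr_fun measurableSet_Ioi (regularized_congr h)

theorem HasFinitePart.congr {F G : ℝ → ℂ} (hF : HasFinitePart F) (h : EqOn F G (Ioi 0)) :
    HasFinitePart G := by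
  obtain ⟨⟨c, hc⟩, hI⟩ := hF
  refine ⟨⟨c, hc.congr' ?_⟩, hI.congr_fun (regularized_congr h) measurableSet_Ioi⟩
  filter_upwards [eventuallyEq_nhdsGT h] with t ht
  rw [ht]

theorem HasFinitePart.tendsto {F : ℝ → ℂ} (hF : HasFinitePart F) :
    Tendsto (fun t : ℝ => (t : ℂ) * F t) (𝓝[>] (0 : ℝ)) (𝓝 (residueAtZero F)) := by
  obtain ⟨⟨c, hc⟩, -⟩ := hF
  have : residueAtZero F = c := hc.limUnder_eq
  rwa [this]

theorem residueAtZero_eq {F : ℝ → ℂ} {c : ℂ}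
    (h : Tendsto (fun t : ℝ => (t : ℂ) * F t) (𝓝[>] (0 : ℝ)) (𝓝 c)) : residueAtZero F = c :=
  h.limUnder_eq

theorem HasFinitePart.regularized_add {F G : ℝ → ℂ} (hF : HasFinitePart F)
    (hG : HasFinitePart G) :
    regularized (fun t => F t + G t) = fun t => regularized F t + regularized G t := by
  have h : residueAtZero (fun t => F t + G t) = residueAtZero F + residueAtZero G :=
    residueAtZero_eq ((hF.tendsto.add hG.tendsto).congr fun t => by ring)
  funext t
  simp only [regularized, h, indicator]
  split_ifs <;> ring

theorem HasFinitePart.add {F G : ℝ → ℂ} (hF : HasFinitePart F) (hG : HasFinitePart G) :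
    HasFinitePart fun t => F t + G t := by
  refine ⟨⟨_, (hF.tendsto.add hG.tendsto).congr fun t => by ring⟩, ?_⟩
  rw [hF.regularized_add hG]
  exact hF.2.add hG.2

theorem finitePart_add {F G : ℝ → ℂ} (hF : HasFinitePart F) (hG : HasFinitePart G) :
    finitePart (fun t => F t + G t) = finitePart F + finitePart G := by
  unfold finitePart
  rw [hF.regularized_add hG]
  exact integral_add hF.2 hG.2

theorem HasFinitePart.regularized_const_mul {F : ℝ → ℂ} (hF : HasFinitePart F) (a : ℂ) :
    regularized (fun t => a * F t) = fun t => a * regularized F t := by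
  have h : residueAtZero (fun t => a * F t) = a * residueAtZero F :=
    residueAtZero_eq ((hF.tendsto.const_mul a).congr fun t => by ring)
  funext t
  simp only [regularized, h, indicator]
  split_ifs <;> ring

theorem HasFinitePart.const_mul {F : ℝ → ℂ} (hF : HasFinitePart F) (a : ℂ) :
    HasFinitePart fun t => a * F t := by
  refine ⟨⟨_, (hF.tendsto.const_mul a).congr fun t => by ring⟩, ?_⟩
  rw [hF.regularized_const_mul]
  exact Integrable.const_mul hF.2 a

theorem finitePart_const_mul {F : ℝ → ℂ} (hF : HasFinitePart F) (a : ℂ) :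
    finitePart (fun t => a * F t) = a * finitePart F := by
  unfold finitePart
  rw [hF.regularized_const_mul]
  exact integral_const_mul a _

/-- A function without pole at zero has its integral as finite part. -/
theorem regularized_of_tendsto_zero {F : ℝ → ℂ}
    (h : Tendsto (fun t : ℝ => (t : ℂ) * F t) (𝓝[>] (0 : ℝ)) (𝓝 0)) : regularized F = F := by
  funext t
  simp [regularized, residueAtZero_eq h]

/-- The finite part of `∫ F` exists and its exponential is `z`. -/
def HasExpFinitePart (F : ℝ → ℂ) (z : ℂ) : Prop :=
  HasFinitePart F ∧ Complex.exp (finitePart F) = z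

namespace HasExpFinitePart

variable {F G : ℝ → ℂ} {z w : ℂ}

theorem congr (hF : HasExpFinitePart F z) (h : EqOn F G (Ioi 0)) : HasExpFinitePart G z :=
  ⟨hF.1.congr h, by rw [← finitePart_congr h]; exact hF.2⟩

theorem add (hF : HasExpFinitePart F z) (hG : HasExpFinitePart G w) :
    HasExpFinitePart (fun t => F t + G t) (z * w) :=
  ⟨hF.1.add hG.1, by rw [finitePart_add hF.1 hG.1, Complex.exp_add, hF.2, hG.2]⟩

theorem neg (hF : HasExpFinitePart F z) : HasExpFinitePart (fun t => -F t) z⁻¹ := by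
  have h := hF.1.const_mul (-1)
  refine ⟨h.congr fun t _ => by simp, ?_⟩
  rw [← finitePart_congr (F := fun t => -1 * F t) fun t _ => by simp,
    finitePart_const_mul hF.1, neg_one_mul, Complex.exp_neg, hF.2]

end HasExpFinitePart

theorem hasExpFinitePart_zero : HasExpFinitePart (fun _ => 0) 1 := by
  have h : Tendsto (fun t : ℝ => (t : ℂ) * (0 : ℂ)) (𝓝[>] (0 : ℝ)) (𝓝 0) := by simp
  have hr := regularized_of_tendsto_zero (F := fun _ => 0) h
  refine ⟨⟨⟨0, h⟩, by rw [hr]; exact integrableOn_zero⟩, ?_⟩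
  unfold finitePart
  rw [hr]
  simp

/-! ### Functions of tame growth -/

/-- `G` is continuous on `(0, ∞)`, is `c + O(t)` at `0` and `O(exp(M t))` at `∞`. -/
structure Tame (M : ℝ) (G : ℝ → ℂ) : Prop where
  cont : ContinuousOn G (Ioi 0)
  zero : ∃ c : ℂ, (fun t => G t - c) =O[𝓝[>] 0] (fun t : ℝ => t)
  top : G =O[atTop] fun t => Real.exp (M * t)

theorem tendsto_id_nhdsGT : Tendsto (fun t : ℝ => t) (𝓝[>] 0) (𝓝 0) :=
  tendsto_nhdsWithin_of_tendsto_nhds tendsto_id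

theorem tendsto_of_isBigO {G : ℝ → ℂ} {c : ℂ}
    (h : (fun t => G t - c) =O[𝓝[>] 0] (fun t : ℝ => t)) : Tendsto G (𝓝[>] 0) (𝓝 c) := by
  have h1 := h.trans_tendsto tendsto_id_nhdsGT
  simpa using h1.add_const c

namespace Tame

variable {M N : ℝ} {F G : ℝ → ℂ}

theorem congr (hF : Tame M F) (h : EqOn F G (Ioi 0)) : Tame M G := by
  obtain ⟨h1, ⟨c, h2⟩, h3⟩ := hF
  refine ⟨h1.congr fun t ht => (h ht).symm, ⟨c, h2.congr' ?_ .rfl⟩, h3.congr' ?_ .rfl⟩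
  · filter_upwards [eventuallyEq_nhdsGT h] with t ht
    rw [ht]
  · filter_upwards [eventually_gt_atTop 0] with t ht using h ht

theorem mono (hF : Tame M F) (h : M ≤ N) : Tame N F := by
  refine ⟨hF.cont, hF.zero, hF.top.trans (Asymptotics.IsBigO.of_bound 1 ?_)⟩
  filter_upwards [eventually_ge_atTop 0] with t ht
  simp only [Real.norm_eq_abs, Real.abs_exp, one_mul]
  gcongr

theorem const (c : ℂ) : Tame 0 fun _ => c := by
  refine ⟨continuousOn_const, ⟨c, by simpa using Asymptotics.isBigO_zero _ _⟩, ?_⟩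
  simpa using Asymptotics.isBigO_const_const c (one_ne_zero (α := ℝ)) atTop

theorem add (hF : Tame M F) (hG : Tame N G) : Tame (max M N) fun t => F t + G t := by
  obtain ⟨a1, ⟨c, b1⟩, d1⟩ := hF.mono (le_max_left M N)
  obtain ⟨a2, ⟨e, b2⟩, d2⟩ := hG.mono (le_max_right M N)
  exact ⟨a1.add a2, ⟨c + e, (b1.add b2).congr_left fun t => by ring⟩, d1.add d2⟩

theorem mul (hF : Tame M F) (hG : Tame N G) : Tame (M + N) fun t => F t * G t := by
  obtain ⟨a1, ⟨c, b1⟩, d1⟩ := hF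
  obtain ⟨a2, ⟨e, b2⟩, d2⟩ := hG
  refine ⟨a1.mul a2, ⟨c * e, ?_⟩, ?_⟩
  · have h1 : G =O[𝓝[>] 0] (fun _ : ℝ => (1 : ℝ)) := (tendsto_of_isBigO b2).isBigO_one ℝ
    have h2 : (fun _ : ℝ => c) =O[𝓝[>] 0] (fun _ : ℝ => (1 : ℝ)) :=
      Asymptotics.isBigO_const_const c one_ne_zero _
    have h3 := (b1.mul h1).congr_right (g₂ := fun t => t) fun t => by ring
    have h4 := (h2.mul b2).congr_right (g₂ := fun t => t) fun t => by ring
    exact (h3.add h4).congr_left fun t => by ring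
  · refine (d1.mul d2).congr_right fun t => ?_
    rw [← Real.exp_add]; ring_nf

theorem const_mul (hF : Tame M F) (a : ℂ) : Tame M fun t => a * F t := by
  simpa using (Tame.const a).mul hF

theorem neg (hF : Tame M F) : Tame M fun t => -F t := by
  simpa using hF.const_mul (-1)

/-- The inverse of a tame function with nonzero limit at `0`. -/
theorem inv {c : ℂ} (hF : Tame M F) (hc : Tendsto F (𝓝[>] 0) (𝓝 c)) (hc0 : c ≠ 0)
    (h0 : ∀ t, 0 < t → F t ≠ 0) (ht : (fun t => (F t)⁻¹) =O[atTop] fun t => Real.exp (N * t)) :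
    Tame N fun t => (F t)⁻¹ := by
  obtain ⟨a1, ⟨e, b1⟩, -⟩ := hF
  obtain rfl : c = e := tendsto_nhds_unique hc (tendsto_of_isBigO b1)
  refine ⟨a1.inv₀ h0, ⟨c⁻¹, ?_⟩, ht⟩
  have h1 : (fun t => (F t)⁻¹) =O[𝓝[>] 0] (fun _ : ℝ => (1 : ℝ)) := (hc.inv₀ hc0).isBigO_one ℝ
  have h2 := ((b1.mul h1).const_mul_left (-c⁻¹)).congr_right (g₂ := fun t => t) fun t => by ring
  refine h2.congr' ?_ .rfl
  filter_upwards [self_mem_nhdsWithin] with t ht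
  have := h0 t ht
  field_simp
  ring

theorem exp (z : ℂ) : Tame z.re fun t => Complex.exp (z * t) := by
  refine ⟨by fun_prop, ⟨1, ?_⟩, ?_⟩
  · have h : HasDerivAt (fun t : ℝ => Complex.exp (z * t)) (Complex.exp (z * (0 : ℝ)) * (z * 1)) 0 :=
      ((hasDerivAt_id (0 : ℝ)).ofReal_comp.const_mul z).cexp
    simpa using (h.isBigO_sub.mono nhdsWithin_le_nhds)
  · refine Asymptotics.IsBigO.of_bound 1 (Eventually.of_forall fun t => ?_)
    simp [Complex.norm_exp]

/-- Taylor's bound `‖exp w - 1 - w‖ ≤ ‖w‖ ^ 2` for `‖w‖ ≤ 1`, applied with `w = z * t` and divided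
by `t`. -/
theorem isBigO_exp_sub_one_div (z : ℂ) :
    (fun t : ℝ => (Complex.exp (z * t) - 1) / t - z) =O[𝓝[>] 0] (fun t : ℝ => t) := by
  refine Asymptotics.IsBigO.of_bound (‖z‖ ^ 2) ?_
  have h : Tendsto (fun t : ℝ => ‖z‖ * t) (𝓝[>] 0) (𝓝 (‖z‖ * 0)) :=
    tendsto_id_nhdsGT.const_mul _
  filter_upwards [self_mem_nhdsWithin, h.eventually_lt_const (u := 1) (by simp)] with t ht h1
  have ht : 0 < t := ht
  have hn : ‖z * t‖ = ‖z‖ * t := by simp [abs_of_pos ht]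
  have h2 := Complex.norm_exp_sub_one_sub_id_le (x := z * t) (by rw [hn]; exact h1.le)
  have h3 : (Complex.exp (z * t) - 1) / t - z = (Complex.exp (z * t) - 1 - z * t) / t := by
    have : (t : ℂ) ≠ 0 := by exact_mod_cast ht.ne'
    field_simp
  rw [h3, norm_div, Complex.norm_real, Real.norm_of_nonneg ht.le, div_le_iff₀ ht]
  calc _ ≤ _ := h2
    _ = _ := by rw [hn]; ring

theorem tendsto_exp_sub_exp_div (x y : ℂ) :
    (fun t : ℝ => (Complex.exp (x * t) - Complex.exp (y * t)) / t - (x - y)) =O[𝓝[>] 0]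
      (fun t : ℝ => t) :=
  ((isBigO_exp_sub_one_div x).sub (isBigO_exp_sub_one_div y)).congr_left fun t => by ring

theorem exp_sub_exp_div (x y : ℂ) :
    Tame (max x.re y.re) fun t => (Complex.exp (x * t) - Complex.exp (y * t)) / t := by
  refine ⟨?_, ⟨x - y, tendsto_exp_sub_exp_div x y⟩, ?_⟩
  · refine ContinuousOn.div (by fun_prop) (by fun_prop) fun t ht => ?_
    have ht : 0 < t := ht
    exact_mod_cast ht.ne'
  · have h1 : (fun t : ℝ => Complex.exp (x * t) - Complex.exp (y * t)) =O[atTop]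
        fun t => Real.exp (max x.re y.re * t) :=
      ((exp x).mono (le_max_left _ _)).top.sub ((exp y).mono (le_max_right _ _)).top
    have h2 : (fun t : ℝ => (t : ℂ)⁻¹) =O[atTop] fun _ => (1 : ℝ) := by
      refine Asymptotics.IsBigO.of_bound 1 ?_
      filter_upwards [eventually_ge_atTop 1] with t ht
      simp only [norm_inv, Complex.norm_real, Real.norm_eq_abs, abs_one, mul_one]
      rw [abs_of_nonneg (by linarith)]
      exact inv_le_one_of_one_le₀ ht
    simpa [div_eq_mul_inv] using h1.mul h2

theorem sinh_div (a : ℝ) : Tame |a| fun t => ((Real.sinh (a * t) / t : ℝ) : ℂ) := by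
  refine (((exp_sub_exp_div a (-a)).const_mul (1 / 2)).mono ?_).congr fun t _ => ?_
  · simp [le_abs_self, neg_le_abs]
  · push_cast
    rw [Complex.sinh]
    ring_nf

theorem tendsto_sinh_div (a : ℝ) :
    Tendsto (fun t : ℝ => ((Real.sinh (a * t) / t : ℝ) : ℂ)) (𝓝[>] 0) (𝓝 a) := by
  have h := (tendsto_of_isBigO (tendsto_exp_sub_exp_div a (-a))).const_mul (1 / 2)
  have e : (1 / 2 : ℂ) * (a - -a) = a := by ring
  rw [e] at h
  refine h.congr fun t => ?_
  push_cast
  rw [Complex.sinh]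
  ring_nf

/-- Only `sinh x ≥ x` is used at infinity, hence the exponent `0` instead of `-b`. The loss is
harmless since the decay will come from `exp(i(α - β)t)`. -/
theorem div_sinh {b : ℝ} (hb : 0 < b) : Tame 0 fun t => ((t / Real.sinh (b * t) : ℝ) : ℂ) := by
  have key : ∀ t, 0 < t → 0 < Real.sinh (b * t) / t := fun t ht =>
    div_pos (Real.sinh_pos_iff.2 (by positivity)) ht
  refine ((sinh_div b).inv (N := 0) (tendsto_sinh_div b) (by exact_mod_cast hb.ne') ?_ ?_).congr ?_
  · intro t ht
    exact_mod_cast (key t ht).ne'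
  · refine Asymptotics.IsBigO.of_bound b⁻¹ ?_
    filter_upwards [eventually_gt_atTop 0] with t ht
    rw [norm_inv, Complex.norm_real, Real.norm_of_nonneg (key t ht).le]
    simp only [zero_mul, Real.exp_zero, norm_one, mul_one]
    gcongr
    rw [le_div_iff₀ ht]
    exact Real.self_le_sinh_iff.2 (by positivity)
  · intro t _
    push_cast
    simp

/-- A continuous function that vanishes near `0` and near `∞` is tame. -/
theorem of_vanish (hc : ContinuousOn F (Ioi 0)) (h0 : ∀ᶠ t in 𝓝[>] 0, F t = 0)
    (h1 : ∀ᶠ t in atTop, F t = 0) : Tame M F := by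
  refine ⟨hc, ⟨0, ?_⟩, ?_⟩
  · refine (Asymptotics.isBigO_zero _ _).congr' ?_ .rfl
    filter_upwards [h0] with t ht
    rw [ht, sub_zero]
  · refine (Asymptotics.isBigO_zero _ _).congr' ?_ .rfl
    filter_upwards [h1] with t ht
    rw [ht]

/-- `G(t) / t` has a finite part if `G` is tame and decays exponentially. -/
theorem hasFinitePart (hG : Tame M G) (hM : M < 0) : HasFinitePart fun t => G t / t := by
  obtain ⟨h1, ⟨c, h2⟩, h3⟩ := hG
  have hlim : Tendsto (fun t : ℝ => (t : ℂ) * (G t / t)) (𝓝[>] 0) (𝓝 c) := by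
    refine (tendsto_of_isBigO h2).congr' ?_
    filter_upwards [self_mem_nhdsWithin] with t ht
    have ht : 0 < t := ht
    have : (t : ℂ) ≠ 0 := by exact_mod_cast ht.ne'
    field_simp
  refine ⟨⟨c, hlim⟩, ?_⟩
  have hr : regularized (fun t => G t / t) = fun t =>
      G t / t - (Ioo (0 : ℝ) 1).indicator (fun s => c / (s : ℂ)) t := by
    funext t; simp [regularized, residueAtZero_eq hlim]
  rw [hr, ← Ioo_union_Ici_eq_Ioi (zero_lt_one' ℝ)]
  have hne : ∀ t ∈ Ioi (0 : ℝ), (t : ℂ) ≠ 0 := fun t ht => by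
    have ht : 0 < t := ht
    exact_mod_cast ht.ne'
  -- On `(0, 1)` the regularized integrand is `(G t - c) / t`, bounded near `0` by the `O(t)`
  -- condition and on `[δ, 1]` by compactness. On `[1, ∞)` nothing is subtracted and `G` decays
  -- exponentially.
  refine IntegrableOn.union ?_ ?_
  · have hcont : ContinuousOn (fun t => (G t - c) / t) (Ioi 0) :=
      (h1.sub continuousOn_const).div (by fun_prop) hne
    have : IntegrableOn (fun t => (G t - c) / t) (Ioo 0 1) := by
      obtain ⟨C, hC⟩ := h2.bound
      obtain ⟨δ, hδ, hδ'⟩ := mem_nhdsGT_iff_exists_Ioo_subset.1 hC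
      have hδ : 0 < δ := hδ
      obtain ⟨B, hB⟩ := (isCompact_Icc (a := δ) (b := 1)).exists_bound_of_continuousOn
        (hcont.mono fun t ht => hδ.trans_le ht.1)
      refine IntegrableOn.of_bound (C := max C B) (by simp)
        ((hcont.mono Ioo_subset_Ioi_self).aestronglyMeasurable measurableSet_Ioo) ?_
      filter_upwards [ae_restrict_mem measurableSet_Ioo] with t ht
      rcases lt_or_ge t δ with h | h
      · have h4 : ‖G t - c‖ ≤ C * ‖t‖ := hδ' ⟨ht.1, h⟩
        refine le_trans ?_ (le_max_left _ _)
        rw [norm_div, Complex.norm_real, div_le_iff₀ (by simpa using ht.1.ne')]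
        exact h4
      · exact (hB t ⟨h, ht.2.le⟩).trans (le_max_right _ _)
    refine this.congr_fun (fun t ht => ?_) measurableSet_Ioo
    simp only [indicator_of_mem ht]
    ring
  · have hcont : ContinuousOn (fun t => G t / t) (Ici 1) :=
      (h1.div (by fun_prop) hne).mono fun t ht => mem_Ioi.2 (lt_of_lt_of_le one_pos ht)
    have h4 : IntegrableOn (fun t => ‖G t / t‖) (Ici 1) := by
      rw [integrableOn_Ici_iff_integrableOn_Ioi]
      refine integrable_of_isBigO_exp_neg (b := -M) (by linarith) hcont.norm ?_
      refine (Asymptotics.IsBigO.trans ?_ h3.norm_left).congr_right fun t => by simp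
      refine Asymptotics.IsBigO.of_bound 1 ?_
      filter_upwards [eventually_ge_atTop 1] with t ht
      simp only [norm_div, Complex.norm_real, Real.norm_eq_abs, abs_abs, abs_norm, one_mul]
      exact div_le_self (norm_nonneg _) (ht.trans (le_abs_self _))
    have h5 : IntegrableOn (fun t => G t / t) (Ici 1) :=
      (integrable_norm_iff (hcont.aestronglyMeasurable measurableSet_Ici)).1 h4
    refine h5.congr_fun (fun t ht => ?_) measurableSet_Ici
    have : t ∉ Ioo (0 : ℝ) 1 := fun h => absurd h.2 (not_lt.2 ht)
    simp [indicator_of_notMem this]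

/-- The residue at zero of `G(t) / t`. -/
theorem residueAtZero_div {c : ℂ} (hc : Tendsto G (𝓝[>] 0) (𝓝 c)) :
    residueAtZero (fun t => G t / t) = c := by
  refine residueAtZero_eq (hc.congr' ?_)
  filter_upwards [self_mem_nhdsWithin] with t ht
  have ht : 0 < t := ht
  have : (t : ℂ) ≠ 0 := by exact_mod_cast ht.ne'
  field_simp

end Tame

end FreeField

namespace FreeField

/-! ### Frullani's integral and the logarithm of the Gamma function -/

theorem integral_Ioi_exp_neg_mul {c : ℂ} (hc : 0 < c.re) :
    ∫ t : ℝ in Ioi 0, Complex.exp (-c * t) = 1 / c := by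
  have h := integral_exp_mul_complex_Ioi (a := -c) (by simpa using hc) 0
  simpa [neg_div] using h

/-- Frullani's integral for exponential functions with complex exponents. -/
theorem integral_exp_sub_exp_div {a b : ℂ} (ha : 0 < a.re) (hb : 0 < b.re) :
    ∫ t : ℝ in Ioi 0, (Complex.exp (-a * t) - Complex.exp (-b * t)) / t =
      Complex.log b - Complex.log a := by
  set m := min a.re b.re with hm
  have hmpos : 0 < m := lt_min ha hb
  -- The integrand is the integral of `(b - a) * exp(-c t)` with `c` running along the segment from
  -- `a` to `b`. After interchanging the integrals, `(b - a) / c` integrates to the increment of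
  -- `log`, holomorphic on the half-plane that contains the segment.
  let c : ℝ → ℂ := fun s => a + s * (b - a)
  have hc : ∀ s ∈ Icc (0 : ℝ) 1, m ≤ (c s).re := by
    intro s hs
    have : (c s).re = (1 - s) * a.re + s * b.re := by simp [c]; ring
    rw [this]
    nlinarith [min_le_left a.re b.re, min_le_right a.re b.re, hs.1, hs.2,
      mul_le_mul_of_nonneg_left (min_le_left a.re b.re) (sub_nonneg.2 hs.2),
      mul_le_mul_of_nonneg_left (min_le_right a.re b.re) hs.1]
  have hinner : ∀ t ∈ Ioi (0 : ℝ), (Complex.exp (-a * t) - Complex.exp (-b * t)) / t =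
      ∫ s in Ioc (0 : ℝ) 1, (b - a) * Complex.exp (-c s * t) := by
    intro t ht
    have ht : 0 < t := ht
    have htc : (t : ℂ) ≠ 0 := by exact_mod_cast ht.ne'
    rw [← intervalIntegral.integral_of_le zero_le_one]
    have hd : ∀ s : ℝ, HasDerivAt (fun s : ℝ => -Complex.exp (-c s * t) / t)
        ((b - a) * Complex.exp (-c s * t)) s := by
      intro s
      have h1 : HasDerivAt (fun s : ℝ => -c s * t) (-(1 * (b - a)) * t) s :=
        (((hasDerivAt_id s).ofReal_comp.mul_const (b - a)).const_add a).neg.mul_const _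
      refine (h1.cexp.neg.div_const (t : ℂ)).congr_deriv ?_
      field_simp
    rw [intervalIntegral.integral_eq_sub_of_hasDerivAt (fun s _ => hd s)
      (by apply Continuous.intervalIntegrable; fun_prop)]
    simp [c]
    ring
  rw [setIntegral_congr_fun measurableSet_Ioi hinner, integral_integral_swap]
  · have h2 : ∀ s ∈ Ioc (0 : ℝ) 1, ∫ t : ℝ in Ioi 0, (b - a) * Complex.exp (-c s * t) =
        (b - a) / c s := by
      intro s hs
      rw [integral_const_mul, integral_Ioi_exp_neg_mul (hmpos.trans_le (hc s ⟨hs.1.le, hs.2⟩))]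
      ring
    rw [setIntegral_congr_fun measurableSet_Ioc h2, ← intervalIntegral.integral_of_le zero_le_one]
    have hd : ∀ s ∈ uIcc (0 : ℝ) 1, HasDerivAt (fun s : ℝ => Complex.log (c s))
        ((b - a) / c s) s := by
      intro s hs
      rw [uIcc_of_le zero_le_one] at hs
      have h1 : HasDerivAt c (1 * (b - a)) s :=
        ((hasDerivAt_id s).ofReal_comp.mul_const (b - a)).const_add a
      have h2 : c s ∈ Complex.slitPlane := Or.inl (hmpos.trans_le (hc s hs))
      simpa using h1.clog_real h2
    rw [intervalIntegral.integral_eq_sub_of_hasDerivAt hd]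
    · simp [c]
    · refine ContinuousOn.intervalIntegrable (ContinuousOn.div continuousOn_const (by fun_prop) ?_)
      intro s hs h0
      rw [uIcc_of_le zero_le_one] at hs
      have := hmpos.trans_le (hc s hs)
      simp [h0] at this
  -- For the interchange: `Re (c s) ≥ m > 0` along the whole segment, so `exp(-m t)` dominates.
  · have hdom : Integrable (fun p : ℝ × ℝ => ‖b - a‖ * Real.exp (-m * p.1))
        ((volume.restrict (Ioi 0)).prod (volume.restrict (Ioc 0 1))) := by
      have h1 : Integrable (fun t => Real.exp (-m * t)) (volume.restrict (Ioi 0)) :=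
        exp_neg_integrableOn_Ioi 0 hmpos
      exact (h1.comp_fst _).const_mul _
    refine hdom.mono' (Continuous.aestronglyMeasurable (by fun_prop)) ?_
    rw [Measure.prod_restrict]
    filter_upwards [ae_restrict_mem (measurableSet_Ioi.prod measurableSet_Ioc)] with p hp
    simp only [Function.uncurry, norm_mul, Complex.norm_exp]
    gcongr
    have := hc p.2 ⟨hp.2.1.le, hp.2.2⟩
    have h0 : (0 : ℝ) < p.1 := hp.1
    simp only [neg_mul, Complex.neg_re, Complex.re_mul_ofReal, neg_le_neg_iff]
    gcongr

/-- The numerator vanishes at `0`, so the finite part is the ordinary integral. Exponentiating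
removes the logarithms and any question of branches. -/
theorem hasFinitePart_exp_sub_exp_div {a b : ℂ} (ha : 0 < a.re) (hb : 0 < b.re) :
    IntegrableOn (fun t : ℝ => (Complex.exp (-a * t) - Complex.exp (-b * t)) / t) (Ioi 0) ∧
    HasExpFinitePart (fun t : ℝ => (Complex.exp (-a * t) - Complex.exp (-b * t)) / t) (b / a) := by
  have hT : Tame (max (-a).re (-b).re)
      fun t : ℝ => (Complex.exp (-a * t) - Complex.exp (-b * t)) := by
    simpa [sub_eq_add_neg] using (Tame.exp (-a)).add (Tame.exp (-b)).neg
  have hF := hT.hasFinitePart (by simp [ha, hb])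
  have h0 : Tendsto (fun t : ℝ => (t : ℂ) *
      ((Complex.exp (-a * t) - Complex.exp (-b * t)) / t)) (𝓝[>] (0 : ℝ)) (𝓝 0) := by
    have h := tendsto_of_isBigO (Tame.tendsto_exp_sub_exp_div (-a) (-b))
    have h1 := ((Complex.continuous_ofReal.tendsto 0).comp tendsto_id_nhdsGT).mul h
    simpa using h1
  have hr := regularized_of_tendsto_zero h0
  refine ⟨hr ▸ hF.2, hF, ?_⟩
  have ha0 : a ≠ 0 := by rintro rfl; simp at ha
  have hb0 : b ≠ 0 := by rintro rfl; simp at hb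
  rw [finitePart, hr, integral_exp_sub_exp_div ha hb, Complex.exp_sub, Complex.exp_log ha0,
    Complex.exp_log hb0]

theorem hasExpFinitePart_frullani {a b : ℂ} (ha : 0 < a.re) (hb : 0 < b.re) :
    HasExpFinitePart (fun t : ℝ => (Complex.exp (-a * t) - Complex.exp (-b * t)) / t) (b / a) :=
  (hasFinitePart_exp_sub_exp_div ha hb).2

/-- The integrand of the logarithm of a quotient of two Gamma functions. -/
noncomputable def gammaIntegrand (ω : ℝ) (a b : ℂ) (t : ℝ) : ℂ :=
  (Complex.exp (-a * t) - Complex.exp (-b * t)) / (t * (1 - Complex.exp (-(ω * t))))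

/-- The finite part of `∫ exp(-ωt) / t dt`. -/
noncomputable def expIntegralConst (ω : ℝ) : ℂ := finitePart fun t : ℝ => Complex.exp (-(ω * t)) / t

theorem one_sub_exp_ne_zero {ω t : ℝ} (hω : 0 < ω) (ht : 0 < t) :
    (1 - Complex.exp (-(ω * t)) : ℂ) ≠ 0 := by
  have : (1 - Real.exp (-(ω * t)) : ℝ) ≠ 0 := by
    have : Real.exp (-(ω * t)) < 1 := Real.exp_lt_one_iff.2 (by simp; positivity)
    linarith
  exact_mod_cast this

/-- The quotient grows linearly, so any positive exponent `δ` will do; it is chosen below the decay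
rate of the exponentials it multiplies. -/
theorem tame_div_one_sub_exp {ω δ : ℝ} (hω : 0 < ω) (hδ : 0 < δ) :
    Tame δ fun t : ℝ => (t : ℂ) / (1 - Complex.exp (-(ω * t))) := by
  have hF := Tame.exp_sub_exp_div 0 (-ω)
  have hc := tendsto_of_isBigO (Tame.tendsto_exp_sub_exp_div 0 (-ω))
  have hne : ∀ t : ℝ, 0 < t →
      (Complex.exp (0 * t) - Complex.exp (-(ω : ℂ) * t)) / t ≠ 0 := by
    intro t ht
    have h1 := one_sub_exp_ne_zero hω ht
    have : (t : ℂ) ≠ 0 := by exact_mod_cast ht.ne'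
    simp only [zero_mul, Complex.exp_zero, neg_mul]
    positivity
  refine (hF.inv (N := δ) hc (by simpa using hω.ne') hne ?_).congr fun t _ => by simp
  have h1 : (fun t : ℝ => t) =O[atTop] fun t => Real.exp (δ * t) := by
    simpa using (isLittleO_pow_exp_pos_mul_atTop 1 hδ).isBigO
  refine Asymptotics.IsBigO.trans ?_ h1
  refine Asymptotics.IsBigO.of_bound (1 - Real.exp (-ω))⁻¹ ?_
  have hω1 : 0 < 1 - Real.exp (-ω) := by
    have : Real.exp (-ω) < 1 := Real.exp_lt_one_iff.2 (by linarith)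
    linarith
  filter_upwards [eventually_ge_atTop 1] with t ht
  have ht0 : 0 < t := by linarith
  have e1 : (Complex.exp (0 * t) - Complex.exp (-(ω : ℂ) * t)) / t =
      (((1 - Real.exp (-ω * t)) / t : ℝ) : ℂ) := by
    push_cast; simp
  have h2 : Real.exp (-ω * t) ≤ Real.exp (-ω) := by
    gcongr
    nlinarith
  rw [e1, norm_inv, Complex.norm_real, Real.norm_of_nonneg (div_nonneg (by linarith) ht0.le),
    inv_div, Real.norm_of_nonneg ht0.le, div_eq_inv_mul]
  gcongr

theorem hasFinitePart_gammaIntegrand {ω : ℝ} (hω : 0 < ω) {a b : ℂ} (ha : 0 < a.re)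
    (hb : 0 < b.re) :
    HasFinitePart (gammaIntegrand ω a b) ∧ residueAtZero (gammaIntegrand ω a b) = (b - a) / ω := by
  set m := min a.re b.re with hm
  have hmpos : 0 < m := lt_min ha hb
  have h1 := Tame.exp_sub_exp_div (-a) (-b)
  have h2 := tame_div_one_sub_exp hω (half_pos hmpos)
  have e : ∀ t ∈ Ioi (0 : ℝ), (Complex.exp (-a * t) - Complex.exp (-b * t)) / t *
      (t / (1 - Complex.exp (-(ω * t)))) / t = gammaIntegrand ω a b t := by
    intro t ht
    have ht : 0 < t := ht
    have h3 := one_sub_exp_ne_zero hω ht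
    have : (t : ℂ) ≠ 0 := by exact_mod_cast ht.ne'
    unfold gammaIntegrand
    field_simp
  refine ⟨((h1.mul h2).hasFinitePart ?_).congr e, ?_⟩
  · have : max (-a).re (-b).re = -m := by simp [hm, max_neg_neg]
    rw [this]
    linarith
  · rw [← residueAtZero_congr e]
    refine Tame.residueAtZero_div ?_
    have h3 := tendsto_of_isBigO (Tame.tendsto_exp_sub_exp_div (-a) (-b))
    have h4 : Tendsto (fun t : ℝ => (t : ℂ) / (1 - Complex.exp (-(ω * t)))) (𝓝[>] 0)
        (𝓝 (ω : ℂ)⁻¹) := by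
      have h5 := (tendsto_of_isBigO (Tame.tendsto_exp_sub_exp_div 0 (-ω))).inv₀
        (by simpa using hω.ne')
      simpa using h5
    convert h3.mul h4 using 2
    ring

/-- With `y = exp(-ωt)`, the factor `1 - y ^ (n + 1)` turns `1 / (1 - y)` into a finite geometric
sum, so the truncated integrand is a combination of Frullani integrands. The subtracted multiple of
`exp(-ωt) / t` removes the pole at zero. -/
theorem gammaIntegrand_sub_mul {ω : ℝ} (hω : 0 < ω) (a b : ℂ) (n : ℕ) {t : ℝ} (ht : 0 < t) :
    (gammaIntegrand ω a b t - (b - a) / ω * (Complex.exp (-(ω * t)) / t)) *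
        (1 - Complex.exp (-(ω * t)) ^ (n + 1)) =
      (∑ j ∈ Finset.range (n + 1),
        (Complex.exp (-(a + j * ω) * t) - Complex.exp (-(b + j * ω) * t)) / t) -
      (b - a) / ω * ((Complex.exp (-ω * t) - Complex.exp (-((n + 2) * ω) * t)) / t) := by
  have htc : (t : ℂ) ≠ 0 := by exact_mod_cast ht.ne'
  have h1 := one_sub_exp_ne_zero hω ht
  have hgeom := mul_neg_geom_sum (Complex.exp (-(ω * t))) (n + 1)
  have e1 : ∀ (c : ℂ) (j : ℕ), Complex.exp (-(c + j * ω) * t) =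
      Complex.exp (-c * t) * Complex.exp (-(ω * t)) ^ j := by
    intro c j
    rw [← Complex.exp_nat_mul, ← Complex.exp_add]
    ring_nf
  have e2 : Complex.exp (-((n + 2) * ω) * t) =
      Complex.exp (-(ω * t)) * Complex.exp (-(ω * t)) ^ (n + 1) := by
    rw [← Complex.exp_nat_mul, ← Complex.exp_add]
    push_cast
    ring_nf
  have e3 : Complex.exp (-ω * t) = Complex.exp (-(ω * t)) := by ring_nf
  have hs : ∑ j ∈ Finset.range (n + 1),
        (Complex.exp (-(a + j * ω) * t) - Complex.exp (-(b + j * ω) * t)) / t =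
      (Complex.exp (-a * t) - Complex.exp (-b * t)) / t *
        ∑ j ∈ Finset.range (n + 1), Complex.exp (-(ω * t)) ^ j := by
    rw [Finset.mul_sum]
    refine Finset.sum_congr rfl fun j _ => ?_
    rw [e1, e1]
    ring
  rw [hs, e2, e3, sub_mul, gammaIntegrand, ← hgeom]
  congr 1
  · generalize ∑ j ∈ Finset.range (n + 1), Complex.exp (-(ω * t)) ^ j = S
    generalize 1 - Complex.exp (-(ω * t) : ℂ) = y at h1
    field_simp
  · rw [hgeom]
    ring

/-- A quotient of two Euler limits `GammaSeq`. The power of `n` is replaced by that of `n + 2`,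
which is what the truncated integral yields; the ratio of the powers tends to `1`. -/
theorem tendsto_gammaSeq_div (A B : ℂ) (hB : 0 < B.re) :
    Tendsto (fun n : ℕ => (∏ j ∈ Finset.range (n + 1), (B + j) / (A + j)) *
        Complex.exp ((A - B) * Real.log (n + 2))) atTop
      (𝓝 (Complex.Gamma A / Complex.Gamma B)) := by
  have h1 := (Complex.GammaSeq_tendsto_Gamma A).div (Complex.GammaSeq_tendsto_Gamma B)
    (Complex.Gamma_ne_zero_of_re_pos hB)
  have h2 : Tendsto (fun n : ℕ => Complex.exp ((A - B) *
      ((Real.log (n + 2) - Real.log n : ℝ) : ℂ))) atTop (𝓝 1) := by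
    have h3 : Tendsto (fun n : ℕ => Real.log ((n : ℝ) + 2) - Real.log n) atTop (𝓝 0) := by
      have h4 : Tendsto (fun n : ℕ => Real.log (1 + 2 / (n : ℝ))) atTop (𝓝 (Real.log (1 + 0))) := by
        refine Tendsto.log ((tendsto_const_div_atTop_nhds_zero_nat 2).const_add 1) (by simp)
      rw [add_zero, Real.log_one] at h4
      refine h4.congr' ?_
      filter_upwards [eventually_gt_atTop 0] with n hn
      have : (0 : ℝ) < n := by exact_mod_cast hn
      rw [← Real.log_div (by positivity) this.ne']
      congr 1
      field_simp
    have h5 := ((Complex.continuous_ofReal.tendsto 0).comp h3).const_mul (A - B)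
    have h6 := (Complex.continuous_exp.tendsto _).comp h5
    simpa [Function.comp_def] using h6
  have h3 := h1.mul h2
  rw [mul_one] at h3
  refine h3.congr' ?_
  filter_upwards [eventually_gt_atTop 0] with n hn
  have hn0 : (n : ℂ) ≠ 0 := by exact_mod_cast hn.ne'
  have hf : (n.factorial : ℂ) ≠ 0 := by exact_mod_cast n.factorial_ne_zero
  have e1 : (n : ℂ) ^ A / (n : ℂ) ^ B = Complex.exp ((A - B) * Real.log n) := by
    rw [← Complex.cpow_sub _ _ hn0, Complex.cpow_def_of_ne_zero hn0, Complex.natCast_log]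
    ring_nf
  simp only [Pi.div_apply, Complex.GammaSeq]
  rw [Finset.prod_div_distrib]
  have e2 : Complex.exp ((A - B) * Real.log (n + 2)) =
      Complex.exp ((A - B) * Real.log n) *
        Complex.exp ((A - B) * ((Real.log (n + 2) - Real.log n : ℝ) : ℂ)) := by
    rw [← Complex.exp_add]
    push_cast
    ring_nf
  rw [e2, ← e1]
  have hnB : (n : ℂ) ^ B ≠ 0 := by simp [Complex.cpow_eq_zero_iff, hn0]
  field_simp

/-- The finite part of `∫ (exp(-at) - exp(-bt)) / (t (1 - exp(-ωt)))` in terms of `Γ`. -/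
theorem hasExpFinitePart_gammaIntegrand {ω : ℝ} (hω : 0 < ω) {a b : ℂ} (ha : 0 < a.re)
    (hb : 0 < b.re) :
    HasExpFinitePart (gammaIntegrand ω a b)
      (Complex.exp ((b - a) / ω * expIntegralConst ω) *
        (Complex.Gamma (a / ω) / Complex.Gamma (b / ω))) := by
  obtain ⟨hF, hres⟩ := hasFinitePart_gammaIntegrand hω ha hb
  refine ⟨hF, ?_⟩
  have hωc : (ω : ℂ) ≠ 0 := by exact_mod_cast hω.ne'
  have hE : HasFinitePart fun t : ℝ => Complex.exp (-(ω * t)) / t := by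
    have h := (Tame.exp (-ω)).hasFinitePart (by simpa using hω)
    simpa using h
  have hEres : residueAtZero (fun t : ℝ => Complex.exp (-(ω * t)) / t) = 1 := by
    refine Tame.residueAtZero_div ?_
    have : Tendsto (fun t : ℝ => Complex.exp (-(ω * t))) (𝓝 0) (𝓝 (Complex.exp (-(ω * (0 : ℝ))))) :=
      Continuous.tendsto (by fun_prop) 0
    simpa using this.mono_left nhdsWithin_le_nhds
  -- The subtracted multiple of `exp(-ωt) / t` has the same residue at zero, so `h` is integrable.
  -- It contributes the constant `expIntegralConst ω`.
  set h : ℝ → ℂ := fun t => gammaIntegrand ω a b t +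
    -((b - a) / ω) * (Complex.exp (-(ω * t)) / t) with hh
  have hE' := hE.const_mul (-((b - a) / ω))
  have hhF : HasFinitePart h := hF.add hE'
  have hreg : regularized h = h := by
    refine regularized_of_tendsto_zero ?_
    have h1 := hF.tendsto.add (hE.tendsto.const_mul (-((b - a) / ω)))
    rw [hres, hEres] at h1
    refine (h1.congr (f₂ := fun t : ℝ => (t : ℂ) * h t) fun t => by simp only [hh]; ring).trans ?_
    simp
  have hint : IntegrableOn h (Ioi 0) := hreg ▸ hhF.2
  have hsplit : finitePart (gammaIntegrand ω a b) =
      (b - a) / ω * expIntegralConst ω + ∫ t in Ioi 0, h t := by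
    have h1 : finitePart h = ∫ t in Ioi 0, h t := by rw [finitePart, hreg]
    have h2 : finitePart h = finitePart (gammaIntegrand ω a b) +
        -((b - a) / ω) * expIntegralConst ω := by
      rw [hh, finitePart_add hF hE', finitePart_const_mul hE, expIntegralConst]
    rw [← h1, h2]
    ring
  rw [hsplit, Complex.exp_add]
  congr 1
  -- The truncating factor tends to `1` pointwise and is bounded by `2`.
  have hlim : Tendsto (fun n : ℕ => ∫ t in Ioi 0, h t * (1 - Complex.exp (-(ω * t)) ^ (n + 1)))
      atTop (𝓝 (∫ t in Ioi 0, h t)) := by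
    have hlt : ∀ t : ℝ, 0 < t → ‖Complex.exp (-(ω * t))‖ < 1 := by
      intro t ht
      rw [Complex.norm_exp, Real.exp_lt_one_iff]
      simpa using mul_pos hω ht
    refine tendsto_integral_of_dominated_convergence (fun t => ‖h t‖ * 2) ?_ ?_ ?_ ?_
    · intro n
      exact hint.aestronglyMeasurable.mul (Continuous.aestronglyMeasurable (by fun_prop))
    · exact hint.norm.mul_const 2
    · intro n
      filter_upwards [ae_restrict_mem measurableSet_Ioi] with t ht
      rw [norm_mul]
      gcongr
      refine (norm_sub_le _ _).trans ?_
      have : ‖Complex.exp (-(ω * t)) ^ (n + 1)‖ ≤ 1 := by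
        rw [norm_pow]
        exact pow_le_one₀ (norm_nonneg _) (hlt t ht).le
      rw [norm_one]
      linarith
    · filter_upwards [ae_restrict_mem measurableSet_Ioi] with t ht
      have h1 := (tendsto_pow_atTop_nhds_zero_of_norm_lt_one (hlt t ht)).comp
        (tendsto_add_atTop_nat 1)
      simpa using (h1.const_sub 1).const_mul (h t)
  -- A sum of Frullani integrals; in `log((n + 2)ω) - log ω` the scale `ω` cancels.
  have hval : ∀ n : ℕ, ∫ t in Ioi 0, h t * (1 - Complex.exp (-(ω * t)) ^ (n + 1)) =
      (∑ j ∈ Finset.range (n + 1), (Complex.log (b + j * ω) - Complex.log (a + j * ω))) -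
        (b - a) / ω * Real.log (n + 2) := by
    intro n
    have hpos : ∀ (c : ℂ), 0 < c.re → ∀ j : ℕ, 0 < (c + j * ω).re := by
      intro c hc j
      simp only [Complex.add_re, Complex.mul_re, Complex.natCast_re, Complex.ofReal_re,
        Complex.natCast_im, Complex.ofReal_im, mul_zero, sub_zero]
      positivity
    have hωre : 0 < (ω : ℂ).re := by simpa using hω
    have hn2 : 0 < ((n + 2) * ω : ℂ).re := by
      have : ((n + 2) * ω : ℂ) = (((n + 2) * ω : ℝ) : ℂ) := by push_cast; ring
      rw [this, Complex.ofReal_re]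
      positivity
    have hcongr : ∀ t ∈ Ioi (0 : ℝ), h t * (1 - Complex.exp (-(ω * t)) ^ (n + 1)) =
        (∑ j ∈ Finset.range (n + 1),
          (Complex.exp (-(a + j * ω) * t) - Complex.exp (-(b + j * ω) * t)) / t) -
        (b - a) / ω * ((Complex.exp (-ω * t) - Complex.exp (-((n + 2) * ω) * t)) / t) := by
      intro t ht
      rw [← gammaIntegrand_sub_mul hω a b n ht, hh]
      ring
    rw [setIntegral_congr_fun measurableSet_Ioi hcongr, integral_sub, integral_finsetSum, integral_const_mul,
      integral_exp_sub_exp_div hωre hn2]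
    · congr 1
      · exact Finset.sum_congr rfl fun j _ => integral_exp_sub_exp_div (hpos a ha j) (hpos b hb j)
      · congr 1
        have : ((n + 2) * ω : ℂ) = (((n + 2) * ω : ℝ) : ℂ) := by push_cast; ring
        rw [this, ← Complex.ofReal_log (by positivity), ← Complex.ofReal_log hω.le,
          Real.log_mul (by positivity) hω.ne']
        push_cast
        ring
    · exact fun j _ => (hasFinitePart_exp_sub_exp_div (hpos a ha j) (hpos b hb j)).1
    · exact integrable_finsetSum _ fun j _ =>
        (hasFinitePart_exp_sub_exp_div (hpos a ha j) (hpos b hb j)).1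
    · exact (hasFinitePart_exp_sub_exp_div hωre hn2).1.const_mul _
  have hlim2 := (Complex.continuous_exp.tendsto _).comp hlim
  have hB : 0 < (b / ω).re := by
    rw [Complex.div_ofReal_re]
    positivity
  -- The exponentials of the truncated integrals are Euler's products, and limits are unique.
  refine tendsto_nhds_unique hlim2 ((tendsto_gammaSeq_div (a / ω) (b / ω) hB).congr fun n => ?_)
  have hne : ∀ (c : ℂ), 0 < c.re → ∀ j : ℕ, c + j * ω ≠ 0 := by
    intro c hc j h0
    have := congrArg Complex.re h0
    simp only [Complex.add_re, Complex.mul_re, Complex.natCast_re, Complex.ofReal_re,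
      Complex.natCast_im, Complex.ofReal_im, mul_zero, sub_zero, Complex.zero_re] at this
    have : 0 < c.re + j * ω := by positivity
    linarith
  simp only [Function.comp_apply]
  rw [hval, Complex.exp_sub, Complex.exp_sum, eq_div_iff (Complex.exp_ne_zero _), mul_assoc,
    ← Complex.exp_add]
  have e0 : (a / ω - b / ω) * Real.log (n + 2) + (b - a) / ω * Real.log (n + 2) = 0 := by ring
  rw [e0, Complex.exp_zero, mul_one]
  · refine Finset.prod_congr rfl fun j _ => ?_
    rw [Complex.exp_sub, Complex.exp_log (hne b hb j), Complex.exp_log (hne a ha j)]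
    have h1 := hne b hb j
    have h2 := hne a ha j
    have e : ∀ c : ℂ, c / ω + j = (c + j * ω) / ω := fun c => by field_simp
    rw [e, e]
    field_simp

end FreeField

namespace FreeField

/-! ### Contractions with test modes and the Fock space -/

section

variable {ħ ξ k : ℝ}

/-- Modes that are continuous away from `0`. -/
def ContOff (f : Modes) : Prop := ∀ j, ContinuousOn (f j) {0}ᶜ

theorem IsTest.contOff {u : Modes} (hu : IsTest u) : ContOff u := fun j => (hu j).1.continuousOn

theorem ContOff.add {f g : Modes} (hf : ContOff f) (hg : ContOff g) : ContOff (f + g) :=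
  fun j => (hf j).add (hg j)

theorem ContOff.smul {f : Modes} (hf : ContOff f) (a : ℂ) : ContOff (a • f) :=
  fun j => (hf j).const_smul a

theorem ContOff.pos {f : Modes} (hf : ContOff f) (j : Fin 3) : ContinuousOn (f j) (Ioi 0) :=
  (hf j).mono fun _ ht => (ne_of_gt ht : _ ≠ (0 : ℝ))

theorem ContOff.neg_pos {f : Modes} (hf : ContOff f) (j : Fin 3) :
    ContinuousOn (fun t => f j (-t)) (Ioi 0) :=
  (hf j).comp continuousOn_neg fun t ht => by
    have : 0 < t := ht
    simp [this.ne']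

/-- Each `c_j` vanishes linearly at `0`, so `c_j(t) / t` has a limit there. The growth exponent is
an upper bound common to the three bosons. -/
theorem tame_commutator_div (hħ : 0 < ħ) (hξ : 0 < ξ) (hk : 0 < k) (j : Fin 3) :
    Tame (ħ * (2 + k + ξ)) fun t => (commutator ħ ξ k j t : ℂ) / t := by
  have s1 := Tame.sinh_div ħ
  have s2 := Tame.sinh_div (ħ * k / 2)
  have s3 := Tame.sinh_div (ħ * (ξ + k) / 2)
  have s4 := Tame.sinh_div (ħ * (k + 2) / 2)
  have s5 := Tame.div_sinh (b := ħ * ξ / 2) (by positivity)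
  rw [abs_of_pos (by positivity)] at s1 s2 s3 s4
  have e : ∀ x t : ℝ, ħ * x * t / 2 = ħ * x / 2 * t := fun x t => by ring
  have hcast : ∀ t : ℝ, t ∈ Ioi (0 : ℝ) → (t : ℂ) ≠ 0 := fun t ht => by
    have : 0 < t := ht
    exact_mod_cast this.ne'
  fin_cases j
  · refine ((((s1.mul s2).mul (s3.mul s5)).const_mul ((1 / ħ ^ 2 : ℝ) : ℂ)).mono
      (by nlinarith [mul_pos hħ hξ, mul_pos hħ hk])).congr fun t ht => ?_
    have h1 := hcast t ht
    have h2 : Real.sinh (ħ * ξ / 2 * t) ≠ 0 := by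
      have : 0 < t := ht
      exact (Real.sinh_pos_iff.2 (by positivity)).ne'
    have h3 : (Real.sinh (ħ * ξ / 2 * t) : ℂ) ≠ 0 := by exact_mod_cast h2
    simp only [commutator, Matrix.cons_val_zero, Fin.zero_eta, e]
    simp only [Complex.ofReal_mul, Complex.ofReal_div]
    field_simp
  · refine (((s1.mul s4).const_mul ((1 / ħ ^ 2 : ℝ) : ℂ)).mono
      (by nlinarith [mul_pos hħ hξ, mul_pos hħ hk])).congr fun t ht => ?_
    have h1 := hcast t ht
    simp only [commutator, Matrix.cons_val_one, Fin.mk_one, Matrix.cons_val_zero, e]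
    simp only [Complex.ofReal_mul, Complex.ofReal_div]
    field_simp
  · refine (((s1.mul s2).const_mul (-(1 / ħ ^ 2 : ℝ) : ℂ)).mono
      (by nlinarith [mul_pos hħ hξ, mul_pos hħ hk])).congr fun t ht => ?_
    have h1 := hcast t ht
    simp only [commutator, Fin.reduceFinMk, Matrix.cons_val, e]
    simp only [Complex.ofReal_mul, Complex.ofReal_div, Complex.ofReal_neg]
    field_simp

/-- Oddness makes `[a_j(t), a_j(t')]` antisymmetric and turns the negative half-line of a commutator
into the reversed contraction. -/
theorem commutator_neg (j : Fin 3) (t : ℝ) : commutator ħ ξ k j (-t) = -commutator ħ ξ k j t := by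
  fin_cases j <;> simp [commutator, div_neg, neg_div]

theorem continuousOn_commutator (hħ : 0 < ħ) (hξ : 0 < ξ) (hk : 0 < k) (j : Fin 3) :
    ContinuousOn (fun t => (commutator ħ ξ k j t : ℂ)) (Ioi 0) := by
  have h := (tame_commutator_div hħ hξ hk j).cont.mul
    (Complex.continuous_ofReal.continuousOn (s := Ioi 0))
  refine h.congr fun t ht => ?_
  have ht : 0 < t := ht
  have : (t : ℂ) ≠ 0 := by exact_mod_cast ht.ne'
  simp only [Pi.mul_apply]
  field_simp

theorem contractionIntegrand_add_left (f g h : Modes) :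
    contractionIntegrand ħ ξ k (f + g) h =
      fun t => contractionIntegrand ħ ξ k f h t + contractionIntegrand ħ ξ k g h t := by
  funext t
  simp only [contractionIntegrand, ← Finset.sum_add_distrib, Pi.add_apply]
  exact Finset.sum_congr rfl fun j _ => by ring

theorem contractionIntegrand_add_right (f g h : Modes) :
    contractionIntegrand ħ ξ k f (g + h) =
      fun t => contractionIntegrand ħ ξ k f g t + contractionIntegrand ħ ξ k f h t := by
  funext t
  simp only [contractionIntegrand, ← Finset.sum_add_distrib, Pi.add_apply]
  exact Finset.sum_congr rfl fun j _ => by ring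

theorem contractionIntegrand_smul_left (a : ℂ) (f h : Modes) :
    contractionIntegrand ħ ξ k (a • f) h = fun t => a * contractionIntegrand ħ ξ k f h t := by
  funext t
  simp only [contractionIntegrand, Finset.mul_sum, Pi.smul_apply, smul_eq_mul]
  exact Finset.sum_congr rfl fun j _ => by ring

/-- The contraction of `f` with `g` converges. -/
def Contractible (ħ ξ k : ℝ) (f g : Modes) : Prop := HasFinitePart (contractionIntegrand ħ ξ k f g)

theorem Contractible.add_left {f g h : Modes} (h1 : Contractible ħ ξ k f h)
    (h2 : Contractible ħ ξ k g h) : Contractible ħ ξ k (f + g) h := by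
  unfold Contractible
  rw [contractionIntegrand_add_left]
  exact HasFinitePart.add h1 h2

theorem contraction_add_left {f g h : Modes} (h1 : Contractible ħ ξ k f h)
    (h2 : Contractible ħ ξ k g h) :
    contraction ħ ξ k (f + g) h = contraction ħ ξ k f h + contraction ħ ξ k g h := by
  unfold contraction
  rw [contractionIntegrand_add_left]
  exact finitePart_add h1 h2

theorem contraction_add_right {f g h : Modes} (h1 : Contractible ħ ξ k f g)
    (h2 : Contractible ħ ξ k f h) :
    contraction ħ ξ k f (g + h) = contraction ħ ξ k f g + contraction ħ ξ k f h := by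
  unfold contraction
  rw [contractionIntegrand_add_right]
  exact finitePart_add h1 h2

theorem Contractible.smul_left {f h : Modes} (h1 : Contractible ħ ξ k f h) (a : ℂ) :
    Contractible ħ ξ k (a • f) h := by
  unfold Contractible
  rw [contractionIntegrand_smul_left]
  exact HasFinitePart.const_mul h1 a

theorem contraction_smul_left {f h : Modes} (h1 : Contractible ħ ξ k f h) (a : ℂ) :
    contraction ħ ξ k (a • f) h = a * contraction ħ ξ k f h := by
  unfold contraction
  rw [contractionIntegrand_smul_left]
  exact finitePart_const_mul h1 a

theorem IsTest.eventually_zero {u : Modes} (hu : IsTest u) (j : Fin 3) :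
    ∀ᶠ t in 𝓝 (0 : ℝ), u j t = 0 := by
  have h : (tsupport (u j))ᶜ ∈ 𝓝 (0 : ℝ) :=
    (isClosed_tsupport _).isOpen_compl.mem_nhds fun h => (hu j).2.2 h rfl
  filter_upwards [h] with t ht using image_eq_zero_of_notMem_tsupport ht

theorem IsTest.eventually_cocompact {u : Modes} (hu : IsTest u) (j : Fin 3) :
    ∀ᶠ t in cocompact ℝ, u j t = 0 := by
  have h : (tsupport (u j))ᶜ ∈ cocompact ℝ := (hu j).2.1.isCompact.compl_mem_cocompact
  filter_upwards [h] with t ht using image_eq_zero_of_notMem_tsupport ht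

theorem IsTest.vanish {u : Modes} (hu : IsTest u) (s : ℝ) (hs : s = 1 ∨ s = -1) :
    (∀ᶠ t in 𝓝[>] (0 : ℝ), ∀ j, u j (s * t) = 0) ∧ ∀ᶠ t in atTop, ∀ j, u j (s * t) = 0 := by
  have h0 : s ≠ 0 := by rcases hs with rfl | rfl <;> norm_num
  constructor
  · rw [eventually_all]
    intro j
    have h : Tendsto (fun t : ℝ => s * t) (𝓝[>] 0) (𝓝 0) := by
      simpa using tendsto_id_nhdsGT.const_mul s
    exact h.eventually (hu.eventually_zero j)
  · rw [eventually_all]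
    intro j
    have h : Tendsto (fun t : ℝ => s * t) (cocompact ℝ) (cocompact ℝ) :=
      (Homeomorph.mulLeft₀ s h0).isClosedEmbedding.tendsto_cocompact
    exact (h.mono_left atTop_le_cocompact).eventually (hu.eventually_cocompact j)

/-- The contraction of `f` with `g` has an integrand that vanishes near `0` and `∞`. -/
structure TestPair (ħ ξ k : ℝ) (f g : Modes) : Prop where
  cont : ContinuousOn (contractionIntegrand ħ ξ k f g) (Ioi 0)
  zero : ∀ᶠ t in 𝓝[>] (0 : ℝ), contractionIntegrand ħ ξ k f g t = 0
  top : ∀ᶠ t in atTop, contractionIntegrand ħ ξ k f g t = 0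

theorem continuousOn_contractionIntegrand (hħ : 0 < ħ) (hξ : 0 < ξ) (hk : 0 < k) {f g : Modes}
    (hf : ContOff f) (hg : ContOff g) :
    ContinuousOn (contractionIntegrand ħ ξ k f g) (Ioi 0) :=
  continuousOn_finsetSum _ fun j _ =>
    ((continuousOn_commutator hħ hξ hk j).mul (hf.pos j)).mul (hg.neg_pos j)

/-- The test mode vanishes near `0` and outside a compact set, which cuts off any growth of `f`. -/
theorem testPair_right (hħ : 0 < ħ) (hξ : 0 < ξ) (hk : 0 < k) {f u : Modes} (hf : ContOff f)
    (hu : IsTest u) : TestPair ħ ξ k f u := by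
  obtain ⟨h1, h2⟩ := hu.vanish (-1) (Or.inr rfl)
  refine ⟨continuousOn_contractionIntegrand hħ hξ hk hf hu.contOff, ?_, ?_⟩
  · filter_upwards [h1] with t ht
    exact Finset.sum_eq_zero fun j _ => by rw [← neg_one_mul t, ht j, mul_zero]
  · filter_upwards [h2] with t ht
    exact Finset.sum_eq_zero fun j _ => by rw [← neg_one_mul t, ht j, mul_zero]

theorem testPair_left (hħ : 0 < ħ) (hξ : 0 < ξ) (hk : 0 < k) {f u : Modes} (hf : ContOff f)
    (hu : IsTest u) : TestPair ħ ξ k u f := by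
  obtain ⟨h1, h2⟩ := hu.vanish 1 (Or.inl rfl)
  refine ⟨continuousOn_contractionIntegrand hħ hξ hk hu.contOff hf, ?_, ?_⟩
  · filter_upwards [h1] with t ht
    exact Finset.sum_eq_zero fun j _ => by rw [← one_mul t, ht j, mul_zero, zero_mul]
  · filter_upwards [h2] with t ht
    exact Finset.sum_eq_zero fun j _ => by rw [← one_mul t, ht j, mul_zero, zero_mul]

theorem hasFinitePart_of_vanish {F : ℝ → ℂ} (hc : ContinuousOn F (Ioi 0))
    (h0 : ∀ᶠ t in 𝓝[>] 0, F t = 0) (h1 : ∀ᶠ t in atTop, F t = 0) :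
    HasFinitePart F ∧ regularized F = F := by
  have hT : Tame (-1) fun t => (t : ℂ) * F t := by
    refine Tame.of_vanish (by fun_prop) ?_ ?_
    · filter_upwards [h0] with t ht
      rw [ht, mul_zero]
    · filter_upwards [h1] with t ht
      rw [ht, mul_zero]
  refine ⟨(hT.hasFinitePart (by norm_num)).congr fun t ht => ?_, regularized_of_tendsto_zero ?_⟩
  · have ht : 0 < t := ht
    have : (t : ℂ) ≠ 0 := by exact_mod_cast ht.ne'
    field_simp
  · refine tendsto_const_nhds.congr' ?_
    filter_upwards [h0] with t ht
    rw [ht, mul_zero]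

theorem TestPair.contractible {f g : Modes} (h : TestPair ħ ξ k f g) : Contractible ħ ξ k f g :=
  (hasFinitePart_of_vanish h.cont h.zero h.top).1

theorem TestPair.integrableOn {f g : Modes} (h : TestPair ħ ξ k f g) :
    IntegrableOn (contractionIntegrand ħ ξ k f g) (Ioi 0) := by
  obtain ⟨h1, h2⟩ := hasFinitePart_of_vanish h.cont h.zero h.top
  exact h2 ▸ h1.2

theorem TestPair.contraction_eq {f g : Modes} (h : TestPair ħ ξ k f g) :
    contraction ħ ξ k f g = ∫ t in Ioi 0, contractionIntegrand ħ ξ k f g t := by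
  rw [contraction, finitePart, (hasFinitePart_of_vanish h.cont h.zero h.top).2]

/-! #### Polynomials in creation operators -/

/-- The polynomial `p` in the creation operators of test modes applied to the vacuum. -/
noncomputable def fockEval (ħ ξ k : ℝ) : MvPolynomial {u : Modes // IsTest u} ℂ →ₐ[ℂ] State :=
  MvPolynomial.aeval fun u v => contraction ħ ξ k v u.1

/-- Vectors are represented by polynomials so that annihilation operators become derivations, which
can be iterated and commuted algebraically. -/
theorem mem_Fock_iff {Φ : State} : Φ ∈ Fock ħ ξ k ↔ ∃ p, fockEval ħ ξ k p = Φ := by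
  have : {Φ : State | ∃ u, IsTest u ∧ Φ = fun v => contraction ħ ξ k v u} =
      range fun (u : {u : Modes // IsTest u}) (v : Modes) => contraction ħ ξ k v u.1 := by
    ext Φ
    simp only [mem_ofPred_eq, mem_range, Subtype.exists]
    exact ⟨fun ⟨u, hu, h⟩ => ⟨u, hu, h.symm⟩, fun ⟨u, hu, h⟩ => ⟨u, hu, h.symm⟩⟩
  rw [Fock, this, Algebra.adjoin_range_eq_range_aeval]
  rfl

/-- The derivation of polynomials in the creation operators given by the annihilation part
of `f`. -/
noncomputable def annihilation (ħ ξ k : ℝ) (f : Modes) :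
    Derivation ℂ (MvPolynomial {u : Modes // IsTest u} ℂ)
      (MvPolynomial {u : Modes // IsTest u} ℂ) :=
  MvPolynomial.mkDerivation ℂ fun u => MvPolynomial.C (contraction ħ ξ k f u.1)

/-- The commutator of two derivations is a derivation, and it kills the generators because each of
the two sends them to constants. -/
theorem annihilation_comm (f g : Modes) (p : MvPolynomial {u : Modes // IsTest u} ℂ) :
    annihilation ħ ξ k f (annihilation ħ ξ k g p) =
      annihilation ħ ξ k g (annihilation ħ ξ k f p) := by
  have h : ⁅annihilation ħ ξ k f, annihilation ħ ξ k g⁆ = 0 := by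
    refine MvPolynomial.derivation_ext fun u => ?_
    simp [Derivation.commutator_apply, annihilation, MvPolynomial.mkDerivation_X]
  have h1 := congrArg (fun D => D p) h
  simpa [Derivation.commutator_apply, sub_eq_zero] using h1

/-- Along the line `v + s • f` every generator is affine in `s`, with slope `⟨f, u⟩`; the Leibniz
rule does the rest. -/
theorem hasDerivAt_fockEval (hħ : 0 < ħ) (hξ : 0 < ξ) (hk : 0 < k) {f v : Modes} (hf : ContOff f)
    (hv : ContOff v) (p : MvPolynomial {u : Modes // IsTest u} ℂ) (s : ℂ) :
    HasDerivAt (fun s : ℂ => fockEval ħ ξ k p (v + s • f))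
      (fockEval ħ ξ k (annihilation ħ ξ k f p) (v + s • f)) s := by
  induction p using MvPolynomial.induction_on with
  | C a =>
    have h : ∀ w, fockEval ħ ξ k (MvPolynomial.C a) w = a := fun w => by
      simp [fockEval, Pi.algebraMap_apply]
    simpa [h] using hasDerivAt_const s a
  | add p q hp hq =>
    simp only [map_add, Pi.add_apply]
    exact hp.add hq
  | mul_X p u hp =>
    have h1 : HasDerivAt (fun s : ℂ => fockEval ħ ξ k (MvPolynomial.X u) (v + s • f))
        (contraction ħ ξ k f u.1) s := by
      have e : ∀ s : ℂ, fockEval ħ ξ k (MvPolynomial.X u) (v + s • f) =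
          contraction ħ ξ k v u.1 + s * contraction ħ ξ k f u.1 := by
        intro s
        have hc := (testPair_right hħ hξ hk hf u.2).contractible
        simp only [fockEval, MvPolynomial.aeval_X]
        rw [contraction_add_left (testPair_right hħ hξ hk hv u.2).contractible (hc.smul_left s),
          contraction_smul_left hc]
      simp only [e]
      simpa using ((hasDerivAt_id s).mul_const (contraction ħ ξ k f u.1)).const_add
        (contraction ħ ξ k v u.1)
    have h2 := hp.mul h1
    simp only [map_mul, Pi.mul_apply, Derivation.leibniz, smul_eq_mul, map_add, Pi.add_apply]
    have e2 : ∀ w, fockEval ħ ξ k (annihilation ħ ξ k f (MvPolynomial.X u)) w =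
        contraction ħ ξ k f u.1 := fun w => by
      simp [fockEval, annihilation, MvPolynomial.mkDerivation_X, Pi.algebraMap_apply]
    rw [e2]
    refine h2.congr_deriv ?_
    ring

/-- Agreement with a polynomial is required only at modes continuous off `0`, where contractions
with test modes are known to be additive. This class contains the line `v + s • f`, so the lemma can
be iterated. -/
theorem annihilate_fockEval (hħ : 0 < ħ) (hξ : 0 < ξ) (hk : 0 < k) {f : Modes} (hf : ContOff f)
    {Φ : State} {p : MvPolynomial {u : Modes // IsTest u} ℂ}
    (hΦ : ∀ v, ContOff v → Φ v = fockEval ħ ξ k p v) {v : Modes} (hv : ContOff v) :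
    annihilate f Φ v = fockEval ħ ξ k (annihilation ħ ξ k f p) v := by
  have h : (fun s : ℂ => Φ (v + s • f)) = fun s : ℂ => fockEval ħ ξ k p (v + s • f) :=
    funext fun s => hΦ _ (hv.add (hf.smul s))
  unfold annihilate lineDeriv
  rw [h, (hasDerivAt_fockEval hħ hξ hk hf hv p 0).deriv, zero_smul, add_zero]

theorem annihilate_iterate_fockEval (hħ : 0 < ħ) (hξ : 0 < ξ) (hk : 0 < k) {f : Modes}
    (hf : ContOff f) (p : MvPolynomial {u : Modes // IsTest u} ℂ) (n : ℕ) :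
    ∀ v, ContOff v → (annihilate f)^[n] (fockEval ħ ξ k p) v =
      fockEval ħ ξ k ((annihilation ħ ξ k f)^[n] p) v := by
  induction n with
  | zero => simp
  | succ n ih =>
    intro v hv
    rw [Function.iterate_succ_apply', Function.iterate_succ_apply']
    exact annihilate_fockEval hħ hξ hk hf ih hv

theorem boson_fockEval (hħ : 0 < ħ) (hξ : 0 < ξ) (hk : 0 < k) (f : {u : Modes // IsTest u})
    {Φ : State} {p : MvPolynomial {u : Modes // IsTest u} ℂ}
    (hΦ : ∀ v, ContOff v → Φ v = fockEval ħ ξ k p v) {v : Modes} (hv : ContOff v) :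
    boson ħ ξ k f.1 Φ v =
      fockEval ħ ξ k (annihilation ħ ξ k f.1 p + MvPolynomial.X f * p) v := by
  simp only [boson, Pi.add_apply, create, annihilate_fockEval hħ hξ hk f.2.contOff hΦ hv, hΦ v hv,
    map_add, map_mul, Pi.mul_apply]
  simp [fockEval]

theorem integral_eq_sub_of_neg_eq_neg {F G : ℝ → ℂ} (hF : IntegrableOn F (Ioi 0))
    (hG : IntegrableOn G (Ioi 0)) (e : ∀ t, F (-t) = -G t) :
    ∫ t : ℝ, F t = (∫ t in Ioi 0, F t) - ∫ t in Ioi 0, G t := by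
  have e' : ∀ t, F t = -G (-t) := fun t => by rw [← e, neg_neg]
  have h3 : IntegrableOn F (Iic 0) := by
    rw [integrableOn_Iic_iff_integrableOn_Iio]
    have h := (Measure.measurePreserving_neg (volume : Measure ℝ)).integrableOn_comp_preimage
      (Homeomorph.neg ℝ).measurableEmbedding (f := G) (s := Ioi 0)
    have h' : IntegrableOn (fun t => -G (-t)) (Iio 0) := by
      have := (h.2 hG).neg
      simpa [Function.comp_def] using this
    exact h'.congr_fun (fun t _ => (e' t).symm) measurableSet_Iio
  rw [← intervalIntegral.integral_Iic_add_Ioi h3 hF]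
  have h4 := integral_comp_neg_Ioi (0 : ℝ) F
  rw [neg_zero] at h4
  rw [← h4]
  simp only [e]
  rw [integral_neg]
  ring

theorem contractionIntegrand_neg (f g : Modes) (t : ℝ) :
    contractionIntegrand ħ ξ k f g (-t) = -contractionIntegrand ħ ξ k g f t := by
  simp only [contractionIntegrand, commutator_neg, ← Finset.sum_neg_distrib, neg_neg]
  exact Finset.sum_congr rfl fun j _ => by push_cast; ring

/-- The part `t < 0` of the commutator integral, reflected, is minus the contraction in the opposite
order. -/
theorem contraction_sub_contraction (hħ : 0 < ħ) (hξ : 0 < ξ) (hk : 0 < k) {f g : Modes}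
    (hf : IsTest f) (hg : IsTest g) :
    contraction ħ ξ k f g - contraction ħ ξ k g f =
      ∫ t : ℝ, contractionIntegrand ħ ξ k f g t := by
  have h1 := testPair_right hħ hξ hk hf.contOff hg
  have h2 := testPair_right hħ hξ hk hg.contOff hf
  rw [h1.contraction_eq, h2.contraction_eq]
  exact (integral_eq_sub_of_neg_eq_neg h1.integrableOn h2.integrableOn
    (contractionIntegrand_neg f g)).symm

theorem annihilation_X (f g : Modes) (hg : IsTest g) :
    annihilation ħ ξ k f (MvPolynomial.X ⟨g, hg⟩) = MvPolynomial.C (contraction ħ ξ k f g) := by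
  simp [annihilation, MvPolynomial.mkDerivation_X]

theorem fockEval_C (a : ℂ) (v : Modes) : fockEval ħ ξ k (MvPolynomial.C a) v = a := by
  simp [fockEval, Pi.algebraMap_apply]

/-- Derivations commute and multiplications commute. The mixed terms leave, by the Leibniz rule, the
constants `⟨f, g⟩` and `⟨g, f⟩` with opposite signs. -/
theorem boson_commutator (hħ : 0 < ħ) (hξ : 0 < ξ) (hk : 0 < k) {f g v : Modes} (hf : IsTest f)
    (hg : IsTest g) (hv : IsTest v) {Φ : State} (hΦ : Φ ∈ Fock ħ ξ k) :
    boson ħ ξ k f (boson ħ ξ k g Φ) v - boson ħ ξ k g (boson ħ ξ k f Φ) v =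
      (contraction ħ ξ k f g - contraction ħ ξ k g f) * Φ v := by
  obtain ⟨p, rfl⟩ := mem_Fock_iff.1 hΦ
  have h1 := fun (v : Modes) (hv : ContOff v) =>
    boson_fockEval hħ hξ hk ⟨f, hf⟩ (Φ := fockEval ħ ξ k p) (fun _ _ => rfl) hv
  have h2 := fun (v : Modes) (hv : ContOff v) =>
    boson_fockEval hħ hξ hk ⟨g, hg⟩ (Φ := fockEval ħ ξ k p) (fun _ _ => rfl) hv
  rw [boson_fockEval hħ hξ hk ⟨f, hf⟩ h2 hv.contOff, boson_fockEval hħ hξ hk ⟨g, hg⟩ h1 hv.contOff]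
  simp only [map_add, Derivation.leibniz, smul_eq_mul, annihilation_X, annihilation_comm g f,
    map_mul, Pi.add_apply, Pi.mul_apply, fockEval_C]
  ring

theorem boson_vacuum {f : Modes} (h0 : ∀ j t, t < 0 → f j t = 0) : boson ħ ξ k f 1 = 0 := by
  funext v
  have h1 : contraction ħ ξ k v f = 0 := by
    have h2 : EqOn (contractionIntegrand ħ ξ k v f) (fun _ => 0) (Ioi 0) := fun t ht => by
      have ht : 0 < t := ht
      exact Finset.sum_eq_zero fun j _ => by rw [h0 j (-t) (by linarith), mul_zero]
    have h3 : regularized (fun _ => (0 : ℂ)) = fun _ => 0 :=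
      regularized_of_tendsto_zero (by simp)
    rw [contraction, finitePart_congr h2, finitePart, h3]
    simp
  simp [boson, annihilate, create, h1, lineDeriv]

theorem create_iterate (f v : Modes) (n : ℕ) (Ψ : State) :
    (create ħ ξ k f)^[n] Ψ v = contraction ħ ξ k v f ^ n * Ψ v := by
  induction n generalizing Ψ with
  | zero => simp
  | succ n ih =>
    rw [Function.iterate_succ_apply, ih]
    simp only [create]
    ring

theorem normalExp_apply (f : Modes) (Φ : State) (v : Modes) :
    normalExp ħ ξ k f Φ v = Complex.exp (contraction ħ ξ k v f) * Φ (v + f) := rfl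

theorem hasSum_mul_prod {X G : ℕ → ℂ} {a b : ℂ} (h2 : HasSum X a) (h1 : HasSum G b) :
    HasSum (fun n : ℕ × ℕ => X n.1 * G n.2) (a * b) := by
  have h1' := h1.summable.norm
  have h2' := h2.summable.norm
  have hs : Summable fun n : ℕ × ℕ => X n.1 * G n.2 := by
    apply summable_mul_of_summable_norm h2' h1'
  exact h2.mul h1 hs

/-- Applied with `g s = Φ(v + s • f)`: the annihilation series is the Taylor expansion of this
entire function from `0` to `1`, the creation series that of `exp`. Absolute convergence permits the
sum over pairs. -/
theorem hasSum_exp_mul_taylor {g : ℂ → ℂ} (hg : Differentiable ℂ g) (x : ℂ) :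
    HasSum (fun n : ℕ × ℕ =>
        x ^ n.1 / n.1.factorial * ((n.2.factorial : ℂ)⁻¹ * iteratedDeriv n.2 g 0))
      (Complex.exp x * g 1) := by
  have h1 : HasSum (fun n : ℕ => (n.factorial : ℂ)⁻¹ * iteratedDeriv n g 0) (g 1) := by
    simpa using Complex.hasSum_taylorSeries_of_entire hg 0 1
  have h2 : HasSum (fun n : ℕ => x ^ n / n.factorial) (Complex.exp x) := by
    rw [Complex.exp_eq_exp_ℂ]
    exact NormedSpace.expSeries_div_hasSum_exp _
  have h3 := hasSum_mul_prod h2 h1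
  exact h3.congr_fun fun n => rfl

theorem hasSum_normalExp (hħ : 0 < ħ) (hξ : 0 < ξ) (hk : 0 < k) {f v : Modes} (hf : ContOff f)
    (hv : ContOff v) {Φ : State} (hΦ : Φ ∈ Fock ħ ξ k) :
    HasSum (fun n : ℕ × ℕ =>
        (create ħ ξ k f)^[n.1] ((annihilate f)^[n.2] Φ) v / (n.1.factorial * n.2.factorial : ℂ))
      (normalExp ħ ξ k f Φ v) := by
  obtain ⟨p, rfl⟩ := mem_Fock_iff.1 hΦ
  -- Repeated annihilation computes the higher derivatives along the line.
  have hd : ∀ n, iteratedDeriv n (fun s : ℂ => fockEval ħ ξ k p (v + s • f)) =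
      fun s => fockEval ħ ξ k ((annihilation ħ ξ k f)^[n] p) (v + s • f) := by
    intro n
    induction n with
    | zero => simp
    | succ n ih =>
      rw [iteratedDeriv_succ, ih, Function.iterate_succ_apply']
      exact funext fun s => (hasDerivAt_fockEval hħ hξ hk hf hv _ s).deriv
  have hdiff : Differentiable ℂ (fun s : ℂ => fockEval ħ ξ k p (v + s • f)) := fun s =>
    (hasDerivAt_fockEval hħ hξ hk hf hv p s).differentiableAt
  have h3 := hasSum_exp_mul_taylor hdiff (contraction ħ ξ k v f)
  rw [normalExp_apply]
  simp only [hd, zero_smul, add_zero, one_smul] at h3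
  refine h3.congr_fun ?_
  intro n
  rw [create_iterate, annihilate_iterate_fockEval hħ hξ hk hf p n.2 v hv]
  field_simp

theorem isBosonicFockSpace (hħ : 0 < ħ) (hξ : 0 < ξ) (hk : 0 < k) :
    IsBosonicFockSpace ħ ξ k where
  comm _ _ _ hf hg hv _ hΦ := by
    rw [boson_commutator hħ hξ hk hf hg hv hΦ, contraction_sub_contraction hħ hξ hk hf hg]
    rfl
  vacuum _ _ h0 := boson_vacuum h0
  normalExp_hasSum _ _ hf hv _ hΦ := hasSum_normalExp hħ hξ hk hf hv.contOff hΦ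

end

end FreeField

namespace FreeField

/-! ### Convergence of the contractions of the currents -/

/-- A coefficient function `exp(iαt) f(t)`, where `t f(± t)` is of growth at most `exp(M t)`. -/
structure CoeffFamily (M : ℝ) (f : ℂ → ℝ → ℂ) : Prop where
  shift : ∀ α t, f α t = Complex.exp (Complex.I * α * t) * f 0 t
  cont : ContinuousOn (f 0) {0}ᶜ
  pos : Tame M fun t => t * f 0 t
  neg : Tame M fun t => t * f 0 (-t)

namespace CoeffFamily

variable {M N : ℝ} {f g : ℂ → ℝ → ℂ}

theorem mono (hf : CoeffFamily M f) (h : M ≤ N) : CoeffFamily N f :=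
  ⟨hf.shift, hf.cont, hf.pos.mono h, hf.neg.mono h⟩

theorem zero (hM : 0 ≤ M) : CoeffFamily M fun _ _ => 0 := by
  have h : Tame M fun t : ℝ => (t : ℂ) * 0 := by simpa using (Tame.const 0).mono hM
  exact ⟨by simp, continuousOn_const, h, h⟩

theorem add (hf : CoeffFamily M f) (hg : CoeffFamily M g) :
    CoeffFamily M fun α t => f α t + g α t := by
  refine ⟨fun α t => by rw [hf.shift, hg.shift]; ring, hf.cont.add hg.cont, ?_, ?_⟩
  · have h := hf.pos.add hg.pos
    rw [max_self] at h
    exact h.congr fun t _ => by ring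
  · have h := hf.neg.add hg.neg
    rw [max_self] at h
    exact h.congr fun t _ => by ring

theorem const_mul (hf : CoeffFamily M f) (a : ℂ) : CoeffFamily M fun α t => a * f α t :=
  ⟨fun α t => by rw [hf.shift]; ring, continuousOn_const.mul hf.cont,
    (hf.pos.const_mul a).congr fun t _ => by ring, (hf.neg.const_mul a).congr fun t _ => by ring⟩

end CoeffFamily

theorem tame_id {δ : ℝ} (hδ : 0 < δ) : Tame δ fun t : ℝ => (t : ℂ) := by
  refine ⟨by fun_prop, ⟨0, ?_⟩, ?_⟩
  · refine Asymptotics.IsBigO.of_bound 1 (Eventually.of_forall fun t => by simp)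
  · refine Asymptotics.IsBigO.trans ?_ (isLittleO_pow_exp_pos_mul_atTop 1 hδ).isBigO
    exact Asymptotics.IsBigO.of_bound 1 (Eventually.of_forall fun t => by simp)

theorem sinh_mul_ne_zero {b t : ℝ} (hb : 0 < b) (ht : t ≠ 0) : Real.sinh (b * t) ≠ 0 := by
  rw [Ne, Real.sinh_eq_zero]
  positivity

theorem tame_exp_real (x : ℝ) : Tame x fun t : ℝ => Complex.exp (x * t) := by
  simpa using Tame.exp x

/-- The coefficient has at most a simple pole at zero, so `t` times it is tame. The decay of `1 /
sinh` at infinity is not exploited. -/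
theorem coeffFamily_fieldCoeff {ħ A B C D : ℝ} (hħ : 0 < ħ) (hB : 0 < B) (hC : 0 < C) :
    CoeffFamily (|ħ * A / 2| + |ħ * D / 2|) fun α => fieldCoeff ħ A B C α D := by
  have hB' : 0 < ħ * B / 2 := by positivity
  have hC' : 0 < ħ * C / 2 := by positivity
  have e : ∀ x t : ℝ, ħ * x * t / 2 = ħ * x / 2 * t := fun x t => by ring
  have hT := (((Tame.sinh_div (ħ * A / 2)).mul
    ((Tame.div_sinh hB').mul (Tame.div_sinh hC'))).mul (tame_exp_real (ħ * D / 2))).const_mul ħ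
  have hT' := hT.mono (N := |ħ * A / 2| + |ħ * D / 2|)
    (by linarith [le_abs_self (ħ * D / 2)])
  have key : ∀ t : ℝ, 0 < t → (ħ : ℂ) * ((((Real.sinh (ħ * A / 2 * t) / t : ℝ) : ℂ) *
      (((t / Real.sinh (ħ * B / 2 * t) : ℝ) : ℂ) * ((t / Real.sinh (ħ * C / 2 * t) : ℝ) : ℂ))) *
        Complex.exp ((ħ * D / 2 : ℝ) * t)) = t * fieldCoeff ħ A B C 0 D t := by
    intro t ht
    have htc : (t : ℂ) ≠ 0 := by exact_mod_cast ht.ne'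
    have h1 : (Real.sinh (ħ * B / 2 * t) : ℂ) ≠ 0 := by
      exact_mod_cast sinh_mul_ne_zero hB' ht.ne'
    have h2 : (Real.sinh (ħ * C / 2 * t) : ℂ) ≠ 0 := by
      exact_mod_cast sinh_mul_ne_zero hC' ht.ne'
    simp only [fieldCoeff, e, mul_zero, zero_mul, zero_add, abs_of_pos ht, Complex.ofReal_mul,
      Complex.ofReal_div, Complex.ofReal_ofNat]
    field_simp
  have odd : ∀ t : ℝ, fieldCoeff ħ A B C 0 D (-t) = -fieldCoeff ħ A B C 0 D t := by
    intro t
    simp only [fieldCoeff, e, abs_neg, mul_zero, zero_mul]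
    simp only [mul_neg, Real.sinh_neg]
    push_cast
    ring
  refine ⟨fun α t => ?_, ?_, hT'.congr fun t ht => key t ht, ?_⟩
  · simp only [fieldCoeff, mul_zero, zero_mul, zero_add, Complex.exp_add]
    ring
  · unfold fieldCoeff
    refine ContinuousOn.mul (ContinuousOn.mul continuousOn_const ?_) (by fun_prop)
    refine Complex.continuous_ofReal.comp_continuousOn ?_
    refine ContinuousOn.div (by fun_prop) (by fun_prop) fun t ht => ?_
    rw [e, e]
    exact mul_ne_zero (sinh_mul_ne_zero hB' ht) (sinh_mul_ne_zero hC' ht)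
  · refine hT'.neg.congr fun t ht => ?_
    simp only [odd]
    rw [key t ht]
    ring

theorem coeffFamily_fieldPrime {ħ ξ k A B C D : ℝ} (hħ : 0 < ħ) (hξ : 0 < ξ) (hk : 0 < k)
    (hB : 0 < B) (hC : 0 < C) :
    CoeffFamily (|ħ * A / 2| + |ħ * D / 2| + ħ * ξ / 2)
      fun α t => (primeRatio ħ ξ k t : ℂ) * fieldCoeff ħ A B C α D t := by
  have hF := coeffFamily_fieldCoeff (A := A) (D := D) hħ hB hC
  have h1 : 0 < ħ * (ξ + k) / 2 := by positivity
  have e : ∀ x t : ℝ, ħ * x * t / 2 = ħ * x / 2 * t := fun x t => by ring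
  have hR : Tame (ħ * ξ / 2) fun t => (primeRatio ħ ξ k t : ℂ) := by
    have h := (Tame.sinh_div (ħ * ξ / 2)).mul (Tame.div_sinh h1)
    rw [add_zero, abs_of_pos (by positivity)] at h
    refine h.congr fun t ht => ?_
    have ht : 0 < t := ht
    have h2 := sinh_mul_ne_zero h1 ht.ne'
    simp only [primeRatio, e, ← Complex.ofReal_mul]
    congr 1
    field_simp
  have even : ∀ t : ℝ, primeRatio ħ ξ k (-t) = primeRatio ħ ξ k t := by
    intro t
    simp only [primeRatio, e]
    simp only [mul_neg, Real.sinh_neg, neg_div_neg_eq]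
  refine ⟨fun α t => by rw [hF.shift]; ring, ?_, (hF.pos.mul hR).congr fun t _ => by ring,
    (hF.neg.mul hR).congr fun t _ => by rw [even]; ring⟩
  refine ContinuousOn.mul (Complex.continuous_ofReal.comp_continuousOn ?_) hF.cont
  unfold primeRatio
  refine ContinuousOn.div (by fun_prop) (by fun_prop) fun t ht => ?_
  rw [e]
  exact sinh_mul_ne_zero h1 ht

theorem units_int_cases (s : ℤˣ) : s = 1 ∨ s = -1 := Int.units_eq_one_or s

/-- The summand `1` in the exponent pays for the factor `t`, as there is no pole to absorb it. The
cutoff keeps continuity off `0` because the sign of `s t` is locally constant there. -/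
theorem coeffFamily_halfFieldCoeff {ħ A B C : ℝ} (hħ : 0 < ħ) (s : ℤˣ) (hB : 0 < B) :
    CoeffFamily (1 + |ħ * A / 2| + |ħ * C / 2|) fun α => halfFieldCoeff ħ s A B α C := by
  have hB' : 0 < ħ * B / 2 := by positivity
  have e : ∀ x t : ℝ, ħ * x * t / 2 = ħ * x / 2 * t := fun x t => by ring
  have hT := (((tame_id one_pos).mul ((Tame.sinh_div (ħ * A / 2)).mul (Tame.div_sinh hB'))).mul
    (tame_exp_real (ħ * C / 2))).const_mul (2 * ħ)
  have hT' := hT.mono (N := 1 + |ħ * A / 2| + |ħ * C / 2|)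
    (by linarith [le_abs_self (ħ * C / 2)])
  have key : ∀ t : ℝ, 0 < t → (2 * ħ : ℂ) * ((t * (((Real.sinh (ħ * A / 2 * t) / t : ℝ) : ℂ) *
      ((t / Real.sinh (ħ * B / 2 * t) : ℝ) : ℂ))) * Complex.exp ((ħ * C / 2 : ℝ) * t)) =
      t * (2 * ħ * (Real.sinh (ħ * A * t / 2) / Real.sinh (ħ * B * t / 2) : ℝ) *
      Complex.exp (ħ * C / 2 * t)) := by
    intro t ht
    have htc : (t : ℂ) ≠ 0 := by exact_mod_cast ht.ne'
    have h1 : (Real.sinh (ħ * B / 2 * t) : ℂ) ≠ 0 := by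
      exact_mod_cast sinh_mul_ne_zero hB' ht.ne'
    simp only [e, Complex.ofReal_mul, Complex.ofReal_div, Complex.ofReal_ofNat]
    field_simp
  have hz : Tame (1 + |ħ * A / 2| + |ħ * C / 2|) fun t : ℝ => (t : ℂ) * 0 := by
    simpa using (Tame.const 0).mono (N := 1 + |ħ * A / 2| + |ħ * C / 2|) (by positivity)
  have hcont : ∀ x : ℝ, ContinuousOn (fun t : ℝ =>
      2 * ħ * ((Real.sinh (ħ * A * |t| / 2) / Real.sinh (ħ * B * |t| / 2) : ℝ) : ℂ) *
      Complex.exp (Complex.I * (0 : ℂ) * t + ħ * C / 2 * |t|)) {0}ᶜ := by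
    intro x
    refine ContinuousOn.mul (ContinuousOn.mul continuousOn_const ?_) (by fun_prop)
    refine Complex.continuous_ofReal.comp_continuousOn ?_
    refine ContinuousOn.div (by fun_prop) (by fun_prop) fun t ht => ?_
    rw [e]
    exact sinh_mul_ne_zero hB' (abs_ne_zero.2 ht)
  refine ⟨fun α t => ?_, ?_, ?_, ?_⟩
  · simp only [halfFieldCoeff]
    split_ifs
    · simp only [mul_zero, zero_mul, zero_add, Complex.exp_add]
      ring
    · simp
  · intro t ht
    have ht : t ≠ 0 := ht
    refine ContinuousAt.continuousWithinAt ?_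
    have hs : (((s : ℤ) : ℝ)) ≠ 0 := by rcases units_int_cases s with rfl | rfl <;> simp
    rcases lt_or_gt_of_ne (mul_ne_zero hs ht) with h | h
    · refine (continuousAt_const (y := (0 : ℂ))).congr ?_
      have : ∀ᶠ x in 𝓝 t, ((s : ℤ) : ℝ) * x < 0 :=
        (isOpen_Iio.preimage (continuous_const_mul ((s : ℤ) : ℝ))).mem_nhds h
      filter_upwards [this] with x hx
      simp only [halfFieldCoeff, if_neg (not_lt.2 hx.le)]
    · refine ContinuousAt.congr ((hcont 0).continuousAt (isOpen_compl_singleton.mem_nhds ht)) ?_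
      have : ∀ᶠ x in 𝓝 t, 0 < ((s : ℤ) : ℝ) * x :=
        (isOpen_Ioi.preimage (continuous_const_mul ((s : ℤ) : ℝ))).mem_nhds h
      filter_upwards [this] with x hx
      simp only [halfFieldCoeff, if_pos hx]
  · rcases units_int_cases s with rfl | rfl
    · refine hT'.congr fun t ht => ?_
      have ht : 0 < t := ht
      simp only [key t ht, halfFieldCoeff, Units.val_one, Int.cast_one, one_mul, if_pos ht,
        abs_of_pos ht, mul_zero, zero_mul, zero_add]
    · refine hz.congr fun t ht => ?_
      have ht : 0 < t := ht
      simp [halfFieldCoeff, not_lt.2 ht.le]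
  · rcases units_int_cases s with rfl | rfl
    · refine hz.congr fun t ht => ?_
      have ht : 0 < t := ht
      simp [halfFieldCoeff, not_lt.2 ht.le]
    · refine hT'.congr fun t ht => ?_
      have ht : 0 < t := ht
      simp only [key t ht, halfFieldCoeff, Units.val_neg, Units.val_one, Int.cast_neg,
        Int.cast_one, neg_mul_neg, one_mul, if_pos ht, abs_neg,
        abs_of_pos ht, mul_zero, zero_mul, zero_add]

/-- A family of modes all of whose components are coefficient families. -/
def ModeFamily (M : ℝ) (f : ℂ → Modes) : Prop := ∀ j, CoeffFamily M fun α => f α j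

section

variable {M ħ ξ k : ℝ} {f g : ℂ → Modes}

theorem ModeFamily.add (hf : ModeFamily M f) (hg : ModeFamily M g) :
    ModeFamily M fun α => f α + g α := fun j => (hf j).add (hg j)

theorem ModeFamily.smul (hf : ModeFamily M f) (a : ℂ) : ModeFamily M fun α => a • f α :=
  fun j => (hf j).const_mul a

theorem ModeFamily.neg (hf : ModeFamily M f) : ModeFamily M fun α => -f α := by
  simpa using hf.smul (-1)

theorem ModeFamily.sub (hf : ModeFamily M f) (hg : ModeFamily M g) :
    ModeFamily M fun α => f α - g α := by
  simpa [sub_eq_add_neg] using hf.add hg.neg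

theorem ModeFamily.single {F : ℂ → ℝ → ℂ} (hF : CoeffFamily M F) (hM : 0 ≤ M) (j : Fin 3) :
    ModeFamily M fun α => Pi.single j (F α) := by
  intro i
  rcases eq_or_ne i j with rfl | h
  · simpa using hF
  · simp only [Pi.single_eq_of_ne h]
    exact CoeffFamily.zero hM

theorem ModeFamily.contOff (hf : ModeFamily M f) (α : ℂ) : ContOff (f α) := by
  intro j
  have h : f α j = fun t : ℝ => Complex.exp (Complex.I * α * t) * f 0 j t :=
    funext fun t => (hf j).shift α t
  rw [h]
  exact ContinuousOn.mul (by fun_prop) (hf j).cont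

/-- The first exponent carries `exp(iαt)` and the second, taken at `-t`, carries `exp(-iβt)`.
Contractions are thus functions of `α - β`, and `Im (α - β)` is the rate of decay of the integrand.
-/
theorem contractionIntegrand_family (hf : ModeFamily M f) (hg : ModeFamily M g) (α β : ℂ) (t : ℝ) :
    contractionIntegrand ħ ξ k (f α) (g β) t =
      Complex.exp (Complex.I * (α - β) * t) * contractionIntegrand ħ ξ k (f 0) (g 0) t := by
  simp only [contractionIntegrand, Finset.mul_sum]
  refine Finset.sum_congr rfl fun j _ => ?_
  rw [(hf j).shift α, (hg j).shift β]
  have : Complex.exp (Complex.I * (α - β) * t) = Complex.exp (Complex.I * α * t) *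
      Complex.exp (Complex.I * β * (-t : ℝ)) := by
    rw [← Complex.exp_add]
    push_cast
    ring_nf
  rw [this]
  ring

theorem tame_contractionIntegrand (hħ : 0 < ħ) (hξ : 0 < ξ) (hk : 0 < k) (hf : ModeFamily M f)
    (hg : ModeFamily M g) :
    Tame (ħ * (2 + k + ξ) + 2 * M)
      fun t => (t : ℂ) * contractionIntegrand ħ ξ k (f 0) (g 0) t := by
  -- The zero of `c_j` and the poles of the two coefficients combine to at most a simple pole; the
  -- powers of `t` are distributed accordingly.
  have h : ∀ j, Tame (ħ * (2 + k + ξ) + 2 * M) fun t =>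
      (commutator ħ ξ k j t : ℂ) / t * (t * f 0 j t) * (t * g 0 j (-t)) := fun j =>
    (((tame_commutator_div hħ hξ hk j).mul (hf j).pos).mul (hg j).neg).mono (by linarith)
  have h2 := ((h 0).add (h 1)).add (h 2)
  simp only [max_self] at h2
  refine h2.congr fun t ht => ?_
  have ht : 0 < t := ht
  have htc : (t : ℂ) ≠ 0 := by exact_mod_cast ht.ne'
  simp only [contractionIntegrand, Fin.sum_univ_three]
  field_simp

theorem contractible_family (hħ : 0 < ħ) (hξ : 0 < ξ) (hk : 0 < k) (hf : ModeFamily M f)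
    (hg : ModeFamily M g) {α β : ℂ} (h : ħ * (2 + k + ξ) + 2 * M < (α - β).im) :
    Contractible ħ ξ k (f α) (g β) := by
  have h1 := (tame_contractionIntegrand hħ hξ hk hf hg).mul (Tame.exp (Complex.I * (α - β)))
  refine (h1.hasFinitePart ?_).congr fun t ht => ?_
  · simp only [Complex.mul_re, Complex.I_re, Complex.I_im, zero_mul, one_mul, zero_sub]
    linarith
  · have ht : 0 < t := ht
    have htc : (t : ℂ) ≠ 0 := by exact_mod_cast ht.ne'
    rw [contractionIntegrand_family hf hg]
    field_simp

/-- A common growth exponent of the modes of the currents. -/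
def growthBound (ħ ξ k : ℝ) : ℝ := 1 + ħ * (2 + k + ξ)

theorem growthBound_nonneg (hħ : 0 < ħ) (hξ : 0 < ξ) (hk : 0 < k) : 0 ≤ growthBound ħ ξ k := by
  unfold growthBound; positivity

theorem modeFamily_field (hħ : 0 < ħ) (hξ : 0 < ξ) (hk : 0 < k) {B C D : ℝ} (hB : 0 < B)
    (hC : 0 < C) (hD : |D| ≤ k + 2) (j : Fin 3) :
    ModeFamily (growthBound ħ ξ k) fun α => field ħ j 1 B C α D := by
  refine ModeFamily.single ((coeffFamily_fieldCoeff hħ hB hC).mono ?_)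
    (growthBound_nonneg hħ hξ hk) j
  have h1 : |ħ * D / 2| ≤ ħ * (k + 2) / 2 := by
    rw [abs_div, abs_mul, abs_of_pos hħ, abs_two]
    gcongr
  have h2 : |ħ * 1 / 2| = ħ / 2 := by rw [mul_one, abs_of_pos (by positivity)]
  unfold growthBound
  nlinarith [mul_pos hħ hξ, mul_pos hħ hk]

theorem modeFamily_fieldPrime (hħ : 0 < ħ) (hξ : 0 < ξ) (hk : 0 < k) {B C D : ℝ} (hB : 0 < B)
    (hC : 0 < C) (hD : |D| ≤ k + 2) :
    ModeFamily (growthBound ħ ξ k) fun α => fieldPrime ħ ξ k 1 B C α D := by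
  refine ModeFamily.single ((coeffFamily_fieldPrime hħ hξ hk hB hC).mono ?_)
    (growthBound_nonneg hħ hξ hk) 0
  have h1 : |ħ * D / 2| ≤ ħ * (k + 2) / 2 := by
    rw [abs_div, abs_mul, abs_of_pos hħ, abs_two]
    gcongr
  have h2 : |ħ * 1 / 2| = ħ / 2 := by rw [mul_one, abs_of_pos (by positivity)]
  unfold growthBound
  nlinarith [mul_pos hħ hξ, mul_pos hħ hk]

theorem modeFamily_halfField (hħ : 0 < ħ) (hξ : 0 < ξ) (hk : 0 < k) {B D : ℝ} (hB : 0 < B)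
    (hD : |D| ≤ k + 2) (s : ℤˣ) (j : Fin 3) :
    ModeFamily (growthBound ħ ξ k) fun α => halfField ħ s j 1 B α D := by
  refine ModeFamily.single ((coeffFamily_halfFieldCoeff hħ s hB).mono ?_)
    (growthBound_nonneg hħ hξ hk) j
  have h1 : |ħ * D / 2| ≤ ħ * (k + 2) / 2 := by
    rw [abs_div, abs_mul, abs_of_pos hħ, abs_two]
    gcongr
  have h2 : |ħ * 1 / 2| = ħ / 2 := by rw [mul_one, abs_of_pos (by positivity)]
  unfold growthBound
  nlinarith [mul_pos hħ hξ, mul_pos hħ hk]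

theorem modeFamily_kExponent (hħ : 0 < ħ) (hξ : 0 < ξ) (hk : 0 < k) :
    ModeFamily (growthBound ħ ξ k) (kExponent ħ ξ k) :=
  (modeFamily_field hħ hξ hk two_pos (by positivity) (by simp; positivity) 0).neg

theorem modeFamily_paraExponent (hħ : 0 < ħ) (hξ : 0 < ξ) (hk : 0 < k) (s u : ℤˣ) :
    ModeFamily (growthBound ħ ξ k) (paraExponent ħ k s u) := by
  have hs : |((s : ℤ) : ℝ)| = 1 := by rcases units_int_cases s with rfl | rfl <;> simp
  have h1 : |((s : ℤ) : ℝ) * k / 2| ≤ k + 2 := by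
    rw [abs_div, abs_mul, hs, abs_of_pos hk, abs_two]; linarith
  have h2 : |-(((s : ℤ) : ℝ) * (k + 2) / 2)| ≤ k + 2 := by
    rw [abs_neg, abs_div, abs_mul, hs, abs_of_pos (by positivity : 0 < k + 2), abs_two]; linarith
  exact (((modeFamily_field hħ hξ hk one_pos hk h1 2).smul _).sub
    ((modeFamily_halfField hħ hξ hk two_pos h2 u 2).smul _)).add
    ((modeFamily_halfField hħ hξ hk two_pos (by rwa [abs_neg]) u 1).smul _)

theorem modeFamily_eField (hħ : 0 < ħ) (hξ : 0 < ξ) (hk : 0 < k) :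
    ModeFamily (growthBound ħ ξ k) fun α => -field ħ 0 1 1 k α 0 :=
  (modeFamily_field hħ hξ hk one_pos hk (by simp; positivity) 0).neg

theorem modeFamily_fField (hħ : 0 < ħ) (hξ : 0 < ξ) (hk : 0 < k) :
    ModeFamily (growthBound ħ ξ k) fun α => fieldPrime ħ ξ k 1 1 k α 0 :=
  modeFamily_fieldPrime hħ hξ hk one_pos hk (by simp; positivity)

theorem modeFamily_of_mem_exponents (hħ : 0 < ħ) (hξ : 0 < ξ) (hk : 0 < k)
    (hf : f ∈ exponents ħ ξ k) : ModeFamily (growthBound ħ ξ k) f := by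
  rcases hf with (rfl | rfl | rfl) | ⟨s, u, rfl⟩
  · exact modeFamily_kExponent hħ hξ hk
  · exact modeFamily_eField hħ hξ hk
  · exact modeFamily_fField hħ hξ hk
  · exact modeFamily_paraExponent hħ hξ hk s u

/-- All contractions converge for `Im (α - β)` above this number. -/
def contractionBound (ħ ξ k : ℝ) : ℝ := 3 * (ħ * (2 + k + ξ)) + 2

theorem contractible_of_modeFamily (hħ : 0 < ħ) (hξ : 0 < ξ) (hk : 0 < k)
    (hf : ModeFamily (growthBound ħ ξ k) f) (hg : ModeFamily (growthBound ħ ξ k) g) {α β : ℂ}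
    (h : contractionBound ħ ξ k < (α - β).im) : Contractible ħ ξ k (f α) (g β) := by
  refine contractible_family hħ hξ hk hf hg ?_
  unfold contractionBound at h
  unfold growthBound
  linarith

theorem commutator_zero_apply (t : ℝ) : commutator ħ ξ k 0 t = 1 / ħ ^ 2 *
    (Real.sinh (ħ * t) * Real.sinh (ħ * k * t / 2) * Real.sinh (ħ * (ξ + k) * t / 2) /
      (t * Real.sinh (ħ * ξ * t / 2))) := rfl

theorem commutator_one_apply (t : ℝ) : commutator ħ ξ k 1 t = 1 / ħ ^ 2 *
    (Real.sinh (ħ * t) * Real.sinh (ħ * (k + 2) * t / 2) / t) := rfl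

theorem commutator_two_apply (t : ℝ) : commutator ħ ξ k 2 t = -(1 / ħ ^ 2 *
    (Real.sinh (ħ * t) * Real.sinh (ħ * k * t / 2) / t)) := rfl

/-- The denominator dominates the numerator. Separate bounds would only give the exponent `a`, and
`contractible_kExponent` has no room for such a loss. -/
theorem tame_sinh_div_sinh {a b : ℝ} (ha : 0 < a) (hab : a ≤ b) :
    Tame 0 fun t => ((Real.sinh (a * t) / Real.sinh (b * t) : ℝ) : ℂ) := by
  have hb := ha.trans_le hab
  have h := (Tame.sinh_div a).mul (Tame.div_sinh hb)
  have e : EqOn (fun t : ℝ => ((Real.sinh (a * t) / t : ℝ) : ℂ) *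
      ((t / Real.sinh (b * t) : ℝ) : ℂ))
      (fun t => ((Real.sinh (a * t) / Real.sinh (b * t) : ℝ) : ℂ)) (Ioi 0) := fun t ht => by
    have ht : 0 < t := ht
    have := sinh_mul_ne_zero hb ht.ne'
    simp only [← Complex.ofReal_mul]
    congr 1
    field_simp
  obtain ⟨h1, h2, -⟩ := h.congr e
  refine ⟨h1, h2, Asymptotics.IsBigO.of_bound 1 ?_⟩
  filter_upwards [eventually_gt_atTop 0] with t ht
  have h3 : 0 < Real.sinh (a * t) := Real.sinh_pos_iff.2 (by positivity)
  have h4 : Real.sinh (a * t) ≤ Real.sinh (b * t) := Real.sinh_le_sinh.2 (by gcongr)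
  rw [Complex.norm_real, Real.norm_of_nonneg (div_nonneg h3.le (h3.le.trans h4))]
  simpa using div_le_one_of_le₀ h4 (h3.le.trans h4)

/-- The contraction inside `H^±` converges. -/
theorem contractible_kExponent (hħ : 0 < ħ) (hξ : 0 < ξ) (hk : 0 < k) {α β : ℂ}
    (h : α - β = Complex.I * ħ) :
    Contractible ħ ξ k (kExponent ħ ξ k α) (kExponent ħ ξ k β) := by
  have hF := modeFamily_kExponent hħ hξ hk
  -- Here `Im (α - β) = ħ` lies below the general bound, so the integrand is regrouped into bounded
  -- quotients of hyperbolic sines and one `sinh(ħt/2)`. Its growth `ħ / 2` is beaten by `exp(-ħt)`.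
  have T := ((((tame_sinh_div_sinh (a := ħ * k / 2) (b := ħ * (ξ + k) / 2) (by positivity)
    (by gcongr; linarith)).mul ((tame_sinh_div_sinh (a := ħ / 2) (b := ħ) (by positivity)
    (by linarith)).mul (Tame.div_sinh (b := ħ * ξ / 2) (by positivity)))).mul
    ((Tame.exp_sub_exp_div (ħ / 2 : ℝ) (-(ħ / 2 : ℝ))).mul
      (Tame.exp (Complex.I * (Complex.I * ħ))))).const_mul (-(1 / 2)))
  refine (T.hasFinitePart ?_).congr fun t ht => ?_
  · have h1 : (Complex.I * (Complex.I * ħ)).re = -ħ := by simp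
    have h2 : max ((ħ / 2 : ℝ) : ℂ).re (-((ħ / 2 : ℝ) : ℂ)).re = ħ / 2 := by
      simp only [Complex.neg_re, Complex.ofReal_re]
      exact max_eq_left (by linarith)
    rw [h1, h2]
    linarith
  · have ht : 0 < t := ht
    have htc : (t : ℂ) ≠ 0 := by exact_mod_cast ht.ne'
    have e : ∀ x t : ℝ, ħ * x * t / 2 = ħ * x / 2 * t := fun x t => by ring
    have n1 : (Real.sinh (ħ * (ξ + k) / 2 * t) : ℂ) ≠ 0 := by
      exact_mod_cast sinh_mul_ne_zero (by positivity) ht.ne'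
    have n2 : (Real.sinh (ħ * t) : ℂ) ≠ 0 := by
      exact_mod_cast sinh_mul_ne_zero (by positivity) ht.ne'
    have n3 : (Real.sinh (ħ * ξ / 2 * t) : ℂ) ≠ 0 := by
      exact_mod_cast sinh_mul_ne_zero (by positivity) ht.ne'
    have n4 : (ħ : ℂ) ≠ 0 := by exact_mod_cast hħ.ne'
    have e5 : (Complex.exp ((ħ / 2 : ℝ) * t) - Complex.exp (-((ħ / 2 : ℝ) : ℂ) * t)) =
        2 * (Real.sinh (ħ / 2 * t) : ℂ) := by
      rw [Complex.ofReal_sinh, Complex.sinh]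
      push_cast
      ring_nf
    beta_reduce
    rw [contractionIntegrand_family hF hF, h, e5]
    simp only [contractionIntegrand, Fin.sum_univ_three, kExponent, Pi.neg_apply, field,
      Pi.single_eq_same, ne_eq, one_ne_zero, not_false_eq_true, Pi.single_eq_of_ne,
      show (2 : Fin 3) ≠ 0 by decide, Pi.zero_apply, neg_zero, mul_zero, add_zero,
      commutator_zero_apply, fieldCoeff, e, zero_mul, Complex.ofReal_zero, zero_div,
      Complex.exp_zero]
    have e6 : ħ * 2 / 2 = ħ := by ring
    simp only [mul_neg, mul_one, Real.sinh_neg, e6, Complex.ofReal_mul, Complex.ofReal_div,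
      Complex.ofReal_neg, Complex.ofReal_pow, Complex.ofReal_one]
    field_simp

theorem contractionsConverge (hħ : 0 < ħ) (hξ : 0 < ξ) (hk : 0 < k) {σ : ℝ}
    (hσ : contractionBound ħ ξ k ≤ σ) : ContractionsConverge ħ ξ k σ := by
  refine ⟨fun f hf g hg α β h => contractible_of_modeFamily hħ hξ hk
    (modeFamily_of_mem_exponents hħ hξ hk hf) (modeFamily_of_mem_exponents hħ hξ hk hg)
    (hσ.trans_lt h), contractible_kExponent hħ hξ hk (by ring)⟩

end

end FreeField

namespace FreeField

/-! ### Evaluation of the contractions of the currents -/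

/-- The exponent of `H^s(α)`. -/
noncomputable def hExponent (ħ ξ k : ℝ) (s : ℤˣ) (α : ℂ) : Modes :=
  kExponent ħ ξ k (α + Complex.I * ħ / 2 * (((s : ℤ) : ℂ) * (ξ + k - k / 2) + 1)) +
    kExponent ħ ξ k (α + Complex.I * ħ / 2 * (((s : ℤ) : ℂ) * (ξ + k - k / 2) - 1))

/-- The exponents of the two terms of `E(α)`. -/
noncomputable def eExponent (ħ k : ℝ) (u : ℤˣ) (α : ℂ) : Modes :=
  paraExponent ħ k (-1) u α + -field ħ 0 1 1 k α 0

/-- The exponents of the two terms of `F(α)`. -/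
noncomputable def fExponent (ħ ξ k : ℝ) (u : ℤˣ) (α : ℂ) : Modes :=
  paraExponent ħ k 1 u α + fieldPrime ħ ξ k 1 1 k α 0

section

set_option linter.unusedSimpArgs false

variable {ħ ξ k : ℝ}

/-- `exp(ħt/2)` -/
noncomputable def expX (ħ t : ℝ) : ℂ := Complex.exp (ħ * t / 2)

/-- `exp(ħkt/4)` -/
noncomputable def expY (ħ k t : ℝ) : ℂ := Complex.exp (ħ * k * t / 4)

/-- `exp(ħξt/2)` -/
noncomputable def expG (ħ ξ t : ℝ) : ℂ := Complex.exp (ħ * ξ * t / 2)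

theorem expX_ne_zero (ħ t : ℝ) : expX ħ t ≠ 0 := Complex.exp_ne_zero _
theorem expY_ne_zero (ħ k t : ℝ) : expY ħ k t ≠ 0 := Complex.exp_ne_zero _
theorem expG_ne_zero (ħ ξ t : ℝ) : expG ħ ξ t ≠ 0 := Complex.exp_ne_zero _

theorem exp_sub_one_ne_zero {x : ℝ} (hx : x ≠ 0) : Complex.exp x - 1 ≠ 0 := by
  have h : Real.exp x ≠ 1 := by simpa using hx
  have : ((Real.exp x - 1 : ℝ) : ℂ) ≠ 0 := by exact_mod_cast sub_ne_zero.2 h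
  simpa using this

theorem expX_pow (ħ t : ℝ) : expX ħ t ^ 2 = Complex.exp (ħ * t) := by
  rw [expX, ← Complex.exp_nat_mul]; congr 1; push_cast; ring

theorem expX_sq_add_one_ne_zero (ħ t : ℝ) : expX ħ t ^ 2 + 1 ≠ 0 := by
  have : (Real.exp (ħ * t) + 1 : ℝ) ≠ 0 := by positivity
  rw [expX_pow]
  exact_mod_cast this

theorem expX_sub_ne_zero {ħ t : ℝ} (hħ : 0 < ħ) (ht : 0 < t) : expX ħ t ^ 2 - 1 ≠ 0 := by
  have := exp_sub_one_ne_zero (mul_pos hħ ht).ne'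
  rw [expX_pow]
  exact_mod_cast this

theorem expY_sub_ne_zero (hħ : 0 < ħ) (hk : 0 < k) {t : ℝ} (ht : 0 < t) :
    expY ħ k t ^ 4 - 1 ≠ 0 := by
  have := exp_sub_one_ne_zero (mul_pos (mul_pos hħ hk) ht).ne'
  rw [expY, ← Complex.exp_nat_mul]
  convert this using 3
  push_cast
  ring

theorem expG_sub_ne_zero (hħ : 0 < ħ) (hξ : 0 < ξ) {t : ℝ} (ht : 0 < t) :
    expG ħ ξ t ^ 2 - 1 ≠ 0 := by
  have := exp_sub_one_ne_zero (mul_pos (mul_pos hħ hξ) ht).ne'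
  rw [expG, ← Complex.exp_nat_mul]
  convert this using 3
  push_cast
  ring

theorem expGY_sub_ne_zero (hħ : 0 < ħ) (hξ : 0 < ξ) (hk : 0 < k) {t : ℝ} (ht : 0 < t) :
    expG ħ ξ t ^ 2 * expY ħ k t ^ 4 - 1 ≠ 0 := by
  have := exp_sub_one_ne_zero (mul_pos (mul_pos hħ (add_pos hξ hk)) ht).ne'
  rw [expG, expY, ← Complex.exp_nat_mul, ← Complex.exp_nat_mul, ← Complex.exp_add]
  convert this using 3
  push_cast
  ring

/-- Each hyperbolic sine becomes rational in `expX`, `expY`, `expG`, so identities between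
integrands reduce to rational identities. The shifts `±k/2` in the parafermion fields are the reason
for the quarter in `expY`. -/
theorem ofReal_sinh_eq (c : ℝ) (z : ℂ) (h : z = Complex.exp c) :
    (Real.sinh c : ℂ) = (z ^ 2 - 1) / (2 * z) := by
  have h0 : z ≠ 0 := h ▸ Complex.exp_ne_zero _
  rw [Complex.ofReal_sinh, Complex.sinh, Complex.exp_neg, ← h]
  field_simp

theorem sinh_ħt (ħ t : ℝ) : (Real.sinh (ħ * t) : ℂ) = (expX ħ t ^ 4 - 1) / (2 * expX ħ t ^ 2) := by
  rw [ofReal_sinh_eq _ (expX ħ t ^ 2) (by rw [expX_pow]; push_cast; rfl)]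
  ring

theorem sinh_ħt_half (ħ t : ℝ) :
    (Real.sinh (ħ * t / 2) : ℂ) = (expX ħ t ^ 2 - 1) / (2 * expX ħ t) :=
  ofReal_sinh_eq _ _ (by rw [expX]; push_cast; rfl)

theorem sinh_ħkt_half (ħ k t : ℝ) :
    (Real.sinh (ħ * k * t / 2) : ℂ) = (expY ħ k t ^ 4 - 1) / (2 * expY ħ k t ^ 2) := by
  rw [ofReal_sinh_eq _ (expY ħ k t ^ 2) (by
    rw [expY, ← Complex.exp_nat_mul]; congr 1; push_cast; ring)]
  ring

theorem sinh_ħξt_half (ħ ξ t : ℝ) :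
    (Real.sinh (ħ * ξ * t / 2) : ℂ) = (expG ħ ξ t ^ 2 - 1) / (2 * expG ħ ξ t) :=
  ofReal_sinh_eq _ _ (by rw [expG]; push_cast; rfl)

theorem sinh_ħrt_half (ħ ξ k t : ℝ) : (Real.sinh (ħ * (ξ + k) * t / 2) : ℂ) =
    (expG ħ ξ t ^ 2 * expY ħ k t ^ 4 - 1) / (2 * (expG ħ ξ t * expY ħ k t ^ 2)) := by
  rw [ofReal_sinh_eq _ (expG ħ ξ t * expY ħ k t ^ 2) (by
    rw [expG, expY, ← Complex.exp_nat_mul, ← Complex.exp_add]; congr 1; push_cast; ring)]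
  ring

theorem sinh_ħk2t_half (ħ k t : ℝ) : (Real.sinh (ħ * (k + 2) * t / 2) : ℂ) =
    (expX ħ t ^ 4 * expY ħ k t ^ 4 - 1) / (2 * (expX ħ t ^ 2 * expY ħ k t ^ 2)) := by
  rw [ofReal_sinh_eq _ (expX ħ t ^ 2 * expY ħ k t ^ 2) (by
    rw [expX, expY, ← Complex.exp_nat_mul, ← Complex.exp_nat_mul, ← Complex.exp_add]
    congr 1; push_cast; ring)]
  ring

theorem commutator_zero_eq (hħ : 0 < ħ) {t : ℝ} (ht : 0 < t) (hξ : 0 < ξ) :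
    (commutator ħ ξ k 0 t : ℂ) =
      (expX ħ t ^ 4 - 1) * (expY ħ k t ^ 4 - 1) * (expG ħ ξ t ^ 2 * expY ħ k t ^ 4 - 1) /
        (4 * ħ ^ 2 * t * expX ħ t ^ 2 * expY ħ k t ^ 4 * (expG ħ ξ t ^ 2 - 1)) := by
  have h1 := expX_ne_zero ħ t
  have h2 := expY_ne_zero ħ k t
  have h3 := expG_ne_zero ħ ξ t
  have h4 := expG_sub_ne_zero hħ hξ ht
  rw [commutator_zero_apply]
  simp only [Complex.ofReal_mul, Complex.ofReal_div, Complex.ofReal_one, Complex.ofReal_pow,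
    sinh_ħt ħ, sinh_ħkt_half ħ k, sinh_ħξt_half ħ ξ, sinh_ħrt_half ħ ξ k]
  field_simp
  ring

theorem commutator_one_eq (t : ℝ) : (commutator ħ ξ k 1 t : ℂ) =
    (expX ħ t ^ 4 - 1) * (expX ħ t ^ 4 * expY ħ k t ^ 4 - 1) /
      (4 * ħ ^ 2 * t * expX ħ t ^ 4 * expY ħ k t ^ 2) := by
  have h1 := expX_ne_zero ħ t
  have h2 := expY_ne_zero ħ k t
  rw [commutator_one_apply]
  simp only [Complex.ofReal_mul, Complex.ofReal_div, Complex.ofReal_one, Complex.ofReal_pow,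
    sinh_ħt ħ, sinh_ħk2t_half ħ k]
  field_simp
  ring

theorem commutator_two_eq (t : ℝ) : (commutator ħ ξ k 2 t : ℂ) =
    -((expX ħ t ^ 4 - 1) * (expY ħ k t ^ 4 - 1) /
      (4 * ħ ^ 2 * t * expX ħ t ^ 2 * expY ħ k t ^ 2)) := by
  have h1 := expX_ne_zero ħ t
  have h2 := expY_ne_zero ħ k t
  rw [commutator_two_apply]
  simp only [Complex.ofReal_mul, Complex.ofReal_div, Complex.ofReal_one, Complex.ofReal_pow,
    sinh_ħt ħ, sinh_ħkt_half ħ k, Complex.ofReal_neg]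
  field_simp
  ring

theorem fieldCoeff_neg (A B C D t : ℝ) :
    fieldCoeff ħ A B C 0 D (-t) = -fieldCoeff ħ A B C 0 D t := by
  have e : ∀ x t : ℝ, ħ * x * t / 2 = ħ * x / 2 * t := fun x t => by ring
  simp only [fieldCoeff, e, abs_neg, mul_zero, zero_mul]
  simp only [mul_neg, Real.sinh_neg]
  push_cast
  ring

theorem fieldCoeff_eq (hħ : 0 < ħ) (D : ℝ) {t : ℝ} (ht : 0 < t) :
    fieldCoeff ħ 1 1 k 0 D t =
      2 * ħ * expY ħ k t ^ 2 / (expY ħ k t ^ 4 - 1) * Complex.exp (ħ * D / 2 * t) := by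
  have h1 := expX_ne_zero ħ t
  have h2 := expY_ne_zero ħ k t
  have h3 := expX_sub_ne_zero hħ ht
  simp only [fieldCoeff, mul_zero, zero_mul, zero_add, abs_of_pos ht, mul_one,
    Complex.ofReal_mul, Complex.ofReal_div, sinh_ħt_half ħ, sinh_ħkt_half ħ k]
  field_simp

theorem primeRatio_neg (t : ℝ) : primeRatio ħ ξ k (-t) = primeRatio ħ ξ k t := by
  have e : ∀ x t : ℝ, ħ * x * t / 2 = ħ * x / 2 * t := fun x t => by ring
  simp only [primeRatio, e]
  simp only [mul_neg, Real.sinh_neg, neg_div_neg_eq]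

theorem primeRatio_eq (t : ℝ) : (primeRatio ħ ξ k t : ℂ) =
    (expG ħ ξ t ^ 2 - 1) * expY ħ k t ^ 2 / (expG ħ ξ t ^ 2 * expY ħ k t ^ 4 - 1) := by
  have h2 := expY_ne_zero ħ k t
  have h3 := expG_ne_zero ħ ξ t
  simp only [primeRatio, Complex.ofReal_div, sinh_ħξt_half ħ ξ, sinh_ħrt_half ħ ξ k]
  field_simp

theorem halfFieldCoeff_pos (hħ : 0 < ħ) (C : ℝ) {t : ℝ} (ht : 0 < t) :
    halfFieldCoeff ħ 1 1 2 0 C t =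
      2 * ħ * expX ħ t / (expX ħ t ^ 2 + 1) * Complex.exp (ħ * C / 2 * t) := by
  have h1 := expX_ne_zero ħ t
  have h3 := expX_sub_ne_zero hħ ht
  have e : ħ * 2 * t / 2 = ħ * t := by ring
  have e4 : expX ħ t ^ 4 - 1 = (expX ħ t ^ 2 - 1) * (expX ħ t ^ 2 + 1) := by ring
  simp only [halfFieldCoeff, Units.val_one, Int.cast_one, one_mul, if_pos ht, abs_of_pos ht,
    mul_zero, zero_mul, zero_add, mul_one, Complex.ofReal_div, sinh_ħt_half ħ, e, sinh_ħt ħ, e4]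
  field_simp

theorem halfFieldCoeff_pos_neg (C : ℝ) {t : ℝ} (ht : 0 < t) :
    halfFieldCoeff ħ 1 1 2 0 C (-t) = 0 := by
  simp [halfFieldCoeff, not_lt.2 ht.le]

theorem halfFieldCoeff_neg (C : ℝ) {t : ℝ} (ht : 0 < t) :
    halfFieldCoeff ħ (-1) 1 2 0 C t = 0 := by
  simp [halfFieldCoeff, not_lt.2 ht.le]

theorem halfFieldCoeff_neg_neg (hħ : 0 < ħ) (C : ℝ) {t : ℝ} (ht : 0 < t) :
    halfFieldCoeff ħ (-1) 1 2 0 C (-t) =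
      2 * ħ * expX ħ t / (expX ħ t ^ 2 + 1) * Complex.exp (ħ * C / 2 * t) := by
  rw [← halfFieldCoeff_pos hħ C ht]
  simp [halfFieldCoeff, ht]

theorem exp_quarter_k (ħ k t : ℝ) : Complex.exp (ħ * (k / 2 : ℝ) / 2 * t) = expY ħ k t := by
  rw [expY]; congr 1; push_cast; ring

theorem exp_quarter_neg_k (ħ k t : ℝ) :
    Complex.exp (ħ * (-(k / 2) : ℝ) / 2 * t) = (expY ħ k t)⁻¹ := by
  rw [expY, ← Complex.exp_neg]; congr 1; push_cast; ring

theorem exp_quarter_k2 (ħ k t : ℝ) :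
    Complex.exp (ħ * ((k + 2) / 2 : ℝ) / 2 * t) = expX ħ t * expY ħ k t := by
  rw [expX, expY, ← Complex.exp_add]; congr 1; push_cast; ring

theorem exp_quarter_neg_k2 (ħ k t : ℝ) :
    Complex.exp (ħ * (-((k + 2) / 2) : ℝ) / 2 * t) = (expX ħ t * expY ħ k t)⁻¹ := by
  rw [expX, expY, ← Complex.exp_add, ← Complex.exp_neg]; congr 1; push_cast; ring

theorem para_zero (s u : ℤˣ) (α : ℂ) (t : ℝ) : paraExponent ħ k s u α 0 t = 0 := by
  simp [paraExponent, field, halfField]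

theorem para_one (s u : ℤˣ) (α : ℂ) (t : ℝ) : paraExponent ħ k s u α 1 t =
    (((u * s : ℤˣ) : ℤ) : ℂ) * halfFieldCoeff ħ u 1 2 α (-(((s : ℤ) : ℝ) * k / 2)) t := by
  simp [paraExponent, field, halfField]

theorem para_two (s u : ℤˣ) (α : ℂ) (t : ℝ) : paraExponent ħ k s u α 2 t =
    ((s : ℤ) : ℂ) * fieldCoeff ħ 1 1 k α (((s : ℤ) : ℝ) * k / 2) t -
      ((u : ℤ) : ℂ) * halfFieldCoeff ħ u 1 2 α (-(((s : ℤ) : ℝ) * (k + 2) / 2)) t := by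
  simp [paraExponent, field, halfField]

theorem eExponent_apply_zero (u : ℤˣ) (α : ℂ) (t : ℝ) :
    eExponent ħ k u α 0 t = -fieldCoeff ħ 1 1 k α 0 t := by
  simp [eExponent, para_zero, field]

theorem eExponent_apply_one (u : ℤˣ) (α : ℂ) (t : ℝ) :
    eExponent ħ k u α 1 t = paraExponent ħ k (-1) u α 1 t := by
  simp [eExponent, field]

theorem eExponent_apply_two (u : ℤˣ) (α : ℂ) (t : ℝ) :
    eExponent ħ k u α 2 t = paraExponent ħ k (-1) u α 2 t := by
  simp [eExponent, field]

theorem fExponent_apply_zero (u : ℤˣ) (α : ℂ) (t : ℝ) :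
    fExponent ħ ξ k u α 0 t = primeRatio ħ ξ k t * fieldCoeff ħ 1 1 k α 0 t := by
  simp [fExponent, para_zero, fieldPrime]

theorem fExponent_apply_one (u : ℤˣ) (α : ℂ) (t : ℝ) :
    fExponent ħ ξ k u α 1 t = paraExponent ħ k 1 u α 1 t := by
  simp [fExponent, fieldPrime]

theorem fExponent_apply_two (u : ℤˣ) (α : ℂ) (t : ℝ) :
    fExponent ħ ξ k u α 2 t = paraExponent ħ k 1 u α 2 t := by
  simp [fExponent, fieldPrime]

/-- The factors `expY ^ 4 - 1` in the denominators of `a_0` and `a_2` cancel between the bosons.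
What remains is one summand independent of the signs, with the denominator of period `ħξ` that leads
to Gamma functions, and a Frullani summand that depends on the signs. -/
theorem integrand_EE (hħ : 0 < ħ) (hξ : 0 < ξ) (hk : 0 < k) (u v : ℤˣ) {t : ℝ} (ht : 0 < t) :
    contractionIntegrand ħ ξ k (eExponent ħ k u 0) (eExponent ħ k v 0) t =
      -((expX ħ t ^ 4 - 1) * expG ħ ξ t ^ 2 / (t * expX ħ t ^ 2 * (expG ħ ξ t ^ 2 - 1))) +
      (if u = 1 then (if v = 1 then expX ħ t ^ 2 - 1 else expX ħ t ^ 2 - (expX ħ t ^ 2)⁻¹)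
        else if v = 1 then 0 else expX ħ t ^ 2 - 1) / t := by
  have h1 := expX_ne_zero ħ t
  have h2 := expY_ne_zero ħ k t
  have h3 := expG_ne_zero ħ ξ t
  have h4 := expX_sq_add_one_ne_zero ħ t
  have h5 := expY_sub_ne_zero hħ hk ht
  have h6 := expG_sub_ne_zero hħ hξ ht
  have h7 := expGY_sub_ne_zero hħ hξ hk ht
  have h7' : expY ħ k t ^ 4 * expG ħ ξ t ^ 2 - 1 ≠ 0 := by rwa [mul_comm]
  have h8 : (t : ℂ) ≠ 0 := by exact_mod_cast ht.ne'
  have h9 : (ħ : ℂ) ≠ 0 := by exact_mod_cast hħ.ne'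
  have n1 : (-1 : ℤˣ) ≠ 1 := by decide
  simp only [contractionIntegrand, Fin.sum_univ_three, eExponent_apply_zero, eExponent_apply_one,
    eExponent_apply_two, para_one, para_two, commutator_zero_eq hħ ht hξ, commutator_one_eq,
    commutator_two_eq, fieldCoeff_neg, fieldCoeff_eq hħ _ ht]
  rcases units_int_cases u with rfl | rfl <;> rcases units_int_cases v with rfl | rfl <;>
  simp only [halfFieldCoeff_pos hħ _ ht, halfFieldCoeff_pos_neg _ ht, halfFieldCoeff_neg _ ht,
    halfFieldCoeff_neg_neg hħ _ ht, Units.val_neg, Units.val_one, Int.cast_neg, Int.cast_one,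
    neg_mul, one_mul, neg_neg, neg_div, exp_quarter_k ħ k, exp_quarter_neg_k ħ k, exp_quarter_k2 ħ k,
    exp_quarter_neg_k2 ħ k, mul_zero, zero_mul, sub_zero, add_zero, zero_add, neg_zero, if_true,
    if_neg n1, mul_neg, mul_one, Complex.ofReal_zero, zero_div, Complex.exp_zero] <;>
  field_simp <;> ring

/-- The two factors `primeRatio` replace the period `ħξ` by `ħ(ξ + k)`, and the sign of the
universal summand changes. -/
theorem integrand_FF (hħ : 0 < ħ) (hξ : 0 < ξ) (hk : 0 < k) (u v : ℤˣ) {t : ℝ} (ht : 0 < t) :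
    contractionIntegrand ħ ξ k (fExponent ħ ξ k u 0) (fExponent ħ ξ k v 0) t =
      (expX ħ t ^ 4 - 1) * (expG ħ ξ t ^ 2 * expY ħ k t ^ 4) /
          (t * expX ħ t ^ 2 * (expG ħ ξ t ^ 2 * expY ħ k t ^ 4 - 1)) +
      (if u = 1 then
        (if v = 1 then (expX ħ t ^ 2)⁻¹ - 1 else (expX ħ t ^ 2)⁻¹ - expX ħ t ^ 2)
        else if v = 1 then 0 else (expX ħ t ^ 2)⁻¹ - 1) / t := by
  have h1 := expX_ne_zero ħ t
  have h2 := expY_ne_zero ħ k t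
  have h3 := expG_ne_zero ħ ξ t
  have h4 := expX_sq_add_one_ne_zero ħ t
  have h5 := expY_sub_ne_zero hħ hk ht
  have h6 := expG_sub_ne_zero hħ hξ ht
  have h7 := expGY_sub_ne_zero hħ hξ hk ht
  have h7' : expY ħ k t ^ 4 * expG ħ ξ t ^ 2 - 1 ≠ 0 := by rwa [mul_comm]
  have h8 : (t : ℂ) ≠ 0 := by exact_mod_cast ht.ne'
  have h9 : (ħ : ℂ) ≠ 0 := by exact_mod_cast hħ.ne'
  have n1 : (-1 : ℤˣ) ≠ 1 := by decide
  simp only [contractionIntegrand, Fin.sum_univ_three, eExponent_apply_zero, eExponent_apply_one,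
    eExponent_apply_two, fExponent_apply_zero, fExponent_apply_one, fExponent_apply_two,
    primeRatio_neg, primeRatio_eq, para_one, para_two, commutator_zero_eq hħ ht hξ, commutator_one_eq,
    commutator_two_eq, fieldCoeff_neg, fieldCoeff_eq hħ _ ht]
  rcases units_int_cases u with rfl | rfl <;> rcases units_int_cases v with rfl | rfl <;>
  simp only [halfFieldCoeff_pos hħ _ ht, halfFieldCoeff_pos_neg _ ht, halfFieldCoeff_neg _ ht,
    halfFieldCoeff_neg_neg hħ _ ht, Units.val_neg, Units.val_one, Int.cast_neg, Int.cast_one,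
    neg_mul, one_mul, neg_neg, neg_div, exp_quarter_k ħ k, exp_quarter_neg_k ħ k, exp_quarter_k2 ħ k,
    exp_quarter_neg_k2 ħ k, mul_zero, zero_mul, sub_zero, add_zero, zero_add, neg_zero, if_true,
    if_neg n1, mul_neg, mul_one, Complex.ofReal_zero, zero_div, Complex.exp_zero] <;>
  field_simp <;> ring

/-- A single factor `primeRatio` cancels the dependence on `ξ`, so no Gamma function survives. Terms
of opposite signs do not contract at all. -/
theorem integrand_EF (hħ : 0 < ħ) (hξ : 0 < ξ) (hk : 0 < k) (u v : ℤˣ) {t : ℝ} (ht : 0 < t) :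
    contractionIntegrand ħ ξ k (eExponent ħ k u 0) (fExponent ħ ξ k v 0) t =
      (if u = 1 then
        (if v = 1 then expY ħ k t ^ 2 - expX ħ t ^ 2 * expY ħ k t ^ 2 else 0)
        else if v = 1 then 0 else
          (expY ħ k t ^ 2)⁻¹ - (expX ħ t ^ 2 * expY ħ k t ^ 2)⁻¹) / t := by
  have h1 := expX_ne_zero ħ t
  have h2 := expY_ne_zero ħ k t
  have h3 := expG_ne_zero ħ ξ t
  have h4 := expX_sq_add_one_ne_zero ħ t
  have h5 := expY_sub_ne_zero hħ hk ht
  have h6 := expG_sub_ne_zero hħ hξ ht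
  have h7 := expGY_sub_ne_zero hħ hξ hk ht
  have h7' : expY ħ k t ^ 4 * expG ħ ξ t ^ 2 - 1 ≠ 0 := by rwa [mul_comm]
  have h8 : (t : ℂ) ≠ 0 := by exact_mod_cast ht.ne'
  have h9 : (ħ : ℂ) ≠ 0 := by exact_mod_cast hħ.ne'
  have n1 : (-1 : ℤˣ) ≠ 1 := by decide
  simp only [contractionIntegrand, Fin.sum_univ_three, eExponent_apply_zero, eExponent_apply_one,
    eExponent_apply_two, fExponent_apply_zero, fExponent_apply_one, fExponent_apply_two,
    primeRatio_neg, primeRatio_eq, para_one, para_two, commutator_zero_eq hħ ht hξ, commutator_one_eq,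
    commutator_two_eq, fieldCoeff_neg, fieldCoeff_eq hħ _ ht]
  rcases units_int_cases u with rfl | rfl <;> rcases units_int_cases v with rfl | rfl <;>
  simp only [halfFieldCoeff_pos hħ _ ht, halfFieldCoeff_pos_neg _ ht, halfFieldCoeff_neg _ ht,
    halfFieldCoeff_neg_neg hħ _ ht, Units.val_neg, Units.val_one, Int.cast_neg, Int.cast_one,
    neg_mul, one_mul, neg_neg, neg_div, exp_quarter_k ħ k, exp_quarter_neg_k ħ k, exp_quarter_k2 ħ k,
    exp_quarter_neg_k2 ħ k, mul_zero, zero_mul, sub_zero, add_zero, zero_add, neg_zero, if_true,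
    if_neg n1, mul_neg, mul_one, Complex.ofReal_zero, zero_div, Complex.exp_zero] <;>
  field_simp <;> ring

/-- Compared with the order `E F`, the two cases of equal signs are interchanged. This is what lets
the two orders continue each other. -/
theorem integrand_FE (hħ : 0 < ħ) (hξ : 0 < ξ) (hk : 0 < k) (u v : ℤˣ) {t : ℝ} (ht : 0 < t) :
    contractionIntegrand ħ ξ k (fExponent ħ ξ k u 0) (eExponent ħ k v 0) t =
      (if u = 1 then
        (if v = 1 then (expY ħ k t ^ 2)⁻¹ - (expX ħ t ^ 2 * expY ħ k t ^ 2)⁻¹ else 0)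
        else if v = 1 then 0 else expY ħ k t ^ 2 - expX ħ t ^ 2 * expY ħ k t ^ 2) / t := by
  have h1 := expX_ne_zero ħ t
  have h2 := expY_ne_zero ħ k t
  have h3 := expG_ne_zero ħ ξ t
  have h4 := expX_sq_add_one_ne_zero ħ t
  have h5 := expY_sub_ne_zero hħ hk ht
  have h6 := expG_sub_ne_zero hħ hξ ht
  have h7 := expGY_sub_ne_zero hħ hξ hk ht
  have h7' : expY ħ k t ^ 4 * expG ħ ξ t ^ 2 - 1 ≠ 0 := by rwa [mul_comm]
  have h8 : (t : ℂ) ≠ 0 := by exact_mod_cast ht.ne'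
  have h9 : (ħ : ℂ) ≠ 0 := by exact_mod_cast hħ.ne'
  have n1 : (-1 : ℤˣ) ≠ 1 := by decide
  simp only [contractionIntegrand, Fin.sum_univ_three, eExponent_apply_zero, eExponent_apply_one,
    eExponent_apply_two, fExponent_apply_zero, fExponent_apply_one, fExponent_apply_two,
    primeRatio_neg, primeRatio_eq, para_one, para_two, commutator_zero_eq hħ ht hξ, commutator_one_eq,
    commutator_two_eq, fieldCoeff_neg, fieldCoeff_eq hħ _ ht]
  rcases units_int_cases u with rfl | rfl <;> rcases units_int_cases v with rfl | rfl <;>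
  simp only [halfFieldCoeff_pos hħ _ ht, halfFieldCoeff_pos_neg _ ht, halfFieldCoeff_neg _ ht,
    halfFieldCoeff_neg_neg hħ _ ht, Units.val_neg, Units.val_one, Int.cast_neg, Int.cast_one,
    neg_mul, one_mul, neg_neg, neg_div, exp_quarter_k ħ k, exp_quarter_neg_k ħ k, exp_quarter_k2 ħ k,
    exp_quarter_neg_k2 ħ k, mul_zero, zero_mul, sub_zero, add_zero, zero_add, neg_zero, if_true,
    if_neg n1, mul_neg, mul_one, Complex.ofReal_zero, zero_div, Complex.exp_zero] <;>
  field_simp <;> ring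


end

end FreeField

/-! ### Closed forms of the contractions: Frullani quotients and Gamma functions -/

namespace FreeField

section

set_option linter.unusedSimpArgs false

variable {ħ ξ k : ℝ}

theorem modeFamily_eExponent (hħ : 0 < ħ) (hξ : 0 < ξ) (hk : 0 < k) (u : ℤˣ) :
    ModeFamily (growthBound ħ ξ k) (eExponent ħ k u) :=
  (modeFamily_paraExponent hħ hξ hk (-1) u).add (modeFamily_eField hħ hξ hk)

theorem modeFamily_fExponent (hħ : 0 < ħ) (hξ : 0 < ξ) (hk : 0 < k) (u : ℤˣ) :
    ModeFamily (growthBound ħ ξ k) (fExponent ħ ξ k u) :=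
  (modeFamily_paraExponent hħ hξ hk 1 u).add (modeFamily_fField hħ hξ hk)

/-- The exponential of the finite part of `gammaIntegrand ω (z - ħ) (z + ħ)`. -/
noncomputable def gammaRatio (ħ ω : ℝ) (z : ℂ) : ℂ :=
  Complex.exp (2 * ħ / ω * expIntegralConst ω) *
    (Complex.Gamma ((z - ħ) / ω) / Complex.Gamma ((z + ħ) / ω))

theorem hasExpFinitePart_gammaRatio (hħ : 0 < ħ) {ω : ℝ} (hω : 0 < ω) {z : ℂ} (hz : ħ < z.re) :
    HasExpFinitePart (gammaIntegrand ω (z - ħ) (z + ħ)) (gammaRatio ħ ω z) := by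
  have h := hasExpFinitePart_gammaIntegrand hω (a := z - ħ) (b := z + ħ) (by simpa using hz)
    (by simp; linarith)
  have e : z + ħ - (z - ħ) = 2 * (ħ : ℂ) := by ring
  rwa [e] at h

theorem exp_sub_ħ (z : ℂ) (t : ℝ) :
    Complex.exp (-(z - ħ) * t) = Complex.exp (-(z * t)) * expX ħ t ^ 2 := by
  rw [expX_pow, ← Complex.exp_add]; ring_nf

theorem exp_add_ħ (z : ℂ) (t : ℝ) :
    Complex.exp (-(z + ħ) * t) = Complex.exp (-(z * t)) * (expX ħ t ^ 2)⁻¹ := by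
  rw [expX_pow, ← Complex.exp_neg, ← Complex.exp_add]; ring_nf

theorem expY_sq (ħ k t : ℝ) : expY ħ k t ^ 2 = Complex.exp (ħ * k / 2 * t) := by
  rw [expY, ← Complex.exp_nat_mul]; congr 1; push_cast; ring

theorem expG_sq (ħ ξ t : ℝ) : expG ħ ξ t ^ 2 = Complex.exp (ħ * ξ * t) := by
  rw [expG, ← Complex.exp_nat_mul]; congr 1; push_cast; ring

theorem exp_sub_k (z : ℂ) (t : ℝ) :
    Complex.exp (-(z - ħ * k / 2) * t) = Complex.exp (-(z * t)) * expY ħ k t ^ 2 := by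
  rw [expY_sq, ← Complex.exp_add]; ring_nf

theorem exp_add_k (z : ℂ) (t : ℝ) :
    Complex.exp (-(z + ħ * k / 2) * t) = Complex.exp (-(z * t)) * (expY ħ k t ^ 2)⁻¹ := by
  rw [expY_sq, ← Complex.exp_neg, ← Complex.exp_add]; ring_nf

theorem exp_sub_k2 (z : ℂ) (t : ℝ) : Complex.exp (-(z - ħ * (k + 2) / 2) * t) =
    Complex.exp (-(z * t)) * (expX ħ t ^ 2 * expY ħ k t ^ 2) := by
  rw [expY_sq, expX_pow, ← Complex.exp_add, ← Complex.exp_add]; ring_nf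

theorem exp_add_k2 (z : ℂ) (t : ℝ) : Complex.exp (-(z + ħ * (k + 2) / 2) * t) =
    Complex.exp (-(z * t)) * (expX ħ t ^ 2 * expY ħ k t ^ 2)⁻¹ := by
  rw [expY_sq, expX_pow, ← Complex.exp_add, ← Complex.exp_neg, ← Complex.exp_add]; ring_nf

theorem gammaIntegrand_xi (hħ : 0 < ħ) (hξ : 0 < ξ) (z : ℂ) {t : ℝ} (ht : 0 < t) :
    gammaIntegrand (ħ * ξ) (z - ħ) (z + ħ) t = Complex.exp (-(z * t)) *
      ((expX ħ t ^ 4 - 1) * expG ħ ξ t ^ 2 / (t * expX ħ t ^ 2 * (expG ħ ξ t ^ 2 - 1))) := by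
  have h1 := expX_ne_zero ħ t
  have h3 := expG_ne_zero ħ ξ t
  have h6 := expG_sub_ne_zero hħ hξ ht
  have h8 : (t : ℂ) ≠ 0 := by exact_mod_cast ht.ne'
  have e : Complex.exp (-(((ħ * ξ : ℝ) : ℂ) * t)) = (expG ħ ξ t ^ 2)⁻¹ := by
    rw [expG_sq, ← Complex.exp_neg]; push_cast; rfl
  rw [gammaIntegrand, e, exp_sub_ħ, exp_add_ħ]
  field_simp

theorem gammaIntegrand_r (hħ : 0 < ħ) (hξ : 0 < ξ) (hk : 0 < k) (z : ℂ) {t : ℝ} (ht : 0 < t) :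
    gammaIntegrand (ħ * (ξ + k)) (z - ħ) (z + ħ) t = Complex.exp (-(z * t)) *
      ((expX ħ t ^ 4 - 1) * (expG ħ ξ t ^ 2 * expY ħ k t ^ 4) /
          (t * expX ħ t ^ 2 * (expG ħ ξ t ^ 2 * expY ħ k t ^ 4 - 1))) := by
  have h1 := expX_ne_zero ħ t
  have h2 := expY_ne_zero ħ k t
  have h3 := expG_ne_zero ħ ξ t
  have h7 := expGY_sub_ne_zero hħ hξ hk ht
  have h7' : expY ħ k t ^ 4 * expG ħ ξ t ^ 2 - 1 ≠ 0 := by rwa [mul_comm]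
  have h8 : (t : ℂ) ≠ 0 := by exact_mod_cast ht.ne'
  have e : Complex.exp (-(((ħ * (ξ + k) : ℝ) : ℂ) * t)) =
      (expG ħ ξ t ^ 2 * expY ħ k t ^ 4)⁻¹ := by
    have : expY ħ k t ^ 4 = (expY ħ k t ^ 2) ^ 2 := by ring
    rw [this, expG_sq, expY_sq, ← Complex.exp_nat_mul, ← Complex.exp_add, ← Complex.exp_neg]
    congr 1; push_cast; ring
  rw [gammaIntegrand, e, exp_sub_ħ, exp_add_ħ]
  field_simp

/-- With `z = -i(α - β)` the dependence is `exp(-zt)`, as in the Gamma integrals, and `Re z = Im (α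
- β)` governs convergence. -/
theorem contractionIntegrand_shift {M : ℝ} {f g : ℂ → Modes} (hf : ModeFamily M f)
    (hg : ModeFamily M g) (α β : ℂ) (t : ℝ) :
    contractionIntegrand ħ ξ k (f α) (g β) t =
      Complex.exp (-(-(Complex.I * (α - β)) * t)) * contractionIntegrand ħ ξ k (f 0) (g 0) t := by
  rw [contractionIntegrand_family hf hg]
  ring_nf

/-- The rational factor in `E(α) E(β)`; `z = -i(α - β)`. -/
noncomputable def ratioEE (ħ : ℝ) (u v : ℤˣ) (z : ℂ) : ℂ :=
  if u = 1 then (if v = 1 then z / (z - ħ) else (z + ħ) / (z - ħ))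
  else if v = 1 then 1 else z / (z - ħ)

/-- The rational factor in `F(α) F(β)`. -/
noncomputable def ratioFF (ħ : ℝ) (u v : ℤˣ) (z : ℂ) : ℂ :=
  if u = 1 then (if v = 1 then z / (z + ħ) else (z - ħ) / (z + ħ))
  else if v = 1 then 1 else z / (z + ħ)

/-- The rational factor in `E(α) F(β)`. -/
noncomputable def ratioEF (ħ k : ℝ) (u v : ℤˣ) (z : ℂ) : ℂ :=
  if u = 1 then (if v = 1 then (z - ħ * (k + 2) / 2) / (z - ħ * k / 2) else 1)
  else if v = 1 then 1 else (z + ħ * (k + 2) / 2) / (z + ħ * k / 2)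

/-- The universal summand contributes the inverse Gamma quotient, the other one a Frullani quotient.
The condition `ħ < Re z` is needed for the smallest exponent, `z - ħ`. -/
theorem hasExp_EE (hħ : 0 < ħ) (hξ : 0 < ξ) (hk : 0 < k) (u v : ℤˣ) {α β z : ℂ}
    (hz : z = -(Complex.I * (α - β))) (hre : ħ < z.re) :
    HasExpFinitePart (contractionIntegrand ħ ξ k (eExponent ħ k u α) (eExponent ħ k v β))
      ((gammaRatio ħ (ħ * ξ) z)⁻¹ * ratioEE ħ u v z) := by
  have hω : 0 < ħ * ξ := by positivity
  have hE := modeFamily_eExponent hħ hξ hk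
  have ha : 0 < (z - ħ).re := by simpa using hre
  have hb : 0 < (z + ħ).re := by simp; linarith
  have hz0 : 0 < z.re := by linarith
  have key : HasExpFinitePart (fun t : ℝ => Complex.exp (-(z * t)) *
      ((if u = 1 then (if v = 1 then expX ħ t ^ 2 - 1 else expX ħ t ^ 2 - (expX ħ t ^ 2)⁻¹)
        else if v = 1 then 0 else expX ħ t ^ 2 - 1) / t)) (ratioEE ħ u v z) := by
    unfold ratioEE
    split_ifs
    · exact (hasExpFinitePart_frullani ha hz0).congr fun t _ => by
        beta_reduce; rw [exp_sub_ħ, neg_mul z]; ring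
    · exact (hasExpFinitePart_frullani ha hb).congr fun t _ => by
        beta_reduce; rw [exp_sub_ħ, exp_add_ħ]; ring
    · exact hasExpFinitePart_zero.congr fun t _ => by simp
    · exact (hasExpFinitePart_frullani ha hz0).congr fun t _ => by
        beta_reduce; rw [exp_sub_ħ, neg_mul z]; ring
  refine ((hasExpFinitePart_gammaRatio hħ hω hre).neg.add key).congr fun t ht => ?_
  beta_reduce
  rw [contractionIntegrand_shift (hE u) (hE v), integrand_EE hħ hξ hk u v ht, ← hz,
    gammaIntegrand_xi hħ hξ z ht]
  ring

theorem hasExp_FF (hħ : 0 < ħ) (hξ : 0 < ξ) (hk : 0 < k) (u v : ℤˣ) {α β z : ℂ}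
    (hz : z = -(Complex.I * (α - β))) (hre : ħ < z.re) :
    HasExpFinitePart (contractionIntegrand ħ ξ k (fExponent ħ ξ k u α) (fExponent ħ ξ k v β))
      (gammaRatio ħ (ħ * (ξ + k)) z * ratioFF ħ u v z) := by
  have hω : 0 < ħ * (ξ + k) := by positivity
  have hF := modeFamily_fExponent hħ hξ hk
  have ha : 0 < (z - ħ).re := by simpa using hre
  have hb : 0 < (z + ħ).re := by simp; linarith
  have hz0 : 0 < z.re := by linarith
  have key : HasExpFinitePart (fun t : ℝ => Complex.exp (-(z * t)) *
      ((if u = 1 then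
        (if v = 1 then (expX ħ t ^ 2)⁻¹ - 1 else (expX ħ t ^ 2)⁻¹ - expX ħ t ^ 2)
        else if v = 1 then 0 else (expX ħ t ^ 2)⁻¹ - 1) / t)) (ratioFF ħ u v z) := by
    unfold ratioFF
    split_ifs
    · exact (hasExpFinitePart_frullani hb hz0).congr fun t _ => by
        beta_reduce; rw [exp_add_ħ, neg_mul z]; ring
    · exact (hasExpFinitePart_frullani hb ha).congr fun t _ => by
        beta_reduce; rw [exp_sub_ħ, exp_add_ħ]; ring
    · exact hasExpFinitePart_zero.congr fun t _ => by simp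
    · exact (hasExpFinitePart_frullani hb hz0).congr fun t _ => by
        beta_reduce; rw [exp_add_ħ, neg_mul z]; ring
  refine ((hasExpFinitePart_gammaRatio hħ hω hre).add key).congr fun t ht => ?_
  beta_reduce
  rw [contractionIntegrand_shift (hF u) (hF v), integrand_FF hħ hξ hk u v ht, ← hz,
    gammaIntegrand_r hħ hξ hk z ht]
  ring

theorem re_sub_k_pos (hħ : 0 < ħ) {z : ℂ} (hre : ħ * (k + 2) / 2 < z.re) :
    0 < (z - ħ * k / 2).re ∧ 0 < (z - ħ * (k + 2) / 2).re := by
  have e1 : (z - ħ * k / 2) = z - ((ħ * k / 2 : ℝ) : ℂ) := by push_cast; ring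
  have e2 : (z - ħ * (k + 2) / 2) = z - ((ħ * (k + 2) / 2 : ℝ) : ℂ) := by push_cast; ring
  rw [e1, e2, Complex.sub_re, Complex.sub_re, Complex.ofReal_re, Complex.ofReal_re]
  constructor <;> nlinarith

theorem re_add_k_pos (hħ : 0 < ħ) (hk : 0 < k) {z : ℂ} (hre : 0 < z.re) :
    0 < (z + ħ * k / 2).re ∧ 0 < (z + ħ * (k + 2) / 2).re := by
  have e1 : (z + ħ * k / 2) = z + ((ħ * k / 2 : ℝ) : ℂ) := by push_cast; ring
  have e2 : (z + ħ * (k + 2) / 2) = z + ((ħ * (k + 2) / 2 : ℝ) : ℂ) := by push_cast; ring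
  rw [e1, e2, Complex.add_re, Complex.add_re, Complex.ofReal_re, Complex.ofReal_re]
  constructor <;> positivity

theorem hasExp_EF (hħ : 0 < ħ) (hξ : 0 < ξ) (hk : 0 < k) (u v : ℤˣ) {α β z : ℂ}
    (hz : z = -(Complex.I * (α - β))) (hre : ħ * (k + 2) / 2 < z.re) :
    HasExpFinitePart (contractionIntegrand ħ ξ k (eExponent ħ k u α) (fExponent ħ ξ k v β))
      (ratioEF ħ k u v z) := by
  have hE := modeFamily_eExponent hħ hξ hk
  have hF := modeFamily_fExponent hħ hξ hk
  have hz0 : 0 < z.re := lt_trans (by positivity) hre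
  obtain ⟨h1, h2⟩ := re_sub_k_pos hħ hre
  obtain ⟨h3, h4⟩ := re_add_k_pos hħ hk hz0
  have key : HasExpFinitePart (fun t : ℝ => Complex.exp (-(z * t)) *
      ((if u = 1 then
        (if v = 1 then expY ħ k t ^ 2 - expX ħ t ^ 2 * expY ħ k t ^ 2 else 0)
        else if v = 1 then 0 else
          (expY ħ k t ^ 2)⁻¹ - (expX ħ t ^ 2 * expY ħ k t ^ 2)⁻¹) / t)) (ratioEF ħ k u v z) := by
    unfold ratioEF
    split_ifs
    · exact (hasExpFinitePart_frullani h1 h2).congr fun t _ => by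
        beta_reduce; rw [exp_sub_k, exp_sub_k2]; ring
    · exact hasExpFinitePart_zero.congr fun t _ => by simp
    · exact hasExpFinitePart_zero.congr fun t _ => by simp
    · exact (hasExpFinitePart_frullani h3 h4).congr fun t _ => by
        beta_reduce; rw [exp_add_k, exp_add_k2]; ring
  refine key.congr fun t ht => ?_
  beta_reduce
  rw [contractionIntegrand_shift (hE u) (hF v), integrand_EF hħ hξ hk u v ht, ← hz]

/-- The rational function and its argument `z` are those of `E(α) F(β)`, now reached from the
opposite half-plane: the fractions do not change when numerator and denominator both change sign. -/
theorem hasExp_FE (hħ : 0 < ħ) (hξ : 0 < ξ) (hk : 0 < k) (u v : ℤˣ) {α β z : ℂ}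
    (hz : z = -(Complex.I * (α - β))) (hre : z.re < -(ħ * (k + 2) / 2)) :
    HasExpFinitePart (contractionIntegrand ħ ξ k (fExponent ħ ξ k v β) (eExponent ħ k u α))
      (ratioEF ħ k u v z) := by
  have hE := modeFamily_eExponent hħ hξ hk
  have hF := modeFamily_fExponent hħ hξ hk
  have hre' : ħ * (k + 2) / 2 < (-z).re := by simp; linarith
  have hz0 : 0 < (-z).re := lt_trans (by positivity) hre'
  obtain ⟨h1, h2⟩ := re_sub_k_pos hħ hre'
  obtain ⟨h3, h4⟩ := re_add_k_pos hħ hk hz0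
  have e1 : (z - ħ * (k + 2) / 2) / (z - ħ * k / 2) =
      (-z + ħ * (k + 2) / 2) / (-z + ħ * k / 2) := by
    rw [← neg_div_neg_eq]; ring_nf
  have e2 : (z + ħ * (k + 2) / 2) / (z + ħ * k / 2) =
      (-z - ħ * (k + 2) / 2) / (-z - ħ * k / 2) := by
    rw [← neg_div_neg_eq]; ring_nf
  have key : HasExpFinitePart (fun t : ℝ => Complex.exp (-(-z * t)) *
      ((if v = 1 then
        (if u = 1 then (expY ħ k t ^ 2)⁻¹ - (expX ħ t ^ 2 * expY ħ k t ^ 2)⁻¹ else 0)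
        else if u = 1 then 0 else expY ħ k t ^ 2 - expX ħ t ^ 2 * expY ħ k t ^ 2) / t))
      (ratioEF ħ k u v z) := by
    unfold ratioEF
    rw [e1, e2]
    split_ifs
    · exact (hasExpFinitePart_frullani h3 h4).congr fun t _ => by
        beta_reduce; rw [exp_add_k, exp_add_k2]; ring
    · exact hasExpFinitePart_zero.congr fun t _ => by simp
    · exact hasExpFinitePart_zero.congr fun t _ => by simp
    · exact (hasExpFinitePart_frullani h1 h2).congr fun t _ => by
        beta_reduce; rw [exp_sub_k, exp_sub_k2]; ring
  refine key.congr fun t ht => ?_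
  beta_reduce
  have hz' : -(Complex.I * (β - α)) = -z := by rw [hz]; ring
  rw [contractionIntegrand_shift (hF v) (hE u), integrand_FE hħ hξ hk v u ht, hz']

/-- Half of the shift between `H^+` and `H^-`. -/
noncomputable def hShift (ħ ξ k : ℝ) : ℝ := ħ * (ξ + k / 2) / 2

/-- The two factors `k` are displaced by `±iħ/2` about a common centre, which gives `exp(-ħt/2) +
exp(ħt/2)`. By `sinh(ħt) = 2 sinh(ħt/2) cosh(ħt/2)` this cancels the quotient `sinh(ħt/2) /
sinh(ħt)`. -/
theorem hExponent_apply_zero (hħ : 0 < ħ) (s : ℤˣ) (α : ℂ) {t : ℝ} (ht : t ≠ 0) :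
    hExponent ħ ξ k s α 0 t = -(ħ / (Real.sinh (ħ * (ξ + k) * t / 2) : ℂ)) *
      Complex.exp (Complex.I * α * t - ((s : ℤ) : ℂ) * hShift ħ ξ k * t) := by
  have n1 : (Real.sinh (ħ * t) : ℂ) ≠ 0 := by
    exact_mod_cast sinh_mul_ne_zero hħ ht
  have e0 : ħ * 2 * t / 2 = ħ * t := by ring
  have e1 : (Real.sinh (ħ * t) : ℂ) = 2 * Real.sinh (ħ * t / 2) * Real.cosh (ħ * t / 2) := by
    rw [← Complex.ofReal_ofNat, ← Complex.ofReal_mul, ← Complex.ofReal_mul, ← Real.sinh_two_mul]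
    congr 2; ring
  have n2 : (Real.sinh (ħ * t / 2) : ℂ) ≠ 0 := fun h => n1 (by rw [e1, h]; ring)
  have n3 : (Real.cosh (ħ * t / 2) : ℂ) ≠ 0 := fun h => n1 (by rw [e1, h]; ring)
  have e2 : (Real.cosh (ħ * t / 2) : ℂ) =
      (Complex.exp (-(ħ * t / 2)) + Complex.exp (ħ * t / 2)) / 2 := by
    rw [Complex.ofReal_cosh, Complex.cosh]; push_cast; ring
  have hexp : ∀ ε : ℂ, Complex.exp (Complex.I *
      (α + Complex.I * ħ / 2 * (((s : ℤ) : ℂ) * (ξ + k - k / 2) + ε)) * t) =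
      Complex.exp (Complex.I * α * t - ((s : ℤ) : ℂ) * hShift ħ ξ k * t) *
        Complex.exp (-(ε * (ħ * t / 2))) := by
    intro ε
    rw [← Complex.exp_add, hShift]
    congr 1
    push_cast
    linear_combination (ħ / 2 * (((s : ℤ) : ℂ) * (ξ + k - k / 2) + ε) * t : ℂ) * Complex.I_sq
  have h1 := hexp 1
  have h2 := hexp (-1)
  rw [← sub_eq_add_neg] at h2
  simp only [hExponent, kExponent, field, Pi.add_apply, Pi.neg_apply, Pi.single_eq_same,
    fieldCoeff, Complex.ofReal_zero, mul_zero, zero_div, zero_mul, add_zero, h1, h2, e0,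
    Complex.ofReal_div, Complex.ofReal_mul, e1, mul_one, one_mul, neg_mul, neg_neg]
  rw [← neg_add, ← mul_add, ← mul_add,
    show Complex.exp (-(ħ * t / 2 : ℂ)) + Complex.exp (ħ * t / 2 : ℂ) =
      2 * (Real.cosh (ħ * t / 2) : ℂ) by rw [e2]; ring]
  field_simp

theorem hExponent_apply_of_ne (s : ℤˣ) (α : ℂ) {j : Fin 3} (hj : j ≠ 0) (t : ℝ) :
    hExponent ħ ξ k s α j t = 0 := by
  simp [hExponent, kExponent, field, hj]

theorem contractionIntegrand_h_left (s : ℤˣ) (α : ℂ) (g : Modes) (t : ℝ) :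
    contractionIntegrand ħ ξ k (hExponent ħ ξ k s α) g t =
      commutator ħ ξ k 0 t * hExponent ħ ξ k s α 0 t * g 0 (-t) := by
  simp only [contractionIntegrand, Fin.sum_univ_three]
  rw [hExponent_apply_of_ne s α one_ne_zero, hExponent_apply_of_ne s α (show (2 : Fin 3) ≠ 0 by decide)]
  ring

theorem contractionIntegrand_h_right (s : ℤˣ) (β : ℂ) (f : Modes) (t : ℝ) :
    contractionIntegrand ħ ξ k f (hExponent ħ ξ k s β) t =
      commutator ħ ξ k 0 t * f 0 t * hExponent ħ ξ k s β 0 (-t) := by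
  simp only [contractionIntegrand, Fin.sum_univ_three]
  rw [hExponent_apply_of_ne s β one_ne_zero, hExponent_apply_of_ne s β (show (2 : Fin 3) ≠ 0 by decide)]
  ring

theorem hExponent_pos (hħ : 0 < ħ) (s : ℤˣ) (α : ℂ) {t : ℝ} (ht : 0 < t) :
    hExponent ħ ξ k s α 0 t = -(2 * ħ * (expG ħ ξ t * expY ħ k t ^ 2) /
        (expG ħ ξ t ^ 2 * expY ħ k t ^ 4 - 1)) *
      Complex.exp (Complex.I * α * t - ((s : ℤ) : ℂ) * hShift ħ ξ k * t) := by
  rw [hExponent_apply_zero hħ s α ht.ne', sinh_ħrt_half]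
  have h2 := expY_ne_zero ħ k t
  have h3 := expG_ne_zero ħ ξ t
  field_simp

theorem hExponent_neg (hħ : 0 < ħ) (s : ℤˣ) (α : ℂ) {t : ℝ} (ht : 0 < t) :
    hExponent ħ ξ k s α 0 (-t) = (2 * ħ * (expG ħ ξ t * expY ħ k t ^ 2) /
        (expG ħ ξ t ^ 2 * expY ħ k t ^ 4 - 1)) *
      Complex.exp (-(Complex.I * α * t) + ((s : ℤ) : ℂ) * hShift ħ ξ k * t) := by
  have e : ħ * (ξ + k) * -t / 2 = -(ħ * (ξ + k) * t / 2) := by ring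
  rw [hExponent_apply_zero hħ s α (neg_ne_zero.2 ht.ne'), e, Real.sinh_neg, Complex.ofReal_neg,
    sinh_ħrt_half, div_neg, neg_neg]
  have h2 := expY_ne_zero ħ k t
  have h3 := expG_ne_zero ħ ξ t
  have e2 : Complex.I * α * ((-t : ℝ) : ℂ) - ((s : ℤ) : ℂ) * hShift ħ ξ k * ((-t : ℝ) : ℂ) =
      -(Complex.I * α * t) + ((s : ℤ) : ℂ) * hShift ħ ξ k * t := by push_cast; ring
  rw [e2]
  field_simp

theorem fieldCoeff_shift (hħ : 0 < ħ) (hk : 0 < k) (α : ℂ) (D t : ℝ) :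
    fieldCoeff ħ 1 1 k α D t = Complex.exp (Complex.I * α * t) * fieldCoeff ħ 1 1 k 0 D t :=
  (coeffFamily_fieldCoeff hħ one_pos hk).shift α t

/-- A partial fraction decomposition splits the integrand into the Gamma integrands of periods `ħξ`
and `ħ(ξ + k)`, with opposite signs. -/
theorem hasExp_HH (hħ : 0 < ħ) (hξ : 0 < ξ) (hk : 0 < k) (s s' : ℤˣ) {α β z : ℂ}
    (hz : z = -(Complex.I * (α - β)) + (((s : ℤ) : ℂ) - ((s' : ℤ) : ℂ)) * hShift ħ ξ k)
    (hre : ħ < z.re) :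
    HasExpFinitePart (contractionIntegrand ħ ξ k (hExponent ħ ξ k s α) (hExponent ħ ξ k s' β))
      ((gammaRatio ħ (ħ * ξ) z)⁻¹ * gammaRatio ħ (ħ * (ξ + k)) z) := by
  refine ((hasExpFinitePart_gammaRatio hħ (mul_pos hħ hξ) hre).neg.add
    (hasExpFinitePart_gammaRatio hħ (mul_pos hħ (add_pos hξ hk)) hre)).congr fun t ht => ?_
  have ht : 0 < t := ht
  beta_reduce
  have h1 := expX_ne_zero ħ t
  have h2 := expY_ne_zero ħ k t
  have h3 := expG_ne_zero ħ ξ t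
  have h6 := expG_sub_ne_zero hħ hξ ht
  have h7 := expGY_sub_ne_zero hħ hξ hk ht
  have h7' : expY ħ k t ^ 4 * expG ħ ξ t ^ 2 - 1 ≠ 0 := by rwa [mul_comm]
  have h8 : (t : ℂ) ≠ 0 := by exact_mod_cast ht.ne'
  have h9 : (ħ : ℂ) ≠ 0 := by exact_mod_cast hħ.ne'
  have e : Complex.exp (-(z * t)) =
      Complex.exp (Complex.I * α * t - ((s : ℤ) : ℂ) * hShift ħ ξ k * t) *
        Complex.exp (-(Complex.I * β * t) + ((s' : ℤ) : ℂ) * hShift ħ ξ k * t) := by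
    rw [← Complex.exp_add, hz]; ring_nf
  rw [contractionIntegrand_h_left, hExponent_pos hħ s α ht, hExponent_neg hħ s' β ht,
    commutator_zero_eq hħ ht hξ, gammaIntegrand_xi hħ hξ z ht, gammaIntegrand_r hħ hξ hk z ht, e]
  generalize Complex.exp (Complex.I * α * t - ((s : ℤ) : ℂ) * hShift ħ ξ k * t) = P
  generalize Complex.exp (-(Complex.I * β * t) + ((s' : ℤ) : ℂ) * hShift ħ ξ k * t) = Q
  field_simp
  ring

end

end FreeField

/-! ### Contractions of `H` with `E` and `F` -/

namespace FreeField

section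

variable {ħ ξ k : ℝ}

theorem eExponent_zero_pos (hħ : 0 < ħ) (hk : 0 < k) (u : ℤˣ) (β : ℂ) {t : ℝ} (ht : 0 < t) :
    eExponent ħ k u β 0 t = -(Complex.exp (Complex.I * β * t) *
      (2 * ħ * expY ħ k t ^ 2 / (expY ħ k t ^ 4 - 1))) := by
  rw [eExponent_apply_zero, fieldCoeff_shift hħ hk, fieldCoeff_eq hħ _ ht]
  simp

theorem eExponent_zero_neg (hħ : 0 < ħ) (hk : 0 < k) (u : ℤˣ) (β : ℂ) {t : ℝ} (ht : 0 < t) :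
    eExponent ħ k u β 0 (-t) = Complex.exp (-(Complex.I * β * t)) *
      (2 * ħ * expY ħ k t ^ 2 / (expY ħ k t ^ 4 - 1)) := by
  rw [eExponent_apply_zero, fieldCoeff_shift hħ hk, fieldCoeff_neg, fieldCoeff_eq hħ _ ht]
  simp

theorem fExponent_zero_pos (hħ : 0 < ħ) (hk : 0 < k) (u : ℤˣ) (β : ℂ) {t : ℝ} (ht : 0 < t) :
    fExponent ħ ξ k u β 0 t = Complex.exp (Complex.I * β * t) *
      ((expG ħ ξ t ^ 2 - 1) * expY ħ k t ^ 2 / (expG ħ ξ t ^ 2 * expY ħ k t ^ 4 - 1) *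
        (2 * ħ * expY ħ k t ^ 2 / (expY ħ k t ^ 4 - 1))) := by
  rw [fExponent_apply_zero, fieldCoeff_shift hħ hk, fieldCoeff_eq hħ _ ht, primeRatio_eq]
  simp
  ring

theorem fExponent_zero_neg (hħ : 0 < ħ) (hk : 0 < k) (u : ℤˣ) (β : ℂ) {t : ℝ} (ht : 0 < t) :
    fExponent ħ ξ k u β 0 (-t) = -(Complex.exp (-(Complex.I * β * t)) *
      ((expG ħ ξ t ^ 2 - 1) * expY ħ k t ^ 2 / (expG ħ ξ t ^ 2 * expY ħ k t ^ 4 - 1) *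
        (2 * ħ * expY ħ k t ^ 2 / (expY ħ k t ^ 4 - 1)))) := by
  rw [fExponent_apply_zero, fieldCoeff_shift hħ hk, fieldCoeff_neg, fieldCoeff_eq hħ _ ht,
    primeRatio_neg, primeRatio_eq]
  simp
  ring

theorem exp_add_half_xi (z : ℂ) (t : ℝ) :
    Complex.exp (-((z + (ħ * ξ : ℝ) / 2) * t)) = Complex.exp (-(z * t)) * (expG ħ ξ t)⁻¹ := by
  rw [expG, ← Complex.exp_neg, ← Complex.exp_add]; congr 1; push_cast; ring

theorem exp_add_half_r (z : ℂ) (t : ℝ) : Complex.exp (-((z + (ħ * (ξ + k) : ℝ) / 2) * t)) =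
    Complex.exp (-(z * t)) * (expG ħ ξ t * expY ħ k t ^ 2)⁻¹ := by
  rw [expG, expY_sq, ← Complex.exp_add, ← Complex.exp_neg, ← Complex.exp_add]
  congr 1; push_cast; ring

theorem lt_re_add_half {c ω : ℝ} (hω : 0 < ω) {z : ℂ} (hz : c < z.re) :
    c < (z + (ω : ℝ) / 2).re := by
  have : (ω : ℂ) / 2 = ((ω / 2 : ℝ) : ℂ) := by push_cast; rfl
  rw [this, Complex.add_re, Complex.ofReal_re]
  linarith

/-- Only `a_0` occurs in `H`, and the product of coefficients is a single Gamma integrand. A factor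
`expG` in place of its square moves the argument by half the period. -/
theorem hasExp_HE (hħ : 0 < ħ) (hξ : 0 < ξ) (hk : 0 < k) (s u : ℤˣ) {α β z : ℂ}
    (hz : z = -(Complex.I * (α - β)) + ((s : ℤ) : ℂ) * hShift ħ ξ k) (hre : ħ < z.re) :
    HasExpFinitePart (contractionIntegrand ħ ξ k (hExponent ħ ξ k s α) (eExponent ħ k u β))
      (gammaRatio ħ (ħ * ξ) (z + (ħ * ξ : ℝ) / 2))⁻¹ := by
  have hω : 0 < ħ * ξ := mul_pos hħ hξ
  refine (hasExpFinitePart_gammaRatio hħ hω (lt_re_add_half hω hre)).neg.congr fun t ht => ?_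
  beta_reduce
  have ht : 0 < t := ht
  have h1 := expX_ne_zero ħ t
  have h2 := expY_ne_zero ħ k t
  have h3 := expG_ne_zero ħ ξ t
  have h5 := expY_sub_ne_zero hħ hk ht
  have h6 := expG_sub_ne_zero hħ hξ ht
  have h7 := expGY_sub_ne_zero hħ hξ hk ht
  have h7' : expY ħ k t ^ 4 * expG ħ ξ t ^ 2 - 1 ≠ 0 := by rwa [mul_comm]
  have h8 : (t : ℂ) ≠ 0 := by exact_mod_cast ht.ne'
  have h9 : (ħ : ℂ) ≠ 0 := by exact_mod_cast hħ.ne'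
  have e : Complex.exp (-(z * t)) =
      Complex.exp (Complex.I * α * t - ((s : ℤ) : ℂ) * hShift ħ ξ k * t) *
        Complex.exp (-(Complex.I * β * t)) := by
    rw [← Complex.exp_add, hz]; ring_nf
  rw [contractionIntegrand_h_left, hExponent_pos hħ s α ht, eExponent_zero_neg hħ hk u β ht,
    commutator_zero_eq hħ ht hξ, gammaIntegrand_xi hħ hξ _ ht, exp_add_half_xi, e]
  generalize Complex.exp (Complex.I * α * t - ((s : ℤ) : ℂ) * hShift ħ ξ k * t) = P
  generalize Complex.exp (-(Complex.I * β * t)) = Q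
  field_simp
  try ring

/-- The function is that of `hasExp_HE`, with `z` of opposite sign; the displacement of `H` takes
part in the change of sign. -/
theorem hasExp_EH (hħ : 0 < ħ) (hξ : 0 < ξ) (hk : 0 < k) (s u : ℤˣ) {α β z : ℂ}
    (hz : z = -(Complex.I * (β - α)) - ((s : ℤ) : ℂ) * hShift ħ ξ k) (hre : ħ < z.re) :
    HasExpFinitePart (contractionIntegrand ħ ξ k (eExponent ħ k u β) (hExponent ħ ξ k s α))
      (gammaRatio ħ (ħ * ξ) (z + (ħ * ξ : ℝ) / 2))⁻¹ := by
  have hω : 0 < ħ * ξ := mul_pos hħ hξ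
  refine (hasExpFinitePart_gammaRatio hħ hω (lt_re_add_half hω hre)).neg.congr fun t ht => ?_
  beta_reduce
  have ht : 0 < t := ht
  have h1 := expX_ne_zero ħ t
  have h2 := expY_ne_zero ħ k t
  have h3 := expG_ne_zero ħ ξ t
  have h5 := expY_sub_ne_zero hħ hk ht
  have h6 := expG_sub_ne_zero hħ hξ ht
  have h7 := expGY_sub_ne_zero hħ hξ hk ht
  have h7' : expY ħ k t ^ 4 * expG ħ ξ t ^ 2 - 1 ≠ 0 := by rwa [mul_comm]
  have h8 : (t : ℂ) ≠ 0 := by exact_mod_cast ht.ne'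
  have h9 : (ħ : ℂ) ≠ 0 := by exact_mod_cast hħ.ne'
  have e : Complex.exp (-(z * t)) =
      Complex.exp (-(Complex.I * α * t) + ((s : ℤ) : ℂ) * hShift ħ ξ k * t) *
        Complex.exp (Complex.I * β * t) := by
    rw [← Complex.exp_add, hz]; ring_nf
  rw [contractionIntegrand_h_right, hExponent_neg hħ s α ht, eExponent_zero_pos hħ hk u β ht,
    commutator_zero_eq hħ ht hξ, gammaIntegrand_xi hħ hξ _ ht, exp_add_half_xi, e]
  generalize Complex.exp (-(Complex.I * α * t) + ((s : ℤ) : ℂ) * hShift ħ ξ k * t) = P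
  generalize Complex.exp (Complex.I * β * t) = Q
  field_simp
  try ring

/-- The factor `primeRatio` replaces the period by `ħ(ξ + k)` and, with the sign of the exponent of
`F`, the Gamma quotient appears uninverted. -/
theorem hasExp_HF (hħ : 0 < ħ) (hξ : 0 < ξ) (hk : 0 < k) (s u : ℤˣ) {α β z : ℂ}
    (hz : z = -(Complex.I * (α - β)) + ((s : ℤ) : ℂ) * hShift ħ ξ k) (hre : ħ < z.re) :
    HasExpFinitePart (contractionIntegrand ħ ξ k (hExponent ħ ξ k s α) (fExponent ħ ξ k u β))
      (gammaRatio ħ (ħ * (ξ + k)) (z + (ħ * (ξ + k) : ℝ) / 2)) := by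
  have hω : 0 < ħ * (ξ + k) := mul_pos hħ (add_pos hξ hk)
  refine (hasExpFinitePart_gammaRatio hħ hω (lt_re_add_half hω hre)).congr fun t ht => ?_
  have ht : 0 < t := ht
  have h1 := expX_ne_zero ħ t
  have h2 := expY_ne_zero ħ k t
  have h3 := expG_ne_zero ħ ξ t
  have h5 := expY_sub_ne_zero hħ hk ht
  have h6 := expG_sub_ne_zero hħ hξ ht
  have h7 := expGY_sub_ne_zero hħ hξ hk ht
  have h7' : expY ħ k t ^ 4 * expG ħ ξ t ^ 2 - 1 ≠ 0 := by rwa [mul_comm]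
  have h8 : (t : ℂ) ≠ 0 := by exact_mod_cast ht.ne'
  have h9 : (ħ : ℂ) ≠ 0 := by exact_mod_cast hħ.ne'
  have e : Complex.exp (-(z * t)) =
      Complex.exp (Complex.I * α * t - ((s : ℤ) : ℂ) * hShift ħ ξ k * t) *
        Complex.exp (-(Complex.I * β * t)) := by
    rw [← Complex.exp_add, hz]; ring_nf
  rw [contractionIntegrand_h_left, hExponent_pos hħ s α ht, fExponent_zero_neg hħ hk u β ht,
    commutator_zero_eq hħ ht hξ, gammaIntegrand_r hħ hξ hk _ ht, exp_add_half_r, e]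
  generalize Complex.exp (Complex.I * α * t - ((s : ℤ) : ℂ) * hShift ħ ξ k * t) = P
  generalize Complex.exp (-(Complex.I * β * t)) = Q
  field_simp
  try ring

theorem hasExp_FH (hħ : 0 < ħ) (hξ : 0 < ξ) (hk : 0 < k) (s u : ℤˣ) {α β z : ℂ}
    (hz : z = -(Complex.I * (β - α)) - ((s : ℤ) : ℂ) * hShift ħ ξ k) (hre : ħ < z.re) :
    HasExpFinitePart (contractionIntegrand ħ ξ k (fExponent ħ ξ k u β) (hExponent ħ ξ k s α))
      (gammaRatio ħ (ħ * (ξ + k)) (z + (ħ * (ξ + k) : ℝ) / 2)) := by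
  have hω : 0 < ħ * (ξ + k) := mul_pos hħ (add_pos hξ hk)
  refine (hasExpFinitePart_gammaRatio hħ hω (lt_re_add_half hω hre)).congr fun t ht => ?_
  have ht : 0 < t := ht
  have h1 := expX_ne_zero ħ t
  have h2 := expY_ne_zero ħ k t
  have h3 := expG_ne_zero ħ ξ t
  have h5 := expY_sub_ne_zero hħ hk ht
  have h6 := expG_sub_ne_zero hħ hξ ht
  have h7 := expGY_sub_ne_zero hħ hξ hk ht
  have h7' : expY ħ k t ^ 4 * expG ħ ξ t ^ 2 - 1 ≠ 0 := by rwa [mul_comm]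
  have h8 : (t : ℂ) ≠ 0 := by exact_mod_cast ht.ne'
  have h9 : (ħ : ℂ) ≠ 0 := by exact_mod_cast hħ.ne'
  have e : Complex.exp (-(z * t)) =
      Complex.exp (-(Complex.I * α * t) + ((s : ℤ) : ℂ) * hShift ħ ξ k * t) *
        Complex.exp (Complex.I * β * t) := by
    rw [← Complex.exp_add, hz]; ring_nf
  rw [contractionIntegrand_h_right, hExponent_neg hħ s α ht, fExponent_zero_pos hħ hk u β ht,
    commutator_zero_eq hħ ht hξ, gammaIntegrand_r hħ hξ hk _ ht, exp_add_half_r, e]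
  generalize Complex.exp (-(Complex.I * α * t) + ((s : ℤ) : ℂ) * hShift ħ ξ k * t) = P
  generalize Complex.exp (Complex.I * β * t) = Q
  field_simp
  try ring

end

end FreeField

namespace FreeField

/-! ### Matrix elements -/

/-- Entire functions that are bounded on horizontal strips. -/
structure EntireOnStrips (F : ℂ → ℂ) : Prop where
  diff : Differentiable ℂ F
  bound : ∀ R : ℝ, ∃ C, ∀ z : ℂ, |z.im| ≤ R → ‖F z‖ ≤ C

namespace EntireOnStrips

variable {F G : ℂ → ℂ}

theorem const (c : ℂ) : EntireOnStrips fun _ => c :=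
  ⟨differentiable_const c, fun _ => ⟨‖c‖, fun _ _ => le_rfl⟩⟩

theorem add (hF : EntireOnStrips F) (hG : EntireOnStrips G) : EntireOnStrips fun z => F z + G z := by
  refine ⟨hF.diff.add hG.diff, fun R => ?_⟩
  obtain ⟨A, hA⟩ := hF.bound R
  obtain ⟨B, hB⟩ := hG.bound R
  exact ⟨A + B, fun z hz => (norm_add_le _ _).trans (add_le_add (hA z hz) (hB z hz))⟩

theorem mul (hF : EntireOnStrips F) (hG : EntireOnStrips G) : EntireOnStrips fun z => F z * G z := by
  refine ⟨hF.diff.mul hG.diff, fun R => ?_⟩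
  obtain ⟨A, hA⟩ := hF.bound R
  obtain ⟨B, hB⟩ := hG.bound R
  refine ⟨A * B, fun z hz => ?_⟩
  rw [norm_mul]
  exact mul_le_mul (hA z hz) (hB z hz) (norm_nonneg _) ((norm_nonneg _).trans (hA z hz))

theorem exp (hF : EntireOnStrips F) : EntireOnStrips fun z => Complex.exp (F z) := by
  refine ⟨hF.diff.cexp, fun R => ?_⟩
  obtain ⟨A, hA⟩ := hF.bound R
  exact ⟨Real.exp A, fun z hz => (Complex.norm_exp_le_exp_norm _).trans
    (Real.exp_le_exp.2 (hA z hz))⟩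

theorem sum {ι : Type*} (s : Finset ι) {F : ι → ℂ → ℂ} (hF : ∀ i ∈ s, EntireOnStrips (F i)) :
    EntireOnStrips fun z => ∑ i ∈ s, F i z := by
  classical
  induction s using Finset.induction_on with
  | empty => simpa using const 0
  | insert i s hi ih =>
    simp only [Finset.sum_insert hi]
    exact (hF i (by simp)).add (ih fun j hj => hF j (by simp [hj]))

theorem comp_add (hF : EntireOnStrips F) (c : ℂ) : EntireOnStrips fun z => F (z + c) := by
  refine ⟨hF.diff.comp (differentiable_id.add_const c), fun R => ?_⟩
  obtain ⟨A, hA⟩ := hF.bound (R + |c.im|)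
  refine ⟨A, fun z hz => hA _ ?_⟩
  rw [Complex.add_im]
  exact (abs_add_le _ _).trans (by linarith)

end EntireOnStrips

/-- On the strip `|Im α| ≤ R` the exponential is at most `exp(R |B|)` where `F` does not vanish.
This bounds the integral and also dominates its derivative. The two values of `c` serve the two
arguments of a contraction. -/
theorem entireOnStrips_integral {μ : Measure ℝ} {F : ℝ → ℂ} {B : ℝ} (hF : Integrable F μ)
    (hB : ∀ᵐ t ∂μ, B < |t| → F t = 0) {c : ℂ} (hc : c = Complex.I ∨ c = -Complex.I) :
    EntireOnStrips fun α => ∫ t, Complex.exp (c * α * t) * F t ∂μ := by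
  have hcn : ‖c‖ = 1 := by rcases hc with rfl | rfl <;> simp
  have hcre : ∀ α : ℂ, |(c * α).re| ≤ |α.im| := by
    intro α; rcases hc with rfl | rfl <;> simp
  have key : ∀ R : ℝ, 0 ≤ R → ∀ t : ℝ, (B < |t| → F t = 0) → ∀ α : ℂ, |α.im| ≤ R →
      ‖Complex.exp (c * α * t) * F t‖ ≤ Real.exp (R * |B|) * ‖F t‖ := by
    intro R hR t ht α hα
    rw [norm_mul, Complex.norm_exp]
    rcases lt_or_ge B |t| with h | h
    · simp [ht h]
    · refine mul_le_mul_of_nonneg_right (Real.exp_le_exp.2 ?_) (norm_nonneg _)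
      rw [Complex.re_mul_ofReal]
      refine (le_abs_self _).trans ?_
      rw [abs_mul]
      exact mul_le_mul ((hcre α).trans hα) (h.trans (le_abs_self B)) (abs_nonneg t) hR
  have hmeas : ∀ α : ℂ, AEStronglyMeasurable (fun t : ℝ => Complex.exp (c * α * t) * F t) μ :=
    fun α => (by fun_prop : Continuous fun t : ℝ =>
      Complex.exp (c * α * t)).aestronglyMeasurable.mul hF.1
  have hint : ∀ α : ℂ, Integrable (fun t : ℝ => Complex.exp (c * α * t) * F t) μ := by
    intro α
    refine Integrable.mono' (hF.norm.const_mul (Real.exp (|α.im| * |B|))) (hmeas α) ?_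
    exact hB.mono fun t ht => key _ (abs_nonneg _) t ht α le_rfl
  constructor
  · intro α
    refine (hasDerivAt_integral_of_dominated_loc_of_deriv_le (μ := μ)
      (F := fun α (t : ℝ) => Complex.exp (c * α * t) * F t)
      (F' := fun α (t : ℝ) => c * t * (Complex.exp (c * α * t) * F t))
      (bound := fun t => |B| * (Real.exp ((|α.im| + 1) * |B|) * ‖F t‖))
      (Metric.ball_mem_nhds α one_pos) (Eventually.of_forall hmeas) (hint α) ?_ ?_ ?_
      ?_).2.differentiableAt
    · exact (by fun_prop : Continuous fun t : ℝ => c * (t : ℂ)).aestronglyMeasurable.mul (hmeas α)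
    · refine hB.mono fun t ht β hβ => ?_
      rcases lt_or_ge B |t| with h | h
      · rw [ht h, mul_zero, mul_zero, norm_zero]; positivity
      · rw [norm_mul, norm_mul, hcn, one_mul, Complex.norm_real, Real.norm_eq_abs]
        refine mul_le_mul (h.trans (le_abs_self B)) (key _ (by positivity) t ht β ?_)
          (norm_nonneg _) (abs_nonneg _)
        have h1 := Complex.abs_im_le_norm (β - α)
        rw [Metric.mem_ball, dist_eq_norm] at hβ
        rw [Complex.sub_im] at h1
        have h2 := abs_sub_abs_le_abs_sub β.im α.im
        linarith
    · exact (hF.norm.const_mul _).const_mul _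
    · refine Eventually.of_forall fun t β _ => ?_
      have h := (((hasDerivAt_id β).const_mul c).mul_const (t : ℂ)).cexp.mul_const (F t)
      refine h.congr_deriv ?_
      simp only [id]
      ring
  · intro R
    refine ⟨∫ t, Real.exp (|R| * |B|) * ‖F t‖ ∂μ, fun z hz => ?_⟩
    refine norm_integral_le_of_norm_le (hF.norm.const_mul _) ?_
    exact hB.mono fun t ht => key _ (abs_nonneg _) t ht z (hz.trans (le_abs_self R))

theorem ae_Ioi_of_eventually_zero {F : ℝ → ℂ} (h : ∀ᶠ t in atTop, F t = 0) :
    ∃ B : ℝ, ∀ᵐ t ∂volume.restrict (Ioi (0 : ℝ)), B < |t| → F t = 0 := by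
  obtain ⟨B, hB⟩ := eventually_atTop.1 h
  refine ⟨B, (ae_restrict_iff' measurableSet_Ioi).2 (Eventually.of_forall fun t ht h => hB t ?_)⟩
  rw [abs_of_pos ht] at h
  exact h.le

/-- The divided difference of an entire function is entire in both variables. -/
theorem exists_divided_difference {q : ℂ → ℂ} (hq : Differentiable ℂ q) :
    ∃ Q : ℂ × ℂ → ℂ, Differentiable ℂ Q ∧ ∀ x y, q y - q x = (y - x) * Q (x, y) := by
  have hq' : Differentiable ℂ (deriv q) := hq.deriv
  have hq'' : Differentiable ℂ (deriv (deriv q)) := hq'.deriv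
  -- `L s x` runs through the segment from `x.1` to `x.2`. The divided difference is the mean of
  -- `deriv q` over this segment, differentiated under the integral sign.
  let L : ℝ → ℂ × ℂ →L[ℂ] ℂ := fun s =>
    ContinuousLinearMap.fst ℂ ℂ ℂ +
      (s : ℂ) • (ContinuousLinearMap.snd ℂ ℂ ℂ - ContinuousLinearMap.fst ℂ ℂ ℂ)
  have hL : Continuous L := by fun_prop
  have hLx : ∀ s x, L s x = x.1 + s * (x.2 - x.1) := fun s x => by simp [L]
  have hcont : ∀ x, Continuous fun s : ℝ => deriv q (L s x) := fun x =>
    hq'.continuous.comp (hL.clm_apply continuous_const)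
  have hF' : Continuous fun p : (ℂ × ℂ) × ℝ => deriv (deriv q) (L p.2 p.1) • L p.2 := by
    have h1 : Continuous fun p : (ℂ × ℂ) × ℝ => L p.2 := hL.comp continuous_snd
    exact (hq''.continuous.comp (h1.clm_apply continuous_fst)).smul h1
  refine ⟨fun x => ∫ s in (0 : ℝ)..1, deriv q (L s x), fun x => ?_, fun x y => ?_⟩
  · obtain ⟨C, hC⟩ := ((isCompact_closedBall x 1).prod (isCompact_Icc (a := (0 : ℝ)) (b := 1))
      ).exists_bound_of_continuousOn hF'.continuousOn
    refine (intervalIntegral.hasFDerivAt_integral_of_dominated_of_fderiv_le (𝕜 := ℂ)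
      (F := fun x s => deriv q (L s x)) (F' := fun x s => deriv (deriv q) (L s x) • L s)
      (bound := fun _ => C) (Metric.ball_mem_nhds x one_pos)
      (Eventually.of_forall fun x => (hcont x).aestronglyMeasurable)
      ((hcont x).intervalIntegrable 0 1)
      (hF'.comp (Continuous.prodMk_right x)).aestronglyMeasurable
      (Eventually.of_forall fun s hs y hy => ?_) intervalIntegrable_const
      (Eventually.of_forall fun s hs y hy => ?_)).differentiableAt
    · rw [uIoc_of_le zero_le_one] at hs
      exact hC (y, s) ⟨Metric.ball_subset_closedBall hy, hs.1.le, hs.2⟩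
    · exact (hq' (L s y)).hasDerivAt.comp_hasFDerivAt y (L s).hasFDerivAt
  · have h : ∀ s ∈ uIcc (0 : ℝ) 1, HasDerivAt (fun s : ℝ => q (L s (x, y)))
        ((y - x) * deriv q (L s (x, y))) s := by
      intro s _
      have h2 : HasDerivAt (fun s : ℝ => L s (x, y)) (y - x) s := by
        simp only [hLx]
        exact ((((hasDerivAt_id s).ofReal_comp).mul_const (y - x)).const_add x).congr_deriv
          (by simp)
      have h3 := (hq (L s (x, y))).hasDerivAt.comp s h2
      exact h3.congr_deriv (mul_comm _ _)
    have h4 := intervalIntegral.integral_eq_sub_of_hasDerivAt h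
      ((continuous_const.mul (hcont (x, y))).intervalIntegrable 0 1)
    rw [intervalIntegral.integral_const_mul] at h4
    rw [h4]
    simp [hLx]

/-- The algebra generated by the entire functions of one of two variables. -/
noncomputable def splitAlgebra : Subalgebra ℂ (ℂ × ℂ → ℂ) :=
  Algebra.adjoin ℂ {A | ∃ p : ℂ → ℂ, Differentiable ℂ p ∧
    ((A = fun x => p x.1) ∨ A = fun x => p x.2)}

theorem fst_mem_splitAlgebra {p : ℂ → ℂ} (hp : Differentiable ℂ p) :
    (fun x : ℂ × ℂ => p x.1) ∈ splitAlgebra :=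
  Algebra.subset_adjoin ⟨p, hp, Or.inl rfl⟩

theorem snd_mem_splitAlgebra {p : ℂ → ℂ} (hp : Differentiable ℂ p) :
    (fun x : ℂ × ℂ => p x.2) ∈ splitAlgebra :=
  Algebra.subset_adjoin ⟨p, hp, Or.inr rfl⟩

theorem differentiable_of_mem_splitAlgebra {A : ℂ × ℂ → ℂ} (hA : A ∈ splitAlgebra) :
    Differentiable ℂ A := by
  induction hA using Algebra.adjoin_induction with
  | mem A h =>
    obtain ⟨p, hp, rfl | rfl⟩ := h
    · exact hp.comp differentiable_fst
    · exact hp.comp differentiable_snd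
  | algebraMap c => exact differentiable_const c
  | add A B _ _ hA hB => exact hA.add hB
  | mul A B _ _ hA hB => exact hA.mul hB

/-- In the application `ρ` projects onto a pole line `l = 0`, so `A (ρ x)` carries the residue and
the rest is divisible by `l`. Divisibility passes to sums and products, and for the generators it is
a divided difference. -/
theorem exists_factor_of_mem_splitAlgebra {A : ℂ × ℂ → ℂ} (hA : A ∈ splitAlgebra)
    {ρ : ℂ × ℂ → ℂ × ℂ} (hρ : Differentiable ℂ ρ) {l : ℂ × ℂ → ℂ} {a b : ℂ}
    (h1 : ∀ x, (ρ x).1 - x.1 = l x * a) (h2 : ∀ x, (ρ x).2 - x.2 = l x * b) :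
    ∃ Q : ℂ × ℂ → ℂ, Differentiable ℂ Q ∧ ∀ x, A (ρ x) - A x = l x * Q x := by
  induction hA using Algebra.adjoin_induction with
  | mem A h =>
    obtain ⟨p, hp, rfl | rfl⟩ := h
    · obtain ⟨Q, hQ, h⟩ := exists_divided_difference hp
      refine ⟨fun x => a * Q (x.1, (ρ x).1), (hQ.comp (differentiable_fst.prodMk
        (differentiable_fst.comp hρ))).const_mul a, fun x => ?_⟩
      rw [h, h1]; ring
    · obtain ⟨Q, hQ, h⟩ := exists_divided_difference hp
      refine ⟨fun x => b * Q (x.2, (ρ x).2), (hQ.comp (differentiable_snd.prodMk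
        (differentiable_snd.comp hρ))).const_mul b, fun x => ?_⟩
      rw [h, h2]; ring
  | algebraMap c => exact ⟨0, differentiable_const 0, fun x => by simp [Pi.algebraMap_apply]⟩
  | add A B _ _ hA hB =>
    obtain ⟨P, hP, hP'⟩ := hA
    obtain ⟨Q, hQ, hQ'⟩ := hB
    refine ⟨P + Q, hP.add hQ, fun x => ?_⟩
    simp only [Pi.add_apply]
    linear_combination hP' x + hQ' x
  | mul A B hA0 hB0 hA hB =>
    obtain ⟨P, hP, hP'⟩ := hA
    obtain ⟨Q, hQ, hQ'⟩ := hB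
    refine ⟨fun x => P x * B (ρ x) + A x * Q x,
      (hP.mul ((differentiable_of_mem_splitAlgebra hB0).comp hρ)).add
        ((differentiable_of_mem_splitAlgebra hA0).mul hQ), fun x => ?_⟩
    simp only [Pi.mul_apply]
    linear_combination B (ρ x) * hP' x + A x * hQ' x

end FreeField

/-! ### Matrix elements of normal ordered exponentials and Wick's theorem -/

namespace FreeField

section

variable {M ħ ξ k : ℝ} {f g : ℂ → Modes} {u v : Modes} {Φ : State}

theorem entireOnStrips_contraction_right (hħ : 0 < ħ) (hξ : 0 < ξ) (hk : 0 < k) (hv : IsTest v)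
    (hf : ModeFamily M f) : EntireOnStrips fun α => contraction ħ ξ k v (f α) := by
  have h0 := testPair_left hħ hξ hk (hf.contOff 0) hv
  obtain ⟨B, hB⟩ := ae_Ioi_of_eventually_zero h0.top
  have h := entireOnStrips_integral h0.integrableOn hB (Or.inr rfl)
  have e : (fun α => contraction ħ ξ k v (f α)) = fun α : ℂ => ∫ t in Ioi (0 : ℝ),
      Complex.exp (-Complex.I * α * t) * contractionIntegrand ħ ξ k v (f 0) t := by
    funext α
    rw [(testPair_left hħ hξ hk (hf.contOff α) hv).contraction_eq]
    congr 1
    funext t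
    simp only [contractionIntegrand, Finset.mul_sum]
    refine Finset.sum_congr rfl fun j _ => ?_
    rw [(hf j).shift α]
    push_cast
    ring_nf
  rwa [e]

theorem entireOnStrips_contraction_left (hħ : 0 < ħ) (hξ : 0 < ξ) (hk : 0 < k) (hu : IsTest u)
    (hf : ModeFamily M f) : EntireOnStrips fun α => contraction ħ ξ k (f α) u := by
  have h0 := testPair_right hħ hξ hk (hf.contOff 0) hu
  obtain ⟨B, hB⟩ := ae_Ioi_of_eventually_zero h0.top
  have h := entireOnStrips_integral h0.integrableOn hB (Or.inl rfl)
  have e : (fun α => contraction ħ ξ k (f α) u) = fun α : ℂ => ∫ t in Ioi (0 : ℝ),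
      Complex.exp (Complex.I * α * t) * contractionIntegrand ħ ξ k (f 0) u t := by
    funext α
    rw [(testPair_right hħ hξ hk (hf.contOff α) hu).contraction_eq]
    congr 1
    funext t
    simp only [contractionIntegrand, Finset.mul_sum]
    refine Finset.sum_congr rfl fun j _ => ?_
    rw [(hf j).shift α]
    ring
  rwa [e]

theorem contraction_add_test (hħ : 0 < ħ) (hξ : 0 < ξ) (hk : 0 < k) {v w u : Modes}
    (hv : ContOff v) (hw : ContOff w) (hu : IsTest u) :
    contraction ħ ξ k (v + w) u = contraction ħ ξ k v u + contraction ħ ξ k w u :=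
  contraction_add_left (testPair_right hħ hξ hk hv hu).contractible
    (testPair_right hħ hξ hk hw hu).contractible

/-- Contractions with test modes are additive in the mode, so a Fock vector at `v + f α` is a
polynomial in entire functions of `α`. -/
theorem entireOnStrips_fock (hħ : 0 < ħ) (hξ : 0 < ξ) (hk : 0 < k) (hv : ContOff v)
    (hf : ModeFamily M f) (hΦ : Φ ∈ Fock ħ ξ k) : EntireOnStrips fun α => Φ (v + f α) := by
  induction hΦ using Algebra.adjoin_induction with
  | mem Φ h =>
    obtain ⟨u, hu, rfl⟩ := h
    simp only [contraction_add_test hħ hξ hk hv (hf.contOff _) hu]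
    exact (EntireOnStrips.const _).add (entireOnStrips_contraction_left hħ hξ hk hu hf)
  | algebraMap c => exact EntireOnStrips.const c
  | add A B _ _ hA hB => exact hA.add hB
  | mul A B _ _ hA hB => exact hA.mul hB

theorem fock_mem_splitAlgebra (hħ : 0 < ħ) (hξ : 0 < ξ) (hk : 0 < k) (hv : ContOff v)
    (hf : ModeFamily M f) (hg : ModeFamily M g) (hΦ : Φ ∈ Fock ħ ξ k) :
    (fun x : ℂ × ℂ => Φ (v + f x.1 + g x.2)) ∈ splitAlgebra := by
  induction hΦ using Algebra.adjoin_induction with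
  | mem Φ h =>
    obtain ⟨u, hu, rfl⟩ := h
    simp only [contraction_add_test hħ hξ hk (hv.add (hf.contOff _)) (hg.contOff _) hu,
      contraction_add_test hħ hξ hk hv (hf.contOff _) hu]
    exact add_mem (add_mem (Subalgebra.algebraMap_mem _ (contraction ħ ξ k v u))
      (fst_mem_splitAlgebra (entireOnStrips_contraction_left hħ hξ hk hu hf).diff))
      (snd_mem_splitAlgebra (entireOnStrips_contraction_left hħ hξ hk hu hg).diff)
  | algebraMap c => exact Subalgebra.algebraMap_mem _ c
  | add A B _ _ hA hB => exact add_mem hA hB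
  | mul A B _ _ hA hB => exact mul_mem hA hB

/-- The matrix element of `:exp(f(α) + g(β)):`. -/
noncomputable def normalPair (ħ ξ k : ℝ) (v : Modes) (Φ : State) (f g : ℂ → Modes)
    (x : ℂ × ℂ) : ℂ :=
  Complex.exp (contraction ħ ξ k v (f x.1)) * Complex.exp (contraction ħ ξ k v (g x.2)) *
    Φ (v + f x.1 + g x.2)

theorem normalPair_mem (hħ : 0 < ħ) (hξ : 0 < ξ) (hk : 0 < k) (hv : IsTest v)
    (hf : ModeFamily M f) (hg : ModeFamily M g) (hΦ : Φ ∈ Fock ħ ξ k) :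
    normalPair ħ ξ k v Φ f g ∈ splitAlgebra :=
  mul_mem (mul_mem
    (fst_mem_splitAlgebra (entireOnStrips_contraction_right hħ hξ hk hv hf).exp.diff)
    (snd_mem_splitAlgebra (entireOnStrips_contraction_right hħ hξ hk hv hg).exp.diff))
    (fock_mem_splitAlgebra hħ hξ hk hv.contOff hf hg hΦ)

/-! ### Currents that are linear combinations of normal ordered exponentials -/

/-- `X(α) = ∑ i, a i :exp(f i α):`, as an operator that is applied to states at modes with a
contraction with the exponents in `P`. -/
structure IsVertexCurrent (ħ ξ k M : ℝ) {ι : Type} [Fintype ι] (X : ℂ → Op) (a : ι → ℂ)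
    (f : ι → ℂ → Modes) (P : Set (ℂ → Modes)) : Prop where
  parts : ∀ p ∈ P, ModeFamily M p
  family : ∀ i, ModeFamily M (f i)
  apply_eq : ∀ (α : ℂ) (v : Modes), (∀ p ∈ P, Contractible ħ ξ k v (p α)) → ∀ Φ : State,
    X α Φ v = ∑ i, a i * (Complex.exp (contraction ħ ξ k v (f i α)) * Φ (v + f i α))

namespace IsVertexCurrent

variable {ι κ : Type} [Fintype ι] [Fintype κ] {X Y : ℂ → Op} {a : ι → ℂ} {b : κ → ℂ}
  {f : ι → ℂ → Modes} {g : κ → ℂ → Modes} {P Q : Set (ℂ → Modes)}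

theorem apply_test (hX : IsVertexCurrent ħ ξ k M X a f P) (hħ : 0 < ħ) (hξ : 0 < ξ) (hk : 0 < k)
    (hv : IsTest v) (α : ℂ) (Φ : State) :
    X α Φ v = ∑ i, a i * (Complex.exp (contraction ħ ξ k v (f i α)) * Φ (v + f i α)) :=
  hX.apply_eq α v (fun p hp =>
    (testPair_left hħ hξ hk ((hX.parts p hp).contOff α) hv).contractible) Φ

theorem entireOnStrips (hX : IsVertexCurrent ħ ξ k M X a f P) (hħ : 0 < ħ) (hξ : 0 < ξ)
    (hk : 0 < k) (hv : IsTest v) (hΦ : Φ ∈ Fock ħ ξ k) : EntireOnStrips fun α => X α Φ v := by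
  simp only [hX.apply_test hħ hξ hk hv]
  exact EntireOnStrips.sum _ fun i _ => (EntireOnStrips.const _).mul
    ((entireOnStrips_contraction_right hħ hξ hk hv (hX.family i)).exp.mul
      (entireOnStrips_fock hħ hξ hk hv.contOff (hX.family i) hΦ))

/-- Wick's theorem: the first factor translates `v` by `f i α`, and `⟨v + f, g⟩ = ⟨v, g⟩ + ⟨f, g⟩`
splits off a scalar. As `v + f i α` is in general no test mode, `apply_eq` is demanded for all modes
contractible with `P`. -/
theorem mul_apply (hX : IsVertexCurrent ħ ξ k M X a f P) (hY : IsVertexCurrent ħ ξ k M Y b g Q)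
    (hħ : 0 < ħ) (hξ : 0 < ξ) (hk : 0 < k) (hv : IsTest v) {α β : ℂ}
    (hαβ : ħ * (2 + k + ξ) + 2 * M < (α - β).im) (Φ : State) :
    (X α * Y β) Φ v = ∑ i, ∑ j, a i * b j *
      (Complex.exp (contraction ħ ξ k (f i α) (g j β)) *
        normalPair ħ ξ k v Φ (f i) (g j) (α, β)) := by
  rw [Module.End.mul_apply, hX.apply_test hħ hξ hk hv]
  refine Finset.sum_congr rfl fun i _ => ?_
  have hv' : ∀ {p : ℂ → Modes}, ModeFamily M p →
      Contractible ħ ξ k v (p β) ∧ Contractible ħ ξ k (f i α) (p β) := fun hp =>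
    ⟨(testPair_left hħ hξ hk (hp.contOff β) hv).contractible,
      contractible_family hħ hξ hk (hX.family i) hp hαβ⟩
  rw [hY.apply_eq β _ fun p hp =>
    (hv' (hY.parts p hp)).1.add_left (hv' (hY.parts p hp)).2]
  simp only [Finset.mul_sum]
  refine Finset.sum_congr rfl fun j _ => ?_
  rw [contraction_add_left (hv' (hY.family j)).1 (hv' (hY.family j)).2, Complex.exp_add,
    normalPair]
  ring

/-- Exchange relations from those of the contractions. -/
theorem exchange (hX : IsVertexCurrent ħ ξ k M X a f P) (hY : IsVertexCurrent ħ ξ k M Y b g Q)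
    (hħ : 0 < ħ) (hξ : 0 < ξ) (hk : 0 < k) {σ : ℝ} (hσ : ħ * (2 + k + ξ) + 2 * M ≤ σ)
    {num den D : ℂ → ℂ} (n : ι → κ → ℂ → ℂ) (hn : ∀ i j, Differentiable ℂ (n i j))
    (hD : Differentiable ℂ D) (hD0 : ∀ d : ℂ, σ < d.im → D d ≠ 0)
    (h1 : ∀ i j, ∀ α β : ℂ, σ < (α - β).im →
      Complex.exp (contraction ħ ξ k (f i α) (g j β)) = n i j (α - β) / D (α - β))
    (h2 : ∀ i j, ∀ α β : ℂ, σ < (β - α).im → den (α - β) * n i j (α - β) =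
      num (α - β) * D (α - β) * Complex.exp (contraction ħ ξ k (g j β) (f i α))) :
    CurrentAlgebra.Exchange bras (Fock ħ ξ k : Set State) σ X Y num den := by
  refine ⟨D, hD, hD0, ?_⟩
  rintro _ ⟨v, hv, rfl⟩ Φ hΦ
  have hsplit : ∀ i j, Differentiable ℂ (normalPair ħ ξ k v Φ (f i) (g j)) := fun i j =>
    differentiable_of_mem_splitAlgebra
      (normalPair_mem hħ hξ hk hv (hX.family i) (hY.family j) hΦ)
  -- The normal ordered matrix elements enter the numerator only, so one denominator `D` serves all
  -- terms and all vectors.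
  refine ⟨fun x => ∑ i, ∑ j, a i * b j *
    (n i j (x.1 - x.2) * normalPair ħ ξ k v Φ (f i) (g j) x), ?_, ?_, ?_⟩
  · refine Differentiable.fun_sum fun i _ => Differentiable.fun_sum fun j _ => ?_
    exact (((hn i j).comp (differentiable_fst.sub differentiable_snd)).mul
      (hsplit i j)).const_mul _
  · intro α β h
    rw [LinearMap.proj_apply, hX.mul_apply hY hħ hξ hk hv (hσ.trans_lt h)]
    simp only [Finset.sum_div]
    refine Finset.sum_congr rfl fun i _ => Finset.sum_congr rfl fun j _ => ?_
    rw [h1 i j α β h]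
    ring
  · intro α β h
    rw [LinearMap.proj_apply, hY.mul_apply hX hħ hξ hk hv (hσ.trans_lt h), Finset.sum_comm]
    simp only [Finset.mul_sum]
    refine Finset.sum_congr rfl fun i _ => Finset.sum_congr rfl fun j _ => ?_
    -- A normal ordered product does not depend on the order of its factors.
    have e : normalPair ħ ξ k v Φ (g j) (f i) (β, α) = normalPair ħ ξ k v Φ (f i) (g j) (α, β) := by
      simp only [normalPair]
      rw [add_right_comm]
      ring
    rw [e]
    linear_combination a i * b j * normalPair ħ ξ k v Φ (f i) (g j) (α, β) * h2 i j α β h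

end IsVertexCurrent

end

/-! ### The currents as linear combinations of normal ordered exponentials -/

section

variable {M N ħ ξ k : ℝ}

/-- The imaginary part of the shift multiplies the coefficient by a real exponential, whence
`|a.im|` in the growth exponent. -/
theorem CoeffFamily.comp_add {f : ℂ → ℝ → ℂ} (hf : CoeffFamily M f) {a : ℂ} (ha : M + |a.im| ≤ N) :
    CoeffFamily N fun α => f (α + a) := by
  refine ⟨fun α t => ?_, ?_, ?_, ?_⟩
  · rw [hf.shift (α + a), hf.shift (0 + a), ← mul_assoc, ← Complex.exp_add]
    ring_nf
  · have e : f (0 + a) = fun t : ℝ => Complex.exp (Complex.I * a * t) * f 0 t :=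
      funext fun t => by rw [hf.shift, zero_add]
    rw [e]
    exact ContinuousOn.mul (by fun_prop) hf.cont
  · have h := (hf.pos.mul (Tame.exp (Complex.I * a))).mono (N := N) (by
      rw [Complex.I_mul_re]; linarith [neg_le_abs a.im])
    refine h.congr fun t _ => ?_
    rw [hf.shift (0 + a), zero_add]
    ring
  · have h := (hf.neg.mul (Tame.exp (-(Complex.I * a)))).mono (N := N) (by
      rw [Complex.neg_re, Complex.I_mul_re]; linarith [le_abs_self a.im])
    refine h.congr fun t _ => ?_
    rw [hf.shift (0 + a), zero_add]
    push_cast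
    ring_nf

theorem ModeFamily.comp_add {f : ℂ → Modes} (hf : ModeFamily M f) {a : ℂ} (ha : M + |a.im| ≤ N) :
    ModeFamily N fun α => f (α + a) := fun j => (hf j).comp_add ha

theorem ModeFamily.mono {f : ℂ → Modes} (hf : ModeFamily M f) (h : M ≤ N) : ModeFamily N f :=
  fun j => (hf j).mono h

/-- A common growth exponent of the exponents of the currents. -/
noncomputable def vertexBound (ħ ξ k : ℝ) : ℝ := growthBound ħ ξ k + ħ * (ξ + k + 1)

theorem growthBound_le_vertexBound (hħ : 0 < ħ) (hξ : 0 < ξ) (hk : 0 < k) :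
    growthBound ħ ξ k ≤ vertexBound ħ ξ k := by
  have : 0 < ħ * (ξ + k + 1) := by positivity
  unfold vertexBound; linarith

/-- The shifts of the arguments of the two factors of `H^s`. -/
noncomputable def kShift (ħ ξ k : ℝ) (s : ℤˣ) (ε : ℂ) : ℂ :=
  Complex.I * ħ / 2 * (((s : ℤ) : ℂ) * (ξ + k - k / 2) + ε)

theorem modeFamily_kExponent_shift (hħ : 0 < ħ) (hξ : 0 < ξ) (hk : 0 < k) (s : ℤˣ) {ε : ℝ}
    (hε : |ε| ≤ 1) :
    ModeFamily (vertexBound ħ ξ k) fun α => kExponent ħ ξ k (α + kShift ħ ξ k s ε) := by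
  refine (modeFamily_kExponent hħ hξ hk).comp_add ?_
  have e : kShift ħ ξ k s ε = Complex.I * ((ħ / 2 * ((s : ℤ) * (ξ + k / 2) + ε) : ℝ) : ℂ) := by
    rw [kShift]; push_cast; ring
  have hs : |((s : ℤ) : ℝ)| = 1 := by rcases units_int_cases s with rfl | rfl <;> simp
  have h1 : |((s : ℤ) : ℝ) * (ξ + k / 2) + ε| ≤ ξ + k / 2 + 1 := by
    refine (abs_add_le _ _).trans ?_
    rw [abs_mul, hs, one_mul, abs_of_pos (by positivity)]
    linarith
  have h2 : |(kShift ħ ξ k s ε).im| ≤ ħ * (ξ + k + 1) := by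
    rw [e, Complex.I_mul_im, Complex.ofReal_re, abs_mul, abs_of_pos (by positivity)]
    calc ħ / 2 * _ ≤ ħ / 2 * (ξ + k / 2 + 1) := by gcongr
      _ ≤ ħ * (ξ + k + 1) := by nlinarith [mul_pos hħ hξ, mul_pos hħ hk]
  unfold vertexBound
  linarith

/-- Two exponents without a common boson add up in the normal ordered product. -/
theorem normalExp_mul_apply {f g v : Modes} (hf : Contractible ħ ξ k v f)
    (hg : Contractible ħ ξ k v g) (h : ∀ j, f j = 0 ∨ g j = 0) (Φ : State) :
    normalExp ħ ξ k f (normalExp ħ ξ k g Φ) v =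
      Complex.exp (contraction ħ ξ k v (f + g)) * Φ (v + (f + g)) := by
  -- No boson occurs in both `f` and `g`, so they do not contract.
  have e : contraction ħ ξ k (v + f) g = contraction ħ ξ k v g := by
    refine finitePart_congr fun t _ => Finset.sum_congr rfl fun j _ => ?_
    rcases h j with h | h <;> simp [h]
  rw [normalExp_apply, normalExp_apply, e, contraction_add_right hf hg, Complex.exp_add, add_assoc]
  ring

theorem para_field_disjoint (s u : ℤˣ) (α : ℂ) (G : ℝ → ℂ) (j : Fin 3) :
    paraExponent ħ k s u α j = 0 ∨ (Pi.single 0 G : Modes) j = 0 := by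
  rcases eq_or_ne j 0 with rfl | h
  · exact Or.inl (funext fun t => para_zero s u α t)
  · exact Or.inr (by simp [h])

/-- The coefficient is `u` times the parafermion prefactor `-s / ħ` at `s = -1`. The set `P` lists
the exponents of the two factors separately because they act one after the other. -/
theorem isVertexCurrent_E (hħ : 0 < ħ) (hξ : 0 < ξ) (hk : 0 < k) :
    IsVertexCurrent ħ ξ k (vertexBound ħ ξ k) (eCurrent ħ ξ k)
      (fun u : ℤˣ => ((u : ℤ) : ℂ) / ħ) (eExponent ħ k)
      (insert (fun α => -field ħ 0 1 1 k α 0) (range (paraExponent ħ k (-1)))) where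
  parts := by
    have hM := growthBound_le_vertexBound hħ hξ hk
    rintro _ (rfl | ⟨u, rfl⟩)
    · exact (modeFamily_eField hħ hξ hk).mono hM
    · exact (modeFamily_paraExponent hħ hξ hk _ _).mono hM
  family u := (modeFamily_eExponent hħ hξ hk u).mono (growthBound_le_vertexBound hħ hξ hk)
  apply_eq α v hv Φ := by
    have h0 := hv _ (mem_insert _ _)
    have h1 := fun u => hv _ (mem_insert_of_mem _ (mem_range_self u))
    have hd : ∀ u j, paraExponent ħ k (-1) u α j = 0 ∨ (-field ħ 0 1 1 k α 0) j = 0 := by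
      intro u j
      rw [field, ← Pi.single_neg]
      exact para_field_disjoint _ _ _ _ _
    have key := fun u => normalExp_mul_apply (h1 u) h0 (hd u) Φ
    have hu : (Finset.univ : Finset ℤˣ) = {1, -1} := rfl
    rw [hu, Finset.sum_pair (by decide)]
    simp only [eExponent, eCurrent, paraCurrent, Module.End.mul_apply, LinearMap.smul_apply,
      LinearMap.sub_apply, Pi.smul_apply, Pi.sub_apply, smul_eq_mul, key]
    simp
    ring

theorem isVertexCurrent_F (hħ : 0 < ħ) (hξ : 0 < ξ) (hk : 0 < k) :
    IsVertexCurrent ħ ξ k (vertexBound ħ ξ k) (fCurrent ħ ξ k)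
      (fun u : ℤˣ => -(((u : ℤ) : ℂ) / ħ)) (fExponent ħ ξ k)
      (insert (fun α => fieldPrime ħ ξ k 1 1 k α 0) (range (paraExponent ħ k 1))) where
  parts := by
    have hM := growthBound_le_vertexBound hħ hξ hk
    rintro _ (rfl | ⟨u, rfl⟩)
    · exact (modeFamily_fField hħ hξ hk).mono hM
    · exact (modeFamily_paraExponent hħ hξ hk _ _).mono hM
  family u := (modeFamily_fExponent hħ hξ hk u).mono (growthBound_le_vertexBound hħ hξ hk)
  apply_eq α v hv Φ := by
    have h0 := hv _ (mem_insert _ _)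
    have h1 := fun u => hv _ (mem_insert_of_mem _ (mem_range_self u))
    have key := fun u => normalExp_mul_apply (h1 u) h0
      (fun j => para_field_disjoint _ u _ _ j) Φ
    have hu : (Finset.univ : Finset ℤˣ) = {1, -1} := rfl
    rw [hu, Finset.sum_pair (by decide)]
    simp only [fExponent, fCurrent, paraCurrent, Module.End.mul_apply, LinearMap.smul_apply,
      LinearMap.sub_apply, Pi.smul_apply, Pi.sub_apply, smul_eq_mul, key]
    simp
    ring

/-- Hence the constant in `hConst` is the right one for every `α` and for both signs. -/
theorem contraction_kExponent_eq (hħ : 0 < ħ) (hξ : 0 < ξ) (hk : 0 < k) {α β α' β' : ℂ}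
    (h : α - β = α' - β') : contraction ħ ξ k (kExponent ħ ξ k α) (kExponent ħ ξ k β) =
      contraction ħ ξ k (kExponent ħ ξ k α') (kExponent ħ ξ k β') := by
  have hf := modeFamily_kExponent hħ hξ hk
  refine finitePart_congr fun t _ => ?_
  rw [contractionIntegrand_family hf hf α, contractionIntegrand_family hf hf α', h]

theorem hExponent_eq (s : ℤˣ) (α : ℂ) : hExponent ħ ξ k s α =
    kExponent ħ ξ k (α + kShift ħ ξ k s (1 : ℝ)) +
      kExponent ħ ξ k (α + kShift ħ ξ k s (-1 : ℝ)) := by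
  simp [hExponent, kShift, sub_eq_add_neg]

theorem modeFamily_hExponent (hħ : 0 < ħ) (hξ : 0 < ξ) (hk : 0 < k) (s : ℤˣ) :
    ModeFamily (vertexBound ħ ξ k) (hExponent ħ ξ k s) := by
  have h := (modeFamily_kExponent_shift hħ hξ hk s (ε := 1) (by simp)).add
    (modeFamily_kExponent_shift hħ hξ hk s (ε := -1) (by simp))
  simpa only [← hExponent_eq] using h

theorem isVertexCurrent_H (hħ : 0 < ħ) (hξ : 0 < ξ) (hk : 0 < k) (s : ℤˣ) :
    IsVertexCurrent ħ ξ k (vertexBound ħ ξ k) (hCurrent ħ ξ k s)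
      (fun _ : Unit => Complex.I / (2 * Real.pi)) (fun _ => hExponent ħ ξ k s)
      {fun α => kExponent ħ ξ k (α + kShift ħ ξ k s (1 : ℝ)),
        fun α => kExponent ħ ξ k (α + kShift ħ ξ k s (-1 : ℝ))} where
  parts := by
    rintro _ (rfl | rfl)
    · exact modeFamily_kExponent_shift hħ hξ hk s (by simp)
    · exact modeFamily_kExponent_shift hħ hξ hk s (by simp)
  family _ := modeFamily_hExponent hħ hξ hk s
  apply_eq α v hv Φ := by
    have h0 := hv _ (Or.inl rfl)
    have h1 := hv _ (Or.inr rfl)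
    beta_reduce at h0 h1
    -- The two arguments always differ by `iħ`: the inner contraction converges there, and `hConst`
    -- cancels its exponential.
    have hd : α + kShift ħ ξ k s (1 : ℝ) - (α + kShift ħ ξ k s (-1 : ℝ)) = Complex.I * ħ := by
      simp only [kShift]; push_cast; ring
    have h2 := contractible_kExponent hħ hξ hk hd
    have e := contraction_kExponent_eq hħ hξ hk (α' := Complex.I * ħ / 2)
      (β' := -(Complex.I * ħ / 2)) (hd.trans (by ring))
    have e2 : α + Complex.I * ħ / 2 * (((s : ℤ) : ℂ) * (ξ + k - k / 2) + 1) =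
        α + kShift ħ ξ k s (1 : ℝ) := by simp [kShift]
    have e3 : α + Complex.I * ħ / 2 * (((s : ℤ) : ℂ) * (ξ + k - k / 2) - 1) =
        α + kShift ħ ξ k s (-1 : ℝ) := by simp [kShift, sub_eq_add_neg]
    rw [Fintype.sum_unique, hExponent_eq, contraction_add_right h0 h1, hCurrent,
      LinearMap.smul_apply, Pi.smul_apply, Module.End.mul_apply, smul_eq_mul, e2, e3, kCurrent,
      kCurrent, normalExp_apply, normalExp_apply, contraction_add_left h1 h2, e, hConst, add_assoc]
    simp only [Complex.exp_add, Complex.exp_neg]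
    have := Complex.exp_ne_zero (contraction ħ ξ k (kExponent ħ ξ k (Complex.I * ħ / 2))
      (kExponent ħ ξ k (-(Complex.I * ħ / 2))))
    field_simp

end

end FreeField

namespace FreeField

/-! ### The exchange relations -/

/-- The reflection formula, arranged for `Re x < 0`: the continued function `1 / Γ` is expressed by
a sine and by `Γ` at `-x`, the argument in the reversed contraction. -/
theorem inv_Gamma_of_re_neg {x : ℂ} (hx : x.re < 0) :
    (Complex.Gamma x)⁻¹ = Complex.sin (Real.pi * x) * (-x * Complex.Gamma (-x)) / Real.pi := by
  have h0 : -x ≠ 0 := fun h => by rw [neg_eq_zero.1 h] at hx; simp at hx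
  have h1 := Complex.Gamma_mul_Gamma_one_sub x
  have h2 : Complex.Gamma (1 - x) = -x * Complex.Gamma (-x) := by
    rw [← Complex.Gamma_add_one _ h0]; ring_nf
  have h3 : Complex.Gamma (1 - x) ≠ 0 := Complex.Gamma_ne_zero_of_re_pos (by simp; linarith)
  rw [← h2, eq_div_of_mul_eq h3 h1, inv_div, div_div_eq_mul_div, mul_comm]

/-- Reflection about `1 / 2` turns the sine into a cosine; the half comes from the half period in
the contractions of `H` with `E` and `F`. -/
theorem inv_Gamma_half_add {x : ℂ} (hx : x.re < 0) : (Complex.Gamma (1 / 2 + x))⁻¹ =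
    Complex.cos (Real.pi * x) * Complex.Gamma (1 / 2 - x) / Real.pi := by
  have h1 := Complex.Gamma_mul_Gamma_one_sub (1 / 2 + x)
  have e : (1 : ℂ) - (1 / 2 + x) = 1 / 2 - x := by ring
  have h3 : Complex.Gamma (1 / 2 - x) ≠ 0 := Complex.Gamma_ne_zero_of_re_pos (by
    rw [Complex.sub_re, Complex.div_ofNat_re, Complex.one_re]; linarith)
  have e2 : Complex.sin (Real.pi * (1 / 2 + x)) = Complex.cos (Real.pi * x) := by
    rw [← Complex.sin_add_pi_div_two]; congr 1; ring
  rw [e, e2] at h1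
  rw [eq_div_of_mul_eq h3 h1, inv_div, div_div_eq_mul_div, mul_comm]

theorem differentiable_inv_Gamma_comp {g : ℂ → ℂ} (hg : Differentiable ℂ g) :
    Differentiable ℂ fun d => (Complex.Gamma (g d))⁻¹ :=
  Complex.differentiable_one_div_Gamma.comp hg

theorem sinh_eq_sin {ω : ℝ} {y d w : ℂ} (h : w = -(Complex.I * d)) (hy : y = d / ω) :
    Complex.sinh (Real.pi * y) = Complex.I * Complex.sin (Real.pi * (w / ω)) := by
  rw [mul_comm Complex.I, ← Complex.sinh_mul_I]
  congr 1
  rw [h, hy]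
  linear_combination (Real.pi * d / ω : ℂ) * Complex.I_sq

/-- The polynomial in the numerator of the rational factors of the contractions. -/
noncomputable def ratioNum (h : ℝ) (u v : ℤˣ) (z : ℂ) : ℂ :=
  if u = 1 then (if v = 1 then z else z + h) else if v = 1 then z - h else z

/-- Reversing a product exchanges `u`, `v` and changes the sign of `z`. As the numerators merely
change sign, one exchange factor is valid for all four terms. -/
theorem ratioNum_neg (h : ℝ) (u v : ℤˣ) (z : ℂ) : ratioNum h v u (-z) = -ratioNum h u v z := by
  unfold ratioNum; split_ifs <;> ring

theorem differentiable_ratioNum (h : ℝ) (u v : ℤˣ) : Differentiable ℂ (ratioNum h u v) := by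
  unfold ratioNum; split_ifs <;> fun_prop

/-- The four cases are brought to one denominator, since `D` may not depend on the term. -/
theorem ratioEE_eq (ħ : ℝ) (u v : ℤˣ) {z : ℂ} (hz : z - ħ ≠ 0) :
    ratioEE ħ u v z = ratioNum ħ u v z / (z - ħ) := by
  unfold ratioEE ratioNum; split_ifs <;> first | rfl | exact (div_self hz).symm

/-- `F` is treated as `E` with `-ħ` in place of `ħ`. -/
theorem ratioFF_eq (ħ : ℝ) (u v : ℤˣ) {z : ℂ} (hz : z + ħ ≠ 0) :
    ratioFF ħ u v z = ratioNum (-ħ) u v z / (z - ((-ħ : ℝ) : ℂ)) := by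
  have e : z - ((-ħ : ℝ) : ℂ) = z + ħ := by push_cast; ring
  have e' : z + ((-ħ : ℝ) : ℂ) = z - ħ := by push_cast; ring
  unfold ratioFF ratioNum
  rw [e, e']
  split_ifs <;> first | rfl | exact (div_self hz).symm

/-- The scalar form of the exchange relations of `E` (`h = ħ`) and `F` (`h = -ħ`): the continued
contraction on the left, the contraction of the reversed product on the right. The two sines come
from reflecting the two Gamma functions. -/
theorem gamma_reflect {ω h : ℝ} (hω : 0 < ω) {z : ℂ} (hz : z.re < -|h|) (r : ℂ) :
    Complex.sin (Real.pi * ((z + h) / ω)) * ((Complex.Gamma ((z - h) / ω))⁻¹ * r) =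
      Complex.sin (Real.pi * ((z - h) / ω)) * ((Complex.Gamma ((z + h) / ω))⁻¹ * (z - h)) *
        (Complex.Gamma ((-z + h) / ω) / Complex.Gamma ((-z - h) / ω) * (-r / (-z - h))) := by
  have hω' : (ω : ℂ) ≠ 0 := by exact_mod_cast hω.ne'
  have hpi : (Real.pi : ℂ) ≠ 0 := by exact_mod_cast Real.pi_ne_zero
  have h1 : z.re - h < 0 := by linarith [neg_le_abs h]
  have h2 : z.re + h < 0 := by linarith [le_abs_self h]
  have ha : ((z - h) / ω).re < 0 := by
    rw [Complex.div_ofReal_re]; exact div_neg_of_neg_of_pos (by simpa using h1) hω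
  have hb : ((z + h) / ω).re < 0 := by
    rw [Complex.div_ofReal_re]; exact div_neg_of_neg_of_pos (by simpa using h2) hω
  have ea : -((z - h) / ω) = (-z + h) / ω := by ring
  have eb : -((z + h) / ω) = (-z - h) / ω := by ring
  have g2 : Complex.Gamma ((-z - h) / ω) ≠ 0 :=
    Complex.Gamma_ne_zero_of_re_pos (by rw [← eb, Complex.neg_re]; linarith)
  have n1 : -z - h ≠ 0 := fun hh => by
    have := congrArg Complex.re hh
    simp at this
    linarith
  rw [inv_Gamma_of_re_neg ha, inv_Gamma_of_re_neg hb, ea, eb]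
  field_simp
  ring

/-- The counterpart for `H` with `E` or `F`, where the half period gives cosines and there is no
rational factor. -/
theorem gamma_reflect_half {ω h : ℝ} (hω : 0 < ω) {z : ℂ} (hz : z.re < -|h|) :
    Complex.cos (Real.pi * ((z + h) / ω)) * (Complex.Gamma ((z + ω / 2 - h) / ω))⁻¹ =
      Complex.cos (Real.pi * ((z - h) / ω)) * (Complex.Gamma ((z + ω / 2 + h) / ω))⁻¹ *
        (Complex.Gamma ((-z + ω / 2 + h) / ω) / Complex.Gamma ((-z + ω / 2 - h) / ω)) := by
  have hω' : (ω : ℂ) ≠ 0 := by exact_mod_cast hω.ne'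
  have h1 : z.re - h < 0 := by linarith [neg_le_abs h]
  have h2 : z.re + h < 0 := by linarith [le_abs_self h]
  have ha : ((z - h) / ω).re < 0 := by
    rw [Complex.div_ofReal_re]; exact div_neg_of_neg_of_pos (by simpa using h1) hω
  have hb : ((z + h) / ω).re < 0 := by
    rw [Complex.div_ofReal_re]; exact div_neg_of_neg_of_pos (by simpa using h2) hω
  have e1 : (z + ω / 2 - h) / ω = 1 / 2 + (z - h) / ω := by field_simp; ring
  have e2 : (z + ω / 2 + h) / ω = 1 / 2 + (z + h) / ω := by field_simp; ring
  have e3 : (-z + ω / 2 + h) / ω = 1 / 2 - (z - h) / ω := by field_simp; ring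
  have e4 : (-z + ω / 2 - h) / ω = 1 / 2 - (z + h) / ω := by field_simp; ring
  have g2 : Complex.Gamma (1 / 2 - (z + h) / ω) ≠ 0 :=
    Complex.Gamma_ne_zero_of_re_pos (by
      rw [Complex.sub_re, Complex.div_ofNat_re, Complex.one_re]; linarith)
  rw [e1, e2, e3, e4, inv_Gamma_half_add ha, inv_Gamma_half_add hb]
  generalize Complex.Gamma (1 / 2 - (z + h) / ω) = p at *
  generalize Complex.Gamma (1 / 2 - (z - h) / ω) = q
  generalize Complex.cos (Real.pi * ((z + h) / ω)) = p'
  generalize Complex.cos (Real.pi * ((z - h) / ω)) = q'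
  field_simp

section

variable {ħ ξ k : ℝ}

/-- The products `X(α) Y(β)` of the currents are considered for `Im (α - β)` above this number. -/
noncomputable def vertexStrip (ħ ξ k : ℝ) : ℝ := ħ * (2 + k + ξ) + 2 * vertexBound ħ ξ k

theorem contractionBound_le_vertexStrip (hħ : 0 < ħ) (hξ : 0 < ξ) (hk : 0 < k) :
    contractionBound ħ ξ k ≤ vertexStrip ħ ξ k := by
  have : 0 < ħ * (ξ + k + 1) := by positivity
  simp only [contractionBound, vertexStrip, vertexBound, growthBound]
  linarith

theorem lt_vertexStrip (hħ : 0 < ħ) (hξ : 0 < ξ) (hk : 0 < k) :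
    ħ + 2 * hShift ħ ξ k < vertexStrip ħ ξ k ∧ ħ * (k + 2) / 2 < vertexStrip ħ ξ k ∧
      0 < hShift ħ ξ k := by
  have h1 := mul_pos hħ hξ
  have h2 := mul_pos hħ hk
  simp only [vertexStrip, vertexBound, growthBound, hShift]
  refine ⟨?_, ?_, by positivity⟩ <;> nlinarith

theorem re_neg_I_mul (d : ℂ) : (-(Complex.I * d)).re = d.im := by simp

/-- As `1 / Γ` is entire, the contraction is a quotient of entire functions: the Gamma function of
its numerator and the pole `z = h` go into `D`. Neither factor of `D` vanishes for `Im d > σ`,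
because there `Re z > |h|`. -/
theorem exchange_full (hħ : 0 < ħ) (hξ : 0 < ξ) (hk : 0 < k) {X : ℂ → Op} {a : ℤˣ → ℂ}
    {f : ℤˣ → ℂ → Modes} {P : Set (ℂ → Modes)}
    (hX : IsVertexCurrent ħ ξ k (vertexBound ħ ξ k) X a f P) {ω h : ℝ} (hω : 0 < ω)
    (hh : |h| ≤ ħ) {c κ : ℂ}
    (hexp : ∀ u v : ℤˣ, ∀ α β z : ℂ, z = -(Complex.I * (α - β)) → ħ < z.re →
      Complex.exp (contraction ħ ξ k (f u α) (f v β)) =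
        c * (Complex.Gamma ((z + h) / ω) / Complex.Gamma ((z - h) / ω)) *
          (ratioNum h u v z / (z - h))) {num den : ℂ → ℂ}
    (hnum : ∀ d, num d = κ * Complex.sin (Real.pi * ((-(Complex.I * d) - h) / ω)))
    (hden : ∀ d, den d = κ * Complex.sin (Real.pi * ((-(Complex.I * d) + h) / ω))) :
    CurrentAlgebra.Exchange bras (Fock ħ ξ k : Set State) (vertexStrip ħ ξ k) X X num den := by
  obtain ⟨hs1, -, hs2⟩ := lt_vertexStrip hħ hξ hk
  have hz : Differentiable ℂ fun d : ℂ => -(Complex.I * d) := by fun_prop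
  refine hX.exchange hX hħ hξ hk (σ := vertexStrip ħ ξ k) le_rfl
    (D := fun d => (Complex.Gamma ((-(Complex.I * d) + h) / ω))⁻¹ * (-(Complex.I * d) - h))
    (fun u v d => c * ((Complex.Gamma ((-(Complex.I * d) - h) / ω))⁻¹ *
      ratioNum h u v (-(Complex.I * d)))) (fun u v => ?_) ?_ ?_ ?_ ?_
  · exact ((differentiable_inv_Gamma_comp (by fun_prop)).mul
      ((differentiable_ratioNum h u v).comp hz)).const_mul c
  · exact (differentiable_inv_Gamma_comp (by fun_prop)).mul (by fun_prop)
  · intro d hd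
    have h1 : ħ < (-(Complex.I * d)).re := by rw [re_neg_I_mul]; linarith
    refine mul_ne_zero (inv_ne_zero (Complex.Gamma_ne_zero_of_re_pos ?_)) fun h0 => ?_
    · rw [Complex.div_ofReal_re, Complex.add_re, Complex.ofReal_re]
      exact div_pos (by linarith [neg_le_abs h]) hω
    · have := congrArg Complex.re h0
      rw [Complex.sub_re, Complex.ofReal_re, Complex.zero_re] at this
      linarith [le_abs_self h]
  · intro u v α β hαβ
    rw [hexp u v α β _ rfl (by rw [re_neg_I_mul]; linarith)]
    simp only [div_eq_mul_inv, mul_inv, inv_inv]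
    ring
  · intro u v α β hαβ
    have hre : (-(Complex.I * (α - β))).re < -|h| := by
      rw [re_neg_I_mul, ← neg_sub β α, Complex.neg_im]; linarith
    have hz' : -(Complex.I * (β - α)) = - -(Complex.I * (α - β)) := by ring
    rw [hexp v u β α _ rfl (by rw [re_neg_I_mul]; linarith), hz',
      ratioNum_neg h u v (-(Complex.I * (α - β))), hnum, hden]
    linear_combination (κ * c) * gamma_reflect hω hre (ratioNum h u v (-(Complex.I * (α - β))))

/-- The displacement `m` of `H^±` enters `z` with opposite signs in the two orders, so that reversal
is again `z ↦ -z`. -/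
theorem exchange_half (hħ : 0 < ħ) (hξ : 0 < ξ) (hk : 0 < k) {X Y : ℂ → Op} {a : Unit → ℂ}
    {f : ℂ → Modes} {P : Set (ℂ → Modes)} {b : ℤˣ → ℂ} {g : ℤˣ → ℂ → Modes} {Q : Set (ℂ → Modes)}
    (hX : IsVertexCurrent ħ ξ k (vertexBound ħ ξ k) X a (fun _ => f) P)
    (hY : IsVertexCurrent ħ ξ k (vertexBound ħ ξ k) Y b g Q) {ω h m : ℝ} (hω : 0 < ω)
    (hh : |h| ≤ ħ) (hm : |m| ≤ hShift ħ ξ k) {c κ : ℂ}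
    (hexp : ∀ u : ℤˣ, ∀ α β z : ℂ, z = -(Complex.I * (α - β)) + m → ħ < z.re →
      Complex.exp (contraction ħ ξ k (f α) (g u β)) =
        c * (Complex.Gamma ((z + ω / 2 + h) / ω) / Complex.Gamma ((z + ω / 2 - h) / ω)))
    (hexp' : ∀ u : ℤˣ, ∀ α β z : ℂ, z = -(Complex.I * (β - α)) - m → ħ < z.re →
      Complex.exp (contraction ħ ξ k (g u β) (f α)) =
        c * (Complex.Gamma ((z + ω / 2 + h) / ω) / Complex.Gamma ((z + ω / 2 - h) / ω)))
    {num den : ℂ → ℂ}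
    (hnum : ∀ d, num d = κ * Complex.cos (Real.pi * ((-(Complex.I * d) + m - h) / ω)))
    (hden : ∀ d, den d = κ * Complex.cos (Real.pi * ((-(Complex.I * d) + m + h) / ω))) :
    CurrentAlgebra.Exchange bras (Fock ħ ξ k : Set State) (vertexStrip ħ ξ k) X Y num den := by
  obtain ⟨hs1, -, hs2⟩ := lt_vertexStrip hħ hξ hk
  refine hX.exchange hY hħ hξ hk (σ := vertexStrip ħ ξ k) le_rfl
    (D := fun d => (Complex.Gamma ((-(Complex.I * d) + m + ω / 2 + h) / ω))⁻¹)
    (fun _ u d => c * (Complex.Gamma ((-(Complex.I * d) + m + ω / 2 - h) / ω))⁻¹)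
    (fun u v => ?_) ?_ ?_ ?_ ?_
  · exact (differentiable_inv_Gamma_comp (by fun_prop)).const_mul c
  · exact differentiable_inv_Gamma_comp (by fun_prop)
  · intro d hd
    refine inv_ne_zero (Complex.Gamma_ne_zero_of_re_pos ?_)
    have e : (ω : ℂ) / 2 = ((ω / 2 : ℝ) : ℂ) := by push_cast; rfl
    rw [Complex.div_ofReal_re, e, Complex.add_re, Complex.add_re, Complex.add_re, Complex.ofReal_re,
      Complex.ofReal_re, Complex.ofReal_re, re_neg_I_mul]
    exact div_pos (by linarith [neg_le_abs h, neg_le_abs m]) hω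
  · intro _ u α β hαβ
    rw [hexp u α β _ rfl (by
      rw [Complex.add_re, re_neg_I_mul, Complex.ofReal_re]; linarith [neg_le_abs m])]
    simp only [div_eq_mul_inv, inv_inv]
    ring
  · intro _ u α β hαβ
    have hre : (-(Complex.I * (α - β)) + m).re < -|h| := by
      rw [Complex.add_re, re_neg_I_mul, ← neg_sub β α, Complex.neg_im, Complex.ofReal_re]
      linarith [le_abs_self m]
    have hz' : -(Complex.I * (β - α)) - m = -(-(Complex.I * (α - β)) + m) := by ring
    rw [hexp' u α β _ rfl (by
      rw [Complex.sub_re, re_neg_I_mul, Complex.ofReal_re]; linarith [le_abs_self m]), hz', hnum,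
      hden]
    linear_combination (κ * c) * gamma_reflect_half hω hre

/-- The pattern of `exchange_full` with a Gamma quotient for each period and no rational factor. The
relative displacement `m` is `0` for equal signs and `±2 hShift` otherwise. -/
theorem exchange_HH (hħ : 0 < ħ) (hξ : 0 < ξ) (hk : 0 < k) (s s' : ℤˣ) {num den : ℂ → ℂ} {m : ℝ}
    (hm : m = ((s : ℤ) - (s' : ℤ)) * hShift ħ ξ k) {κ : ℂ}
    (hnum : ∀ d, num d = κ *
      (Complex.sin (Real.pi * ((-(Complex.I * d) + m - ħ) / (ħ * ξ : ℝ))) *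
        Complex.sin (Real.pi * ((-(Complex.I * d) + m + ħ) / (ħ * (ξ + k) : ℝ)))))
    (hden : ∀ d, den d = κ *
      (Complex.sin (Real.pi * ((-(Complex.I * d) + m + ħ) / (ħ * ξ : ℝ))) *
        Complex.sin (Real.pi * ((-(Complex.I * d) + m - ħ) / (ħ * (ξ + k) : ℝ))))) :
    CurrentAlgebra.Exchange bras (Fock ħ ξ k : Set State) (vertexStrip ħ ξ k)
      (hCurrent ħ ξ k s) (hCurrent ħ ξ k s') num den := by
  obtain ⟨hs1, -, hs2⟩ := lt_vertexStrip hħ hξ hk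
  have hω : 0 < ħ * ξ := mul_pos hħ hξ
  have hω' : 0 < ħ * (ξ + k) := mul_pos hħ (add_pos hξ hk)
  have hmabs : |m| ≤ 2 * hShift ħ ξ k := by
    rw [hm, abs_mul, abs_of_pos hs2]
    refine mul_le_mul_of_nonneg_right ?_ hs2.le
    rcases units_int_cases s with rfl | rfl <;> rcases units_int_cases s' with rfl | rfl <;>
      norm_num
  have hmc : (m : ℂ) = (((s : ℤ) : ℂ) - ((s' : ℤ) : ℂ)) * hShift ħ ξ k := by
    rw [hm]; push_cast; rfl
  generalize hω1 : ħ * ξ = ω at *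
  generalize hω2 : ħ * (ξ + k) = ω' at *
  set c : ℂ := (Complex.exp (2 * ħ / ω * expIntegralConst ω))⁻¹ *
    Complex.exp (2 * ħ / ω' * expIntegralConst ω') with hc
  refine (isVertexCurrent_H hħ hξ hk s).exchange (isVertexCurrent_H hħ hξ hk s') hħ hξ hk (σ := vertexStrip ħ ξ k) le_rfl
    (D := fun d => (Complex.Gamma ((-(Complex.I * d) + m + ħ) / ω))⁻¹ *
      (Complex.Gamma ((-(Complex.I * d) + m - ħ) / ω'))⁻¹)
    (fun _ _ d => c * ((Complex.Gamma ((-(Complex.I * d) + m - ħ) / ω))⁻¹ *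
      (Complex.Gamma ((-(Complex.I * d) + m + ħ) / ω'))⁻¹))
    (fun _ _ => ?_) ?_ ?_ ?_ ?_
  · exact ((differentiable_inv_Gamma_comp (by fun_prop)).mul
      (differentiable_inv_Gamma_comp (by fun_prop))).const_mul c
  · exact (differentiable_inv_Gamma_comp (by fun_prop)).mul
      (differentiable_inv_Gamma_comp (by fun_prop))
  · intro d hd
    refine mul_ne_zero (inv_ne_zero (Complex.Gamma_ne_zero_of_re_pos ?_))
      (inv_ne_zero (Complex.Gamma_ne_zero_of_re_pos ?_)) <;>
    simp only [Complex.div_ofReal_re, Complex.add_re, Complex.sub_re, Complex.ofReal_re,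
      re_neg_I_mul]
    · exact div_pos (by linarith [neg_le_abs m]) hω
    · exact div_pos (by linarith [neg_le_abs m]) hω'
  · intro _ _ α β hαβ
    have h := (hasExp_HH hħ hξ hk s s' (α := α) (β := β)
      (z := -(Complex.I * (α - β)) + m) (by rw [hmc]) (by
        rw [Complex.add_re, re_neg_I_mul, Complex.ofReal_re]; linarith [neg_le_abs m])).2
    rw [contraction, h, hω1, hω2, gammaRatio, gammaRatio, hc]
    simp only [div_eq_mul_inv, mul_inv, inv_inv]
    ring
  · intro _ _ α β hαβ
    set z : ℂ := -(Complex.I * (α - β)) + m with hz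
    have hzre : z.re < -ħ := by
      rw [hz, Complex.add_re, re_neg_I_mul, ← neg_sub β α, Complex.neg_im, Complex.ofReal_re]
      linarith [le_abs_self m]
    have h := (hasExp_HH hħ hξ hk s' s (α := β) (β := α) (z := -z) (by
      rw [hz, hmc]; ring) (by rw [Complex.neg_re]; linarith)).2
    have ha : ∀ w : ℝ, 0 < w → ((z - ħ) / w).re < 0 := fun w hw => by
      rw [Complex.div_ofReal_re]
      exact div_neg_of_neg_of_pos (by rw [Complex.sub_re, Complex.ofReal_re]; linarith) hw
    have hb : ∀ w : ℝ, 0 < w → ((z + ħ) / w).re < 0 := fun w hw => by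
      rw [Complex.div_ofReal_re]
      exact div_neg_of_neg_of_pos (by rw [Complex.add_re, Complex.ofReal_re]; linarith) hw
    have ea : ∀ w : ℝ, -((z - ħ) / w) = (-z + ħ) / w := fun w => by ring
    have eb : ∀ w : ℝ, -((z + ħ) / w) = (-z - ħ) / w := fun w => by ring
    have ga : ∀ w : ℝ, 0 < w → Complex.Gamma ((-z + ħ) / w) ≠ 0 := fun w hw =>
      Complex.Gamma_ne_zero_of_re_pos (by rw [← ea, Complex.neg_re]; linarith [ha w hw])
    have gb : ∀ w : ℝ, 0 < w → Complex.Gamma ((-z - ħ) / w) ≠ 0 := fun w hw =>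
      Complex.Gamma_ne_zero_of_re_pos (by rw [← eb, Complex.neg_re]; linarith [hb w hw])
    have ga1 := ga ω hω
    have ga2 := ga ω' hω'
    have gb1 := gb ω hω
    have gb2 := gb ω' hω'
    have hw1 : (ω : ℂ) ≠ 0 := by exact_mod_cast hω.ne'
    have hw2 : (ω' : ℂ) ≠ 0 := by exact_mod_cast hω'.ne'
    have hpi : (Real.pi : ℂ) ≠ 0 := by exact_mod_cast Real.pi_ne_zero
    have hx1 := Complex.exp_ne_zero (2 * ħ / ω * expIntegralConst ω)
    rw [contraction, h, hω1, hω2, gammaRatio, gammaRatio, hc, hnum, hden,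
      inv_Gamma_of_re_neg (ha ω hω), inv_Gamma_of_re_neg (ha ω' hω'),
      inv_Gamma_of_re_neg (hb ω hω), inv_Gamma_of_re_neg (hb ω' hω')]
    simp only [ea, eb]
    rw [← hz]
    field_simp

end

end FreeField

/-! ### The exchange relations of the individual currents -/

namespace FreeField

section

variable {ħ ξ k : ℝ}

theorem sub_ne_zero_of_lt_re {z : ℂ} {c : ℝ} (h : c < z.re) : z - c ≠ 0 := fun h0 => by
  have := congrArg Complex.re h0
  rw [Complex.sub_re, Complex.ofReal_re, Complex.zero_re] at this
  linarith

theorem ofReal_eq_inv {η ω : ℝ} (h : 1 / η = ω) : (η : ℂ) = 1 / (ω : ℂ) := by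
  rw [← h]; push_cast; rw [one_div_one_div]

theorem sinh_pi_eq {η ω : ℝ} (h : 1 / η = ω) {x w : ℂ} (hw : w = -(Complex.I * x)) :
    Complex.sinh (Real.pi * η * x) = Complex.I * Complex.sin (Real.pi * (w / ω)) := by
  rw [mul_assoc]
  refine sinh_eq_sin hw ?_
  rw [ofReal_eq_inv h]
  ring

theorem exchange_EE (hħ : 0 < ħ) (hξ : 0 < ξ) (hk : 0 < k) {η : ℝ} (hη : 1 / η = ħ * ξ) :
    CurrentAlgebra.Exchange bras (Fock ħ ξ k : Set State) (vertexStrip ħ ξ k)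
      (eCurrent ħ ξ k) (eCurrent ħ ξ k)
      (fun d => Complex.sinh (Real.pi * η * (d - Complex.I * ħ)))
      (fun d => Complex.sinh (Real.pi * η * (d + Complex.I * ħ))) := by
  refine exchange_full hħ hξ hk (isVertexCurrent_E hħ hξ hk) (mul_pos hħ hξ) (abs_of_pos hħ).le
    (c := (Complex.exp (2 * ħ / (ħ * ξ : ℝ) * expIntegralConst (ħ * ξ)))⁻¹) (κ := Complex.I)
    ?_ (fun d => sinh_pi_eq hη ?_) (fun d => sinh_pi_eq hη ?_)
  · intro u v α β z hz hre
    rw [contraction, (hasExp_EE hħ hξ hk u v hz hre).2, ratioEE_eq _ _ _ (sub_ne_zero_of_lt_re hre),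
      gammaRatio, mul_inv, inv_div]
  · linear_combination -ħ * Complex.I_sq
  · linear_combination ħ * Complex.I_sq

theorem exchange_FF (hħ : 0 < ħ) (hξ : 0 < ξ) (hk : 0 < k) {η' : ℝ} (hη' : 1 / η' = ħ * (ξ + k)) :
    CurrentAlgebra.Exchange bras (Fock ħ ξ k : Set State) (vertexStrip ħ ξ k)
      (fCurrent ħ ξ k) (fCurrent ħ ξ k)
      (fun d => Complex.sinh (Real.pi * η' * (d + Complex.I * ħ)))
      (fun d => Complex.sinh (Real.pi * η' * (d - Complex.I * ħ))) := by
  refine exchange_full hħ hξ hk (isVertexCurrent_F hħ hξ hk) (mul_pos hħ (add_pos hξ hk)) (h := -ħ)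
    (by rw [abs_neg, abs_of_pos hħ])
    (c := Complex.exp (2 * ħ / (ħ * (ξ + k) : ℝ) * expIntegralConst (ħ * (ξ + k))))
    (κ := Complex.I) ?_ (fun d => sinh_pi_eq hη' ?_) (fun d => sinh_pi_eq hη' ?_)
  · intro u v α β z hz hre
    have h0 : z + ħ ≠ 0 := by
      have := sub_ne_zero_of_lt_re (z := z) (c := -ħ) (by linarith)
      rwa [Complex.ofReal_neg, sub_neg_eq_add] at this
    rw [contraction, (hasExp_FF hħ hξ hk u v hz hre).2, ratioFF_eq _ _ _ h0, gammaRatio,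
      Complex.ofReal_neg, sub_neg_eq_add, ← sub_eq_add_neg]
  · push_cast; linear_combination ħ * Complex.I_sq
  · push_cast; linear_combination -ħ * Complex.I_sq

theorem abs_sign_mul_le (s : ℤˣ) {x y : ℝ} (hx : 0 ≤ x) (h : x ≤ y) : |((s : ℤ) : ℝ) * x| ≤ y := by
  have hs : |((s : ℤ) : ℝ)| = 1 := by rcases units_int_cases s with rfl | rfl <;> simp
  rwa [abs_mul, hs, one_mul, abs_of_nonneg hx]

theorem cos_add_half_sign (s : ℤˣ) (x : ℂ) : Complex.cos (Real.pi * (x + ((s : ℤ) : ℂ) / 2)) =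
    -((s : ℤ) : ℂ) * Complex.sin (Real.pi * x) := by
  rcases units_int_cases s with rfl | rfl
  · have : (Real.pi : ℂ) * (x + (((1 : ℤˣ) : ℤ) : ℂ) / 2) = Real.pi * x + Real.pi / 2 := by
      rw [Units.val_one, Int.cast_one]; ring
    rw [this, Complex.cos_add_pi_div_two, Units.val_one, Int.cast_one, neg_mul, one_mul]
  · have : (Real.pi : ℂ) * (x + (((-1 : ℤˣ) : ℤ) : ℂ) / 2) = Real.pi * x - Real.pi / 2 := by
      rw [Units.val_neg, Units.val_one, Int.cast_neg, Int.cast_one]; ring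
    rw [this, Complex.cos_sub_pi_div_two, Units.val_neg, Units.val_one, Int.cast_neg, Int.cast_one,
      neg_neg, one_mul]

theorem sign_mul_self (s : ℤˣ) : ((s : ℤ) : ℂ) * ((s : ℤ) : ℂ) = 1 := by
  rcases units_int_cases s with rfl | rfl <;> simp

/-- The displacement `s hShift` of `H^s` is half a period, `s ω / 2`, up to `±s ħk / 4`. The half
period turns the cosine of the contraction into a sine; the remainder is the `c / 4` of the
relations. -/
theorem sinh_eq_cos {η ω : ℝ} (hω : 0 < ω) (h : 1 / η = ω) (s : ℤˣ) {x w : ℂ}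
    (hw : w = -(Complex.I * x) + ((s : ℤ) : ℂ) * (ω / 2)) : Complex.sinh (Real.pi * η * x) =
      (-(Complex.I * ((s : ℤ) : ℂ))) * Complex.cos (Real.pi * (w / ω)) := by
  have hω' : (ω : ℂ) ≠ 0 := by exact_mod_cast hω.ne'
  have e : w / ω = -(Complex.I * x) / ω + ((s : ℤ) : ℂ) / 2 := by rw [hw]; field_simp
  rw [sinh_pi_eq h rfl, e, cos_add_half_sign]
  linear_combination -(Complex.I * Complex.sin (Real.pi * (-(Complex.I * x) / ω))) * sign_mul_self s

theorem exchange_HE (hħ : 0 < ħ) (hξ : 0 < ξ) (hk : 0 < k) {η : ℝ} (hη : 1 / η = ħ * ξ) (s : ℤˣ) :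
    CurrentAlgebra.Exchange bras (Fock ħ ξ k : Set State) (vertexStrip ħ ξ k)
      (hCurrent ħ ξ k s) (eCurrent ħ ξ k)
      (fun d => Complex.sinh (Real.pi * η * (d - Complex.I * ħ * (1 - ((s : ℤ) : ℂ) * k / 4))))
      (fun d => Complex.sinh (Real.pi * η * (d + Complex.I * ħ * (1 + ((s : ℤ) : ℂ) * k / 4)))) := by
  obtain ⟨-, -, hs⟩ := lt_vertexStrip hħ hξ hk
  refine exchange_half hħ hξ hk (isVertexCurrent_H hħ hξ hk s) (isVertexCurrent_E hħ hξ hk)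
    (mul_pos hħ hξ) (abs_of_pos hħ).le (abs_sign_mul_le s hs.le le_rfl)
    (c := (Complex.exp (2 * ħ / (ħ * ξ : ℝ) * expIntegralConst (ħ * ξ)))⁻¹)
    (κ := -(Complex.I * ((s : ℤ) : ℂ))) ?_ ?_
    (fun d => sinh_eq_cos (mul_pos hħ hξ) hη s ?_) (fun d => sinh_eq_cos (mul_pos hħ hξ) hη s ?_)
  · intro u α β z hz hre
    rw [contraction, (hasExp_HE hħ hξ hk s u (by rw [hz]; push_cast; rfl) hre).2, gammaRatio,
      mul_inv, inv_div]
  · intro u α β z hz hre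
    rw [contraction, (hasExp_EH hħ hξ hk s u (by rw [hz]; push_cast; rfl) hre).2, gammaRatio,
      mul_inv, inv_div]
  · simp only [hShift]; push_cast
    linear_combination -(ħ * (1 - ((s : ℤ) : ℂ) * k / 4)) * Complex.I_sq
  · simp only [hShift]; push_cast
    linear_combination (ħ * (1 + ((s : ℤ) : ℂ) * k / 4)) * Complex.I_sq

theorem exchange_HF (hħ : 0 < ħ) (hξ : 0 < ξ) (hk : 0 < k) {η' : ℝ} (hη' : 1 / η' = ħ * (ξ + k))
    (s : ℤˣ) : CurrentAlgebra.Exchange bras (Fock ħ ξ k : Set State) (vertexStrip ħ ξ k)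
      (hCurrent ħ ξ k s) (fCurrent ħ ξ k)
      (fun d => Complex.sinh (Real.pi * η' * (d + Complex.I * ħ * (1 - ((s : ℤ) : ℂ) * k / 4))))
      (fun d => Complex.sinh (Real.pi * η' * (d - Complex.I * ħ * (1 + ((s : ℤ) : ℂ) * k / 4)))) := by
  obtain ⟨-, -, hs⟩ := lt_vertexStrip hħ hξ hk
  have hω := mul_pos hħ (add_pos hξ hk)
  refine exchange_half hħ hξ hk (isVertexCurrent_H hħ hξ hk s) (isVertexCurrent_F hħ hξ hk)
    hω (h := -ħ) (by rw [abs_neg, abs_of_pos hħ]) (abs_sign_mul_le s hs.le le_rfl)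
    (c := Complex.exp (2 * ħ / (ħ * (ξ + k) : ℝ) * expIntegralConst (ħ * (ξ + k))))
    (κ := -(Complex.I * ((s : ℤ) : ℂ))) ?_ ?_
    (fun d => sinh_eq_cos hω hη' s ?_) (fun d => sinh_eq_cos hω hη' s ?_)
  · intro u α β z hz hre
    rw [contraction, (hasExp_HF hħ hξ hk s u (by rw [hz]; push_cast; rfl) hre).2, gammaRatio,
      Complex.ofReal_neg, sub_neg_eq_add, ← sub_eq_add_neg]
  · intro u α β z hz hre
    rw [contraction, (hasExp_FH hħ hξ hk s u (by rw [hz]; push_cast; rfl) hre).2, gammaRatio,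
      Complex.ofReal_neg, sub_neg_eq_add, ← sub_eq_add_neg]
  · simp only [hShift]; push_cast
    linear_combination (ħ * (1 - ((s : ℤ) : ℂ) * k / 4)) * Complex.I_sq
  · simp only [hShift]; push_cast
    linear_combination -(ħ * (1 + ((s : ℤ) : ℂ) * k / 4)) * Complex.I_sq

theorem exchange_H_same (hħ : 0 < ħ) (hξ : 0 < ξ) (hk : 0 < k) {η η' : ℝ} (hη : 1 / η = ħ * ξ)
    (hη' : 1 / η' = ħ * (ξ + k)) (s : ℤˣ) :
    CurrentAlgebra.Exchange bras (Fock ħ ξ k : Set State) (vertexStrip ħ ξ k)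
      (hCurrent ħ ξ k s) (hCurrent ħ ξ k s)
      (fun d => Complex.sinh (Real.pi * η * (d - Complex.I * ħ)) *
        Complex.sinh (Real.pi * η' * (d + Complex.I * ħ)))
      (fun d => Complex.sinh (Real.pi * η * (d + Complex.I * ħ)) *
        Complex.sinh (Real.pi * η' * (d - Complex.I * ħ))) := by
  have h1 : ∀ d : ℂ, -(Complex.I * d) + (0 : ℝ) - ħ = -(Complex.I * (d - Complex.I * ħ)) := by
    intro d; push_cast; linear_combination -ħ * Complex.I_sq
  have h2 : ∀ d : ℂ, -(Complex.I * d) + (0 : ℝ) + ħ = -(Complex.I * (d + Complex.I * ħ)) := by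
    intro d; push_cast; linear_combination ħ * Complex.I_sq
  refine exchange_HH hħ hξ hk s s (m := 0) (by simp) (κ := Complex.I * Complex.I)
    (fun d => ?_) (fun d => ?_)
  · rw [sinh_pi_eq hη (h1 d), sinh_pi_eq hη' (h2 d)]; ring
  · rw [sinh_pi_eq hη (h2 d), sinh_pi_eq hη' (h1 d)]; ring

/-- Between `H^+` and `H^-` the displacement `2 hShift` is a full period up to `±ħk / 2`, the `c /
2` of the relation. The two signs arising from the two periods cancel in the product. -/
theorem sinh_eq_neg_sin {η ω : ℝ} (hω : 0 < ω) (h : 1 / η = ω) {x w : ℂ}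
    (hw : w = -(Complex.I * x) + ω) : Complex.sinh (Real.pi * η * x) =
      -(Complex.I * Complex.sin (Real.pi * (w / ω))) := by
  have hω' : (ω : ℂ) ≠ 0 := by exact_mod_cast hω.ne'
  have e : Real.pi * (w / ω) = Real.pi * (-(Complex.I * x) / ω) + Real.pi := by
    rw [hw]; field_simp
  rw [sinh_pi_eq h rfl, e, Complex.sin_add_pi]
  ring

theorem exchange_H_pos_neg (hħ : 0 < ħ) (hξ : 0 < ξ) (hk : 0 < k) {η η' : ℝ} (hη : 1 / η = ħ * ξ)
    (hη' : 1 / η' = ħ * (ξ + k)) :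
    CurrentAlgebra.Exchange bras (Fock ħ ξ k : Set State) (vertexStrip ħ ξ k)
      (hCurrent ħ ξ k 1) (hCurrent ħ ξ k (-1))
      (fun d => Complex.sinh (Real.pi * η * (d - Complex.I * ħ * (1 - k / 2))) *
        Complex.sinh (Real.pi * η' * (d + Complex.I * ħ * (1 - k / 2))))
      (fun d => Complex.sinh (Real.pi * η * (d + Complex.I * ħ * (1 + k / 2))) *
        Complex.sinh (Real.pi * η' * (d - Complex.I * ħ * (1 + k / 2)))) := by
  have hω := mul_pos hħ hξ
  have hω' := mul_pos hħ (add_pos hξ hk)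
  refine exchange_HH hħ hξ hk 1 (-1) (m := 2 * hShift ħ ξ k) (by norm_num)
    (κ := Complex.I * Complex.I) (fun d => ?_) (fun d => ?_)
  · rw [sinh_eq_neg_sin hω hη
        (w := -(Complex.I * d) + ((2 * hShift ħ ξ k : ℝ) : ℂ) - ħ) (by
          simp only [hShift]; push_cast; linear_combination -(ħ * (1 - k / 2)) * Complex.I_sq),
      sinh_eq_neg_sin hω' hη'
        (w := -(Complex.I * d) + ((2 * hShift ħ ξ k : ℝ) : ℂ) + ħ) (by
          simp only [hShift]; push_cast; linear_combination (ħ * (1 - k / 2)) * Complex.I_sq)]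
    ring
  · rw [sinh_eq_neg_sin hω hη
        (w := -(Complex.I * d) + ((2 * hShift ħ ξ k : ℝ) : ℂ) + ħ) (by
          simp only [hShift]; push_cast; linear_combination (ħ * (1 + k / 2)) * Complex.I_sq),
      sinh_eq_neg_sin hω' hη'
        (w := -(Complex.I * d) + ((2 * hShift ħ ξ k : ℝ) : ℂ) - ħ) (by
          simp only [hShift]; push_cast; linear_combination -(ħ * (1 + k / 2)) * Complex.I_sq)]
    ring

end

end FreeField

namespace FreeField

/-! ### The commutation relation of `E` and `F` -/

section

set_option linter.unusedSimpArgs false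

variable {ħ ξ k : ℝ}

theorem halfFieldCoeff_shift (hħ : 0 < ħ) (s : ℤˣ) (α : ℂ) (C t : ℝ) :
    halfFieldCoeff ħ s 1 2 α C t = Complex.exp (Complex.I * α * t) * halfFieldCoeff ħ s 1 2 0 C t :=
  (coeffFamily_halfFieldCoeff hħ s two_pos).shift α t

theorem exp_shift_pos (α : ℂ) (t : ℝ) : Complex.exp (Complex.I * (α - Complex.I * ħ * k / 2) * t) =
    Complex.exp (Complex.I * α * t) * expY ħ k t ^ 2 := by
  rw [expY_sq, ← Complex.exp_add]
  congr 1
  linear_combination -(ħ * k / 2 * t : ℂ) * Complex.I_sq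

theorem exp_shift_neg (α : ℂ) (t : ℝ) :
    Complex.exp (Complex.I * (α - Complex.I * ħ * k / 2) * (-t : ℝ)) =
      Complex.exp (-(Complex.I * α * t)) * (expY ħ k t ^ 2)⁻¹ := by
  rw [expY_sq, ← Complex.exp_neg, ← Complex.exp_add]
  congr 1
  push_cast
  linear_combination (ħ * k / 2 * t : ℂ) * Complex.I_sq

theorem exp_h_pos (s : ℤˣ) (α : ℂ) (t : ℝ) : Complex.exp (Complex.I * (α - Complex.I * ħ * k / 4) * t -
      ((s : ℤ) : ℂ) * hShift ħ ξ k * t) =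
    Complex.exp (Complex.I * α * t) * expY ħ k t *
      (if s = 1 then (expG ħ ξ t * expY ħ k t)⁻¹ else expG ħ ξ t * expY ħ k t) := by
  rcases units_int_cases s with rfl | rfl
  · rw [if_pos rfl, expG, expY, ← Complex.exp_add, ← Complex.exp_add, ← Complex.exp_neg,
      ← Complex.exp_add]
    congr 1
    simp only [hShift]
    push_cast
    linear_combination -(ħ * k / 4 * t : ℂ) * Complex.I_sq
  · rw [if_neg (by decide), expG, expY, ← Complex.exp_add, ← Complex.exp_add, ← Complex.exp_add]
    congr 1
    simp only [hShift, Units.val_neg]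
    push_cast
    linear_combination -(ħ * k / 4 * t : ℂ) * Complex.I_sq

theorem exp_h_neg (s : ℤˣ) (α : ℂ) (t : ℝ) :
    Complex.exp (-(Complex.I * (α - Complex.I * ħ * k / 4) * t) +
      ((s : ℤ) : ℂ) * hShift ħ ξ k * t) =
    Complex.exp (-(Complex.I * α * t)) * (expY ħ k t)⁻¹ *
      (if s = 1 then expG ħ ξ t * expY ħ k t else (expG ħ ξ t * expY ħ k t)⁻¹) := by
  have e : -(Complex.I * (α - Complex.I * ħ * k / 4) * t) + ((s : ℤ) : ℂ) * hShift ħ ξ k * t =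
    -(Complex.I * (α - Complex.I * ħ * k / 4) * t - ((s : ℤ) : ℂ) * hShift ħ ξ k * t) := by ring
  rw [e, Complex.exp_neg, exp_h_pos, Complex.exp_neg]
  split_ifs <;> simp only [mul_inv, inv_inv]

/-- At `t = 0` the coefficients vanish by convention (division by zero, strict cutoff). States are
functions of modes defined on all of `ℝ`, so equality of exponents has to include this point. -/
theorem eExponent_apply_origin (u : ℤˣ) (α : ℂ) (j : Fin 3) : eExponent ħ k u α j 0 = 0 := by
  fin_cases j <;> simp [eExponent_apply_zero, eExponent_apply_one, eExponent_apply_two,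
    para_one, para_two, fieldCoeff, halfFieldCoeff]

theorem fExponent_apply_origin (u : ℤˣ) (α : ℂ) (j : Fin 3) : fExponent ħ ξ k u α j 0 = 0 := by
  fin_cases j <;> simp [fExponent_apply_zero, fExponent_apply_one, fExponent_apply_two,
    para_one, para_two, fieldCoeff, halfFieldCoeff]

theorem hExponent_apply_origin (s : ℤˣ) (α : ℂ) (j : Fin 3) : hExponent ħ ξ k s α j 0 = 0 := by
  fin_cases j <;> simp [hExponent, kExponent, field, fieldCoeff]

theorem modes_ext {f g : Modes} (h0 : ∀ j, f j 0 = g j 0) (h1 : ∀ j t, 0 < t → f j t = g j t)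
    (h2 : ∀ j t, 0 < t → f j (-t) = g j (-t)) : f = g := by
  funext j t
  rcases lt_trichotomy t 0 with h | rfl | h
  · simpa using h2 j (-t) (by linarith)
  · exact h0 j
  · exact h1 j t h

theorem fin_three_cases {p : Fin 3 → Prop} (h0 : p 0) (h1 : p 1) (h2 : p 2) (j : Fin 3) : p j := by
  fin_cases j <;> assumption

/-- On the pole `α - β = iħk/2` of the term with both signs `1` the bosons `a_1`, `a_2` of `E` and
`F` cancel, and the `a_0` parts add up. This identifies the residue. -/
theorem eExponent_add_fExponent_one (hħ : 0 < ħ) (hξ : 0 < ξ) (hk : 0 < k) (α : ℂ) :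
    eExponent ħ k 1 α + fExponent ħ ξ k 1 (α - Complex.I * ħ * k / 2) =
      hExponent ħ ξ k 1 (α - Complex.I * ħ * k / 4) := by
  refine modes_ext (fun j => ?_) (fun j t ht => ?_) (fun j t ht => ?_)
  · simp [eExponent_apply_origin, fExponent_apply_origin, hExponent_apply_origin]
  all_goals
    have h1 := expX_ne_zero ħ t
    have h2 := expY_ne_zero ħ k t
    have h3 := expG_ne_zero ħ ξ t
    have h4 := expX_sq_add_one_ne_zero ħ t
    have h5 := expY_sub_ne_zero hħ hk ht
    have h6 := expG_sub_ne_zero hħ hξ ht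
    have h7 := expGY_sub_ne_zero hħ hξ hk ht
    have h7' : expY ħ k t ^ 4 * expG ħ ξ t ^ 2 - 1 ≠ 0 := by rwa [mul_comm]
    have s1 := fun D x => fieldCoeff_shift hħ hk α D x
    have s2 := fun D x => fieldCoeff_shift hħ hk (α - Complex.I * ħ * k / 2) D x
    have s3 := fun D x => halfFieldCoeff_shift hħ 1 α D x
    have s4 := fun D x => halfFieldCoeff_shift hħ 1 (α - Complex.I * ħ * k / 2) D x
    have n1 : ∀ β : ℂ, Complex.I * β * ((-t : ℝ) : ℂ) = -(Complex.I * β * t) := fun β => by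
      push_cast; ring
    refine fin_three_cases (p := fun j => (_ : Modes) j _ = (_ : Modes) j _) ?_ ?_ ?_ j
  all_goals
    simp only [Pi.add_apply, eExponent_apply_zero, eExponent_apply_one,
      eExponent_apply_two, fExponent_apply_zero, fExponent_apply_one, fExponent_apply_two,
      para_one, para_two, s1, s2, s3, s4, exp_shift_pos α t, exp_shift_neg α t]
    first
      | rw [hExponent_pos hħ 1 _ ht, exp_h_pos, if_pos rfl]
      | rw [hExponent_neg hħ 1 _ ht, exp_h_neg, if_pos rfl]
      | rw [hExponent_apply_of_ne _ _ (show (1 : Fin 3) ≠ 0 by decide)]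
      | rw [hExponent_apply_of_ne _ _ (show (2 : Fin 3) ≠ 0 by decide)]
    simp only [fieldCoeff_neg, fieldCoeff_eq hħ _ ht, primeRatio_neg, primeRatio_eq,
      halfFieldCoeff_pos hħ _ ht, halfFieldCoeff_pos_neg _ ht, halfFieldCoeff_neg _ ht,
      halfFieldCoeff_neg_neg hħ _ ht, Units.val_neg, Units.val_one, Int.cast_neg, Int.cast_one,
      neg_mul, one_mul, neg_neg, neg_div, exp_quarter_k ħ k, exp_quarter_neg_k ħ k,
      exp_quarter_k2 ħ k, exp_quarter_neg_k2 ħ k, mul_zero, zero_mul, sub_zero, add_zero, zero_add,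
      neg_zero, mul_neg, mul_one, Complex.ofReal_zero, zero_div, Complex.exp_zero, n1]
    try
      generalize Complex.exp (Complex.I * α * t) = A
      generalize Complex.exp (-(Complex.I * α * t)) = B
      field_simp
      try ring

/-- The same on the pole at `-iħk/2` of the term with both signs `-1`; here `α` stands for the
argument of `F`. -/
theorem eExponent_add_fExponent_neg_one (hħ : 0 < ħ) (hξ : 0 < ξ) (hk : 0 < k) (α : ℂ) :
    eExponent ħ k (-1) (α - Complex.I * ħ * k / 2) + fExponent ħ ξ k (-1) α =
      hExponent ħ ξ k (-1) (α - Complex.I * ħ * k / 4) := by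
  refine modes_ext (fun j => ?_) (fun j t ht => ?_) (fun j t ht => ?_)
  · simp [eExponent_apply_origin, fExponent_apply_origin, hExponent_apply_origin]
  all_goals
    have h1 := expX_ne_zero ħ t
    have h2 := expY_ne_zero ħ k t
    have h3 := expG_ne_zero ħ ξ t
    have h4 := expX_sq_add_one_ne_zero ħ t
    have h5 := expY_sub_ne_zero hħ hk ht
    have h6 := expG_sub_ne_zero hħ hξ ht
    have h7 := expGY_sub_ne_zero hħ hξ hk ht
    have h7' : expY ħ k t ^ 4 * expG ħ ξ t ^ 2 - 1 ≠ 0 := by rwa [mul_comm]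
    have s1 := fun D x => fieldCoeff_shift hħ hk α D x
    have s2 := fun D x => fieldCoeff_shift hħ hk (α - Complex.I * ħ * k / 2) D x
    have s3 := fun D x => halfFieldCoeff_shift hħ (-1) α D x
    have s4 := fun D x => halfFieldCoeff_shift hħ (-1) (α - Complex.I * ħ * k / 2) D x
    have n1 : ∀ β : ℂ, Complex.I * β * ((-t : ℝ) : ℂ) = -(Complex.I * β * t) := fun β => by
      push_cast; ring
    refine fin_three_cases (p := fun j => (_ : Modes) j _ = (_ : Modes) j _) ?_ ?_ ?_ j
  all_goals
    simp only [Pi.add_apply, eExponent_apply_zero, eExponent_apply_one,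
      eExponent_apply_two, fExponent_apply_zero, fExponent_apply_one, fExponent_apply_two,
      para_one, para_two, s1, s2, s3, s4, exp_shift_pos α t, exp_shift_neg α t]
    first
      | rw [hExponent_pos hħ (-1) _ ht, exp_h_pos, if_neg (by decide)]
      | rw [hExponent_neg hħ (-1) _ ht, exp_h_neg, if_neg (by decide)]
      | rw [hExponent_apply_of_ne _ _ (show (1 : Fin 3) ≠ 0 by decide)]
      | rw [hExponent_apply_of_ne _ _ (show (2 : Fin 3) ≠ 0 by decide)]
    simp only [fieldCoeff_neg, fieldCoeff_eq hħ _ ht, primeRatio_neg, primeRatio_eq,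
      halfFieldCoeff_pos hħ _ ht, halfFieldCoeff_pos_neg _ ht, halfFieldCoeff_neg _ ht,
      halfFieldCoeff_neg_neg hħ _ ht, Units.val_neg, Units.val_one, Int.cast_neg, Int.cast_one,
      neg_mul, one_mul, neg_neg, neg_div, exp_quarter_k ħ k, exp_quarter_neg_k ħ k,
      exp_quarter_k2 ħ k, exp_quarter_neg_k2 ħ k, mul_zero, zero_mul, sub_zero, add_zero, zero_add,
      neg_zero, mul_neg, mul_one, Complex.ofReal_zero, zero_div, Complex.exp_zero, n1]
    try
      generalize Complex.exp (Complex.I * α * t) = A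
      generalize Complex.exp (-(Complex.I * α * t)) = B
      field_simp
      try ring

end

end FreeField

/-! ### Poles and residues of the products of `E` and `F` -/

namespace FreeField

section

variable {ħ ξ k M : ℝ}

theorem normalPair_swap (v : Modes) (Φ : State) (f g : ℂ → Modes) (α β : ℂ) :
    normalPair ħ ξ k v Φ g f (β, α) = normalPair ħ ξ k v Φ f g (α, β) := by
  simp only [normalPair]
  rw [add_right_comm]
  ring

/-- The normal ordered product of two exponentials is the exponential of the sum. -/
theorem normalPair_eq (hħ : 0 < ħ) (hξ : 0 < ξ) (hk : 0 < k) {v : Modes} (hv : IsTest v)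
    (Φ : State) {f g : ℂ → Modes} (hf : ModeFamily M f) (hg : ModeFamily M g) {α β : ℂ} {h : Modes}
    (hh : f α + g β = h) : normalPair ħ ξ k v Φ f g (α, β) =
      Complex.exp (contraction ħ ξ k v h) * Φ (v + h) := by
  rw [← hh, contraction_add_right (testPair_left hħ hξ hk (hf.contOff α) hv).contractible
    (testPair_left hħ hξ hk (hg.contOff β) hv).contractible, Complex.exp_add, ← add_assoc]
  rfl

theorem sum_units (f : ℤˣ → ℂ) : ∑ u, f u = f 1 + f (-1) := by
  have hu : (Finset.univ : Finset ℤˣ) = {1, -1} := rfl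
  rw [hu, Finset.sum_pair (by decide)]

/-- The matrix elements of `E(α) F(β)` and `F(β) E(α)`. -/
noncomputable def productEF (ħ ξ k : ℝ) (v : Modes) (Φ : State) (α β : ℂ) : ℂ :=
  ∑ u : ℤˣ, ∑ w : ℤˣ, ((u : ℤ) : ℂ) / ħ * -(((w : ℤ) : ℂ) / ħ) *
    (ratioEF ħ k u w (-(Complex.I * (α - β))) *
      normalPair ħ ξ k v Φ (eExponent ħ k u) (fExponent ħ ξ k w) (α, β))

theorem mul_EF_apply (hħ : 0 < ħ) (hξ : 0 < ξ) (hk : 0 < k) {v : Modes} (hv : IsTest v) (Φ : State)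
    {α β : ℂ} (h : vertexStrip ħ ξ k < (α - β).im) :
    (eCurrent ħ ξ k α * fCurrent ħ ξ k β) Φ v = productEF ħ ξ k v Φ α β := by
  rw [(isVertexCurrent_E hħ hξ hk).mul_apply (isVertexCurrent_F hħ hξ hk) hħ hξ hk hv h, productEF]
  refine Finset.sum_congr rfl fun u _ => Finset.sum_congr rfl fun w _ => ?_
  rw [contraction, (hasExp_EF hħ hξ hk u w rfl (by
    rw [re_neg_I_mul]; linarith [(lt_vertexStrip hħ hξ hk).2.1])).2]

theorem mul_FE_apply (hħ : 0 < ħ) (hξ : 0 < ξ) (hk : 0 < k) {v : Modes} (hv : IsTest v) (Φ : State)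
    {α β : ℂ} (h : vertexStrip ħ ξ k < (β - α).im) :
    (fCurrent ħ ξ k β * eCurrent ħ ξ k α) Φ v = productEF ħ ξ k v Φ α β := by
  rw [(isVertexCurrent_F hħ hξ hk).mul_apply (isVertexCurrent_E hħ hξ hk) hħ hξ hk hv h, productEF,
    Finset.sum_comm]
  refine Finset.sum_congr rfl fun u _ => Finset.sum_congr rfl fun w _ => ?_
  rw [contraction, (hasExp_FE hħ hξ hk u w (α := α) (β := β) rfl (by
    rw [re_neg_I_mul, ← neg_sub, Complex.neg_im]
    linarith [(lt_vertexStrip hħ hξ hk).2.1])).2, normalPair_swap]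
  ring

/-- In terms of the distance `x` to the pole, the residue can be read off. -/
theorem ratioEF_one_one {x z : ℂ} (hx : x ≠ 0) (hz : z = -(Complex.I * (x + Complex.I * ħ * k / 2))) :
    ratioEF ħ k 1 1 z = 1 - Complex.I * ħ / x := by
  have h1 : z - ħ * k / 2 = -(Complex.I * x) := by
    rw [hz]; linear_combination -(ħ * k / 2 : ℂ) * Complex.I_sq
  have h2 : z - ħ * (k + 2) / 2 = -(Complex.I * x) - ħ := by rw [← h1]; ring
  rw [ratioEF, if_pos rfl, if_pos rfl, h1, h2]
  have := Complex.I_ne_zero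
  field_simp
  linear_combination (ħ : ℂ) * Complex.I_sq

theorem ratioEF_neg_neg {y z : ℂ} (hy : y ≠ 0)
    (hz : z = -(Complex.I * (y - Complex.I * ħ * k / 2))) :
    ratioEF ħ k (-1) (-1) z = 1 + Complex.I * ħ / y := by
  have h1 : z + ħ * k / 2 = -(Complex.I * y) := by
    rw [hz]; linear_combination (ħ * k / 2 : ℂ) * Complex.I_sq
  have h2 : z + ħ * (k + 2) / 2 = -(Complex.I * y) + ħ := by rw [← h1]; ring
  rw [ratioEF, if_neg (by decide), if_neg (by decide), h1, h2]
  have := Complex.I_ne_zero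
  field_simp
  linear_combination -(ħ : ℂ) * Complex.I_sq

theorem hCurrent_apply (hħ : 0 < ħ) (hξ : 0 < ξ) (hk : 0 < k) (s : ℤˣ) {v : Modes} (hv : IsTest v)
    (α : ℂ) (Φ : State) : hCurrent ħ ξ k s α Φ v = Complex.I / (2 * Real.pi) *
      (Complex.exp (contraction ħ ξ k v (hExponent ħ ξ k s α)) * Φ (v + hExponent ħ ξ k s α)) := by
  rw [(isVertexCurrent_H hħ hξ hk s).apply_test hħ hξ hk hv, Fintype.sum_unique]

/-- Terms with opposite signs are entire. In a term with equal signs the matrix element is its value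
on the pole line, a matrix element of `H^±`, plus a multiple of the distance to the line, which
cancels the pole. The residues have the factors `±i / ħ`, that is `2π / ħ` times the `i / (2π)` in
`H`. -/
theorem exists_regular_EF (hħ : 0 < ħ) (hξ : 0 < ξ) (hk : 0 < k) {v : Modes} (hv : IsTest v)
    {Φ : State} (hΦ : Φ ∈ Fock ħ ξ k) : ∃ R : ℂ × ℂ → ℂ, Differentiable ℂ R ∧ ∀ α β : ℂ,
      α - β - Complex.I * ħ * k / 2 ≠ 0 → α - β + Complex.I * ħ * k / 2 ≠ 0 →
      productEF ħ ξ k v Φ α β = 2 * Real.pi / ħ *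
          (1 / (α - β - Complex.I * ħ * k / 2) *
              hCurrent ħ ξ k 1 (α - Complex.I * ħ * k / 4) Φ v -
            1 / (α - β + Complex.I * ħ * k / 2) *
              hCurrent ħ ξ k (-1) (β - Complex.I * ħ * k / 4) Φ v) + R (α, β) := by
  have hE := modeFamily_eExponent hħ hξ hk
  have hF := modeFamily_fExponent hħ hξ hk
  have hA := fun u w => normalPair_mem hħ hξ hk hv (hE u) (hF w) hΦ
  set A : ℤˣ → ℤˣ → ℂ × ℂ → ℂ :=
    fun u w => normalPair ħ ξ k v Φ (eExponent ħ k u) (fExponent ħ ξ k w) with hAdef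
  have hAd := fun u w => differentiable_of_mem_splitAlgebra (hA u w)
  -- The first variable is kept and the second moved onto the pole line, so that `H^+` appears at an
  -- argument depending on `α` only.
  obtain ⟨Q, hQ, hQ'⟩ := exists_factor_of_mem_splitAlgebra (hA 1 1)
    (ρ := fun x => (x.1, x.1 - Complex.I * ħ * k / 2)) (by fun_prop)
    (l := fun x => x.1 - x.2 - Complex.I * ħ * k / 2) (a := 0) (b := 1)
    (fun x => by ring) (fun x => by ring)
  -- Here the second variable is kept, so that `H^-` depends on `β` only.
  obtain ⟨P, hP, hP'⟩ := exists_factor_of_mem_splitAlgebra (hA (-1) (-1))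
    (ρ := fun x => (x.2 - Complex.I * ħ * k / 2, x.2)) (by fun_prop)
    (l := fun x => x.1 - x.2 + Complex.I * ħ * k / 2) (a := -1) (b := 0)
    (fun x => by ring) (fun x => by ring)
  -- The first group collects the constants `1` in the four factors `ratioEF`, with weights `-uw / ħ
  -- ^ 2`; the terms in `Q` and `P` are what division by the distances leaves.
  refine ⟨fun x => -(1 / ħ ^ 2) * (A 1 1 x + A (-1) (-1) x - A 1 (-1) x - A (-1) 1 x) -
    Complex.I / ħ * Q x + Complex.I / ħ * P x, ?_, fun α β hx hy => ?_⟩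
  · have h1 := hAd 1 1
    have h2 := hAd (-1) (-1)
    have h3 := hAd 1 (-1)
    have h4 := hAd (-1) 1
    exact ((((((h1.add h2).sub h3).sub h4).const_mul _).sub (hQ.const_mul _)).add (hP.const_mul _))
  · have hħ' : (ħ : ℂ) ≠ 0 := by exact_mod_cast hħ.ne'
    have hpi : (Real.pi : ℂ) ≠ 0 := by exact_mod_cast Real.pi_ne_zero
    have q := hQ' (α, β)
    have p := hP' (α, β)
    beta_reduce at q p
    rw [normalPair_eq hħ hξ hk hv Φ (hE 1) (hF 1) (eExponent_add_fExponent_one hħ hξ hk α)] at q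
    rw [normalPair_eq hħ hξ hk hv Φ (hE (-1)) (hF (-1))
      (eExponent_add_fExponent_neg_one hħ hξ hk β)] at p
    rw [hCurrent_apply hħ hξ hk 1 hv, hCurrent_apply hħ hξ hk (-1) hv, eq_add_of_sub_eq q,
      eq_add_of_sub_eq p, productEF]
    simp only [sum_units]
    rw [ratioEF_one_one hx (by ring), ratioEF_neg_neg hy (by ring)]
    have r1 : ∀ z, ratioEF ħ k 1 (-1) z = 1 := fun z => by
      rw [ratioEF, if_pos rfl, if_neg (by decide)]
    have r2 : ∀ z, ratioEF ħ k (-1) 1 z = 1 := fun z => by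
      rw [ratioEF, if_neg (by decide), if_pos rfl]
    rw [r1, r2]
    simp only [hAdef, Units.val_neg, Units.val_one, Int.cast_neg, Int.cast_one]
    generalize normalPair ħ ξ k v Φ (eExponent ħ k 1) (fExponent ħ ξ k 1) (α, β) = a1
    generalize normalPair ħ ξ k v Φ (eExponent ħ k 1) (fExponent ħ ξ k (-1)) (α, β) = a2
    generalize normalPair ħ ξ k v Φ (eExponent ħ k (-1)) (fExponent ħ ξ k 1) (α, β) = a3
    generalize normalPair ħ ξ k v Φ (eExponent ħ k (-1)) (fExponent ħ ξ k (-1)) (α, β) = a4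
    generalize Q (α, β) = q0
    generalize P (α, β) = p0
    generalize α - β - Complex.I * ħ * k / 2 = x at *
    generalize α - β + Complex.I * ħ * k / 2 = y at *
    field_simp
    ring

theorem relation_EF (hħ : 0 < ħ) (hξ : 0 < ξ) (hk : 0 < k) : ∀ b ∈ bras, ∀ w ∈ Fock ħ ξ k,
    ∃ R : ℂ × ℂ → ℂ, Differentiable ℂ R ∧ ∀ α β G : ℂ,
      G = 2 * Real.pi / ħ *
          (1 / (α - β - Complex.I * ħ * k / 2) *
              b (hCurrent ħ ξ k 1 (α - Complex.I * ħ * k / 4) w) -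
            1 / (α - β + Complex.I * ħ * k / 2) *
              b (hCurrent ħ ξ k (-1) (β - Complex.I * ħ * k / 4) w)) + R (α, β) →
      (vertexStrip ħ ξ k < (α - β).im → b ((eCurrent ħ ξ k α * fCurrent ħ ξ k β) w) = G) ∧
      (vertexStrip ħ ξ k < (β - α).im → b ((fCurrent ħ ξ k β * eCurrent ħ ξ k α) w) = G) := by
  rintro _ ⟨v, hv, rfl⟩ Φ hΦ
  obtain ⟨R, hR, h⟩ := exists_regular_EF hħ hξ hk hv hΦ
  obtain ⟨-, hs, -⟩ := lt_vertexStrip hħ hξ hk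
  have him : ∀ d : ℂ, (d - Complex.I * ħ * k / 2).im = d.im - ħ * k / 2 ∧
      (d + Complex.I * ħ * k / 2).im = d.im + ħ * k / 2 := fun d => by
    have e : Complex.I * ħ * k / 2 = ((ħ * k / 2 : ℝ) : ℂ) * Complex.I := by push_cast; ring
    rw [e]; simp
  have hne : ∀ d : ℂ, d.im ≠ 0 → d ≠ 0 := fun d hd h0 => hd (by rw [h0, Complex.zero_im])
  have hk' := mul_pos hħ hk
  -- In both half-planes `|Im (α - β)|` exceeds `ħk/2`, so neither pole is met.
  refine ⟨R, hR, fun α β G hG => ⟨fun hd => ?_, fun hd => ?_⟩⟩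
  · rw [hG, LinearMap.proj_apply, mul_EF_apply hħ hξ hk hv Φ hd]
    refine h α β (hne _ ?_) (hne _ ?_)
    · rw [(him _).1]; nlinarith
    · rw [(him _).2]; nlinarith
  · rw [← neg_sub, Complex.neg_im] at hd
    rw [hG, LinearMap.proj_apply, mul_FE_apply hħ hξ hk hv Φ (by
      rw [← neg_sub, Complex.neg_im]; exact hd)]
    refine h α β (hne _ ?_) (hne _ ?_)
    · rw [(him _).1]; nlinarith
    · rw [(him _).2]; nlinarith

end

end FreeField

namespace FreeField

/-! ### Fourier transforms of functions that are bounded on strips -/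

/-- Integration of Schwartz functions against a bounded function. -/
theorem exists_clm_integral_mul {J : ℝ → ℂ} (hJ : Continuous J) {C : ℝ} (hC : ∀ x, ‖J x‖ ≤ C) :
    ∃ A : 𝓢(ℝ, ℂ) →L[ℂ] ℂ, ∀ φ : 𝓢(ℝ, ℂ),
      Integrable (fun x : ℝ => J x * φ x) ∧ ∫ x : ℝ, J x * φ x = A φ := by
  have hint : ∀ φ : 𝓢(ℝ, ℂ), Integrable (fun x : ℝ => J x * φ x) := fun φ =>
    φ.integrable.bdd_mul hJ.aestronglyMeasurable (Eventually.of_forall hC)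
  let L : (Lp ℂ 1 (volume : Measure ℝ)) →L[ℂ] ℂ := LinearMap.mkContinuous
    { toFun := fun f => ∫ x : ℝ, J x * f x
      map_add' := fun f g => by
        have hi : ∀ f : Lp ℂ 1 (volume : Measure ℝ), Integrable (fun x : ℝ => J x * f x) := fun f =>
          (L1.integrable_coeFn f).bdd_mul hJ.aestronglyMeasurable (Eventually.of_forall hC)
        rw [← integral_add (hi f) (hi g)]
        refine integral_congr_ae ?_
        filter_upwards [Lp.coeFn_add f g] with x hx
        rw [hx, Pi.add_apply, mul_add]
      map_smul' := fun a f => by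
        rw [RingHom.id_apply, smul_eq_mul, ← integral_const_mul]
        refine integral_congr_ae ?_
        filter_upwards [Lp.coeFn_smul a f] with x hx
        rw [hx, Pi.smul_apply, smul_eq_mul]
        ring } C fun f => by
    have h : ‖f‖ = ∫ x, ‖f x‖ := L1.norm_eq_integral_norm f
    rw [h, ← integral_const_mul]
    refine norm_integral_le_of_norm_le ((L1.integrable_coeFn f).norm.const_mul C)
      (Eventually.of_forall fun x => ?_)
    rw [norm_mul]
    exact mul_le_mul_of_nonneg_right (hC x) (norm_nonneg _)
  refine ⟨L ∘L SchwartzMap.toLpCLM ℂ ℂ 1 volume, fun φ => ⟨hint φ, ?_⟩⟩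
  refine integral_congr_ae ?_
  filter_upwards [φ.coeFn_toLp 1 volume] with x hx
  exact congrArg (J x * ·) hx.symm

/-- `ψ ↦ φ` for `ψ(l) = ∫ exp(ilx) φ(x) dx`. -/
noncomputable def invExpTransform : 𝓢(ℝ, ℂ) →L[ℂ] 𝓢(ℝ, ℂ) :=
  (FourierTransform.fourierCLE ℂ 𝓢(ℝ, ℂ)).symm.toContinuousLinearMap ∘L
    SchwartzMap.compCLMOfContinuousLinearEquiv ℂ (ContinuousLinearEquiv.unitsEquivAut ℝ
      (Units.mk0 (-(2 * Real.pi)) (neg_ne_zero.2 Real.two_pi_pos.ne')))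

/-- The kernel `exp(ilx)` is that of the Fourier transform up to the substitution `l ↦ -2πl`;
Fourier inversion recovers `φ`. -/
theorem invExpTransform_eq {φ ψ : 𝓢(ℝ, ℂ)}
    (h : ∀ l : ℝ, ψ l = ∫ x : ℝ, Complex.exp (Complex.I * l * x) * φ x) :
    invExpTransform ψ = φ := by
  have e : SchwartzMap.compCLMOfContinuousLinearEquiv ℂ (ContinuousLinearEquiv.unitsEquivAut ℝ
      (Units.mk0 (-(2 * Real.pi)) (neg_ne_zero.2 Real.two_pi_pos.ne'))) ψ =
      FourierTransform.fourierCLE ℂ 𝓢(ℝ, ℂ) φ := by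
    ext l
    rw [SchwartzMap.compCLMOfContinuousLinearEquiv_apply, FourierTransform.fourierCLE_apply,
      SchwartzMap.fourier_coe, Real.fourier_real_eq_integral_exp_smul, Function.comp_apply, h]
    refine integral_congr_ae (Eventually.of_forall fun x => ?_)
    simp only [ContinuousLinearEquiv.unitsEquivAut_apply, Units.val_mk0, smul_eq_mul]
    push_cast
    ring_nf
  rw [invExpTransform, ContinuousLinearMap.comp_apply, e]
  exact (FourierTransform.fourierCLE ℂ 𝓢(ℝ, ℂ)).symm_apply_apply φ

theorem invExpTransform_apply (ψ : 𝓢(ℝ, ℂ)) (x : ℝ) : invExpTransform ψ x =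
    (2 * Real.pi : ℂ)⁻¹ * ∫ l : ℝ, Complex.exp (-Complex.I * x * l) * ψ l := by
  have e : invExpTransform ψ x = ∫ l : ℝ, (fun l : ℝ => Complex.exp (-Complex.I * x * l) * ψ l)
      (-(2 * Real.pi) * l) := by
    rw [invExpTransform, ContinuousLinearMap.comp_apply]
    change (FourierTransform.fourierCLE ℂ 𝓢(ℝ, ℂ)).symm _ x = _
    rw [FourierTransform.fourierCLE_symm_apply, SchwartzMap.fourierInv_coe, Real.fourierInv_eq']
    refine integral_congr_ae (Eventually.of_forall fun l => ?_)
    simp only [SchwartzMap.compCLMOfContinuousLinearEquiv_apply, Function.comp_apply,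
      ContinuousLinearEquiv.unitsEquivAut_apply, Units.val_mk0, smul_eq_mul, real_inner_comm]
    simp only [RCLike.inner_apply, conj_trivial]
    push_cast
    ring_nf
  rw [e, Measure.integral_comp_mul_left (fun l : ℝ => Complex.exp (-Complex.I * x * l) * ψ l),
    abs_inv, abs_neg, abs_of_pos Real.two_pi_pos,
    Complex.real_smul]
  push_cast
  rfl

/-- The distribution is forced: integrate `J` against the function whose transform is `ψ`. It is
tempered because `J` is bounded on the real line. -/
theorem EntireOnStrips.exists_isGeneratingFunction {J : ℂ → ℂ} (hJ : EntireOnStrips J) :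
    ∃ T : 𝓢(ℝ, ℂ) →L[ℂ] ℂ, CurrentAlgebra.IsGeneratingFunction T J ∧
      ∀ ψ : 𝓢(ℝ, ℂ), T ψ = ∫ x : ℝ, J x * invExpTransform ψ x := by
  obtain ⟨C, hC⟩ := hJ.bound 0
  obtain ⟨A, hA⟩ := exists_clm_integral_mul (J := fun x : ℝ => J x)
    (hJ.diff.continuous.comp Complex.continuous_ofReal) (fun x => hC x (by simp))
  refine ⟨A ∘L invExpTransform, fun φ ψ h => ?_, fun ψ => (hA _).2.symm⟩
  rw [ContinuousLinearMap.comp_apply, invExpTransform_eq h]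
  exact hA φ

/-- The easy half of Paley–Wiener: compact support makes the transform entire and bounded on strips.
-/
theorem entireOnStrips_expTransform {χ : 𝓢(ℝ, ℂ)} (hχ : HasCompactSupport χ) :
    EntireOnStrips fun z =>
      (2 * Real.pi : ℂ)⁻¹ * ∫ l : ℝ, Complex.exp (-Complex.I * z * l) * χ l := by
  obtain ⟨B, hB⟩ := hχ.isCompact.isBounded.exists_norm_le
  refine (EntireOnStrips.const _).mul (entireOnStrips_integral (B := B) χ.integrable
    (Eventually.of_forall fun t ht => ?_) (Or.inr rfl))
  by_contra h
  exact absurd (hB t (subset_tsupport _ h)) (not_le.2 ht)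

/-- The Riemann–Lebesgue lemma on a horizontal line, applied to `χ` weighted with `exp(yl)`. -/
theorem tendsto_expTransform (χ : 𝓢(ℝ, ℂ)) (y : ℝ) :
    Tendsto (fun x : ℝ => (2 * Real.pi : ℂ)⁻¹ *
      ∫ l : ℝ, Complex.exp (-Complex.I * (x + y * Complex.I) * l) * χ l) (cocompact ℝ) (𝓝 0) := by
  have h := Real.tendsto_integral_exp_smul_cocompact (fun l : ℝ => Complex.exp (y * l) * χ l)
  have h2 : Tendsto (fun x : ℝ => (2 * Real.pi)⁻¹ * x) (cocompact ℝ) (cocompact ℝ) :=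
    (Homeomorph.mulLeft₀ _ (inv_ne_zero Real.two_pi_pos.ne')).isClosedEmbedding.tendsto_cocompact
  have h3 := (h.comp h2).const_mul (2 * Real.pi : ℂ)⁻¹
  rw [mul_zero] at h3
  refine h3.congr fun x => ?_
  congr 1
  refine integral_congr_ae (Eventually.of_forall fun l => ?_)
  simp only [Circle.smul_def, Real.fourierChar_apply, smul_eq_mul]
  rw [← mul_assoc, ← Complex.exp_add]
  have hpi : (Real.pi : ℂ) ≠ 0 := by exact_mod_cast Real.pi_ne_zero
  congr 2
  push_cast
  field_simp
  linear_combination (y * l : ℂ) * Complex.I_sq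

/-- Shift of the contour of integration. -/
theorem integral_shift_eq {G : ℂ → ℂ} (hG : EntireOnStrips G) {y : ℝ}
    (h0 : Integrable fun x : ℝ => G x) (h1 : Integrable fun x : ℝ => G (x + y * Complex.I))
    (hlim : ∀ τ : ℝ, Tendsto (fun x : ℝ => G (x + τ * Complex.I)) (cocompact ℝ) (𝓝 0)) :
    ∫ x : ℝ, G x = ∫ x : ℝ, G (x + y * Complex.I) := by
  obtain ⟨C, hC⟩ := hG.bound |y|
  -- The vertical sides of the rectangle contribute nothing in the limit, by dominated convergence
  -- between `0` and `y`.
  have side : ∀ l : Filter ℝ, l.IsCountablyGenerated → l ≤ cocompact ℝ →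
      Tendsto (fun R : ℝ => ∫ τ in (0 : ℝ)..y, G (R + τ * Complex.I)) l (𝓝 0) := by
    intro l _ hl
    have h := intervalIntegral.tendsto_integral_filter_of_dominated_convergence (μ := volume)
      (a := 0) (b := y) (l := l) (F := fun (R τ : ℝ) => G (R + τ * Complex.I)) (f := fun _ => 0)
      (fun _ => C) (Eventually.of_forall fun R =>
        (hG.diff.continuous.comp (by fun_prop)).aestronglyMeasurable)
      (Eventually.of_forall fun R => Eventually.of_forall fun τ hτ => hC _ ?_)
      intervalIntegrable_const (Eventually.of_forall fun τ _ => (hlim τ).mono_left hl)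
    · simpa using h
    · have : (R + τ * Complex.I : ℂ).im = τ := by simp
      rw [this]
      rcases le_total 0 y with h | h
      · rw [uIoc_of_le h] at hτ
        rw [abs_of_pos hτ.1, abs_of_nonneg h]; exact hτ.2
      · rw [uIoc_of_ge h] at hτ
        rw [abs_of_nonpos hτ.2, abs_of_nonpos h]; linarith [hτ.1]
  -- Cauchy's theorem for the rectangle of half-width `R` between the real line and the line `Im =
  -- y`.
  have hrect : ∀ R : ℝ, (∫ x : ℝ in (-R)..R, G x) - (∫ x : ℝ in (-R)..R, G (x + y * Complex.I)) +
      Complex.I * (∫ τ : ℝ in (0 : ℝ)..y, G (R + τ * Complex.I)) -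
      Complex.I * (∫ τ : ℝ in (0 : ℝ)..y, G ((-R : ℝ) + τ * Complex.I)) = 0 := by
    intro R
    have h := Complex.integral_boundary_rect_eq_zero_of_differentiableOn G (-R : ℝ) (R + y * Complex.I)
      hG.diff.differentiableOn
    simpa using h
  have l0 := intervalIntegral_tendsto_integral h0 tendsto_neg_atTop_atBot tendsto_id
  have l1 := intervalIntegral_tendsto_integral h1 tendsto_neg_atTop_atBot tendsto_id
  have l2 := (side atTop inferInstance atTop_le_cocompact).const_mul Complex.I
  have l3 := ((side atBot inferInstance atBot_le_cocompact).comp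
    tendsto_neg_atTop_atBot).const_mul Complex.I
  have l4 := ((l0.sub l1).add l2).sub l3
  have h5 := tendsto_nhds_unique (l4.congr fun R => hrect R) (tendsto_const_nhds (x := (0 : ℂ)))
  simpa [sub_eq_zero] using h5

/-- Multiplying `χ` by `exp(-yl)` displaces its transform by `-iy`, and moving the contour transfers
the displacement to `J`. Compact support of `χ` makes its transform entire, as the contour shift
requires. -/
theorem EntireOnStrips.integral_shift {J : ℂ → ℂ} (hJ : EntireOnStrips J) {χ ψ : 𝓢(ℝ, ℂ)}
    (hχ : HasCompactSupport χ) {y : ℝ} (hψ : ∀ l : ℝ, ψ l = Complex.exp (-(y * l)) * χ l) :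
    ∫ x : ℝ, J (x + y * Complex.I) * invExpTransform χ x = ∫ x : ℝ, J x * invExpTransform ψ x := by
  set L : ℂ → ℂ := fun z =>
    (2 * Real.pi : ℂ)⁻¹ * ∫ l : ℝ, Complex.exp (-Complex.I * z * l) * χ l with hL
  have hLs : EntireOnStrips L := entireOnStrips_expTransform hχ
  have e0 : ∀ x : ℝ, L x = invExpTransform χ x := fun x => (invExpTransform_apply χ x).symm
  have e1 : ∀ x : ℝ, L (x + -(y * Complex.I)) = invExpTransform ψ x := fun x => by
    rw [invExpTransform_apply]
    simp only [hL]
    refine congrArg ((2 * Real.pi : ℂ)⁻¹ * ·)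
      (integral_congr_ae (Eventually.of_forall fun l => ?_))
    beta_reduce
    rw [hψ, ← mul_assoc, ← Complex.exp_add]
    congr 2
    linear_combination (y * l : ℂ) * Complex.I_sq
  have hG := hJ.mul (hLs.comp_add (-(y * Complex.I)))
  have e2 : ∀ x : ℝ, J (x + y * Complex.I) * L (x + y * Complex.I + -(y * Complex.I)) =
      J (x + y * Complex.I) * invExpTransform χ x := fun x => by
    rw [add_neg_cancel_right, e0]
  have hi : ∀ (c : ℂ) (φ : 𝓢(ℝ, ℂ)), Integrable fun x : ℝ => J (x + c) * φ x := fun c φ => by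
    have hJc := hJ.comp_add c
    obtain ⟨C, hC⟩ := hJc.bound 0
    exact φ.integrable.bdd_mul
      (hJc.diff.continuous.comp Complex.continuous_ofReal).aestronglyMeasurable
      (Eventually.of_forall fun x => hC x (by simp))
  have h := integral_shift_eq hG (y := y) (by
      simp only [e1]
      simpa using hi 0 (invExpTransform ψ)) (by
      simp only [e2]
      exact hi _ _) (fun τ => ?_)
  · simp only [e1, e2] at h
    exact h.symm
  · obtain ⟨C, hC⟩ := hJ.bound |τ|
    have ht := tendsto_expTransform χ (τ - y)
    refine squeeze_zero_norm (a := fun x : ℝ => C * ‖L (x + (τ - y : ℝ) * Complex.I)‖)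
      (fun x => ?_) ?_
    · have e : (x + τ * Complex.I + -(y * Complex.I) : ℂ) = x + (τ - y : ℝ) * Complex.I := by
        push_cast; ring
      rw [norm_mul, e]
      exact mul_le_mul_of_nonneg_right (hC _ (by simp)) (norm_nonneg _)
    · have h := ht.norm.const_mul C
      rwa [norm_zero, mul_zero] at h

section

variable {ħ ξ k : ℝ}

/-- `H^+` and `H^-` are translates of each other, which is why one `t` suffices for both. -/
theorem hExponent_shift (hħ : 0 < ħ) (s : ℤˣ) (α : ℂ) : hExponent ħ ξ k s α =
    hExponent ħ ξ k 1 (α + ((((s : ℤ) : ℝ) * hShift ħ ξ k : ℝ) : ℂ) * Complex.I -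
      Complex.I * hShift ħ ξ k) := by
  funext j t
  rcases eq_or_ne t 0 with rfl | ht
  · rw [hExponent_apply_origin, hExponent_apply_origin]
  rcases eq_or_ne j 0 with rfl | hj
  · rw [hExponent_apply_zero hħ _ _ ht, hExponent_apply_zero hħ _ _ ht]
    congr 2
    push_cast
    linear_combination -((((s : ℤ) : ℂ) - 1) * hShift ħ ξ k * t) * Complex.I_sq
  · rw [hExponent_apply_of_ne _ _ hj, hExponent_apply_of_ne _ _ hj]

theorem modes_H (hħ : 0 < ħ) (hξ : 0 < ξ) (hk : 0 < k) {η η' : ℝ} (hη : 1 / η = ħ * ξ)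
    (hη' : 1 / η' = ħ * (ξ + k)) : ∀ b ∈ bras, ∀ w ∈ Fock ħ ξ k, ∃ t : 𝓢(ℝ, ℂ) →ₗ[ℂ] ℂ, ∀ s : ℤˣ,
    ∃ T : 𝓢(ℝ, ℂ) →L[ℂ] ℂ,
      CurrentAlgebra.IsGeneratingFunction T (fun α => b (hCurrent ħ ξ k s α w)) ∧
      ∀ χ ψ : 𝓢(ℝ, ℂ), HasCompactSupport χ →
        (∀ l : ℝ, ψ l =
          Complex.exp (-(((s : ℤ) : ℂ) * l / (2 * (2 * η * η' / (η + η'))))) * χ l) →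
        T χ = -(ħ / 2) * t ψ := by
  rintro _ ⟨v, hv, rfl⟩ Φ hΦ
  have hH := fun s => (isVertexCurrent_H hħ hξ hk s).entireOnStrips hħ hξ hk hv hΦ
  have hħ' : (ħ : ℂ) ≠ 0 := by exact_mod_cast hħ.ne'
  -- The common function, centred so that `H^s` is `h` translated by `s i hShift`.
  set h : ℂ → ℂ := fun z => hCurrent ħ ξ k 1 (z - Complex.I * hShift ħ ξ k) Φ v with hdef
  have hh : EntireOnStrips h := by
    simpa only [← sub_eq_add_neg] using (hH 1).comp_add (-(Complex.I * hShift ħ ξ k))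
  have hs : ∀ (s : ℤˣ) (α : ℂ), hCurrent ħ ξ k s α Φ v =
      h (α + ((((s : ℤ) : ℝ) * hShift ħ ξ k : ℝ) : ℂ) * Complex.I) := fun s α => by
    simp only [hdef]
    rw [hCurrent_apply hħ hξ hk s hv, hCurrent_apply hħ hξ hk 1 hv, hExponent_shift hħ s α]
  obtain ⟨T₀, -, hT₀⟩ := hh.exists_isGeneratingFunction
  -- The factor inverts the normalization `-(ħ / 2)`.
  refine ⟨(-(2 / ħ : ℂ)) • T₀.toLinearMap, fun s => ?_⟩
  obtain ⟨T, hT, hT'⟩ := (hH s).exists_isGeneratingFunction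
  refine ⟨T, hT, fun χ ψ hχ hψ => ?_⟩
  have hω := mul_pos hħ hξ
  have hω' := mul_pos hħ (add_pos hξ hk)
  have hη0 : 0 < η := by rw [← one_div_pos, hη]; exact hω
  have hη0' : 0 < η' := by rw [← one_div_pos, hη']; exact hω'
  -- By this, `1 / (2η'')` equals `hShift`, so the weight in the integral for `H^s` is exactly the
  -- effect of its translation.
  have e : (2 * η * η' / (η + η') : ℂ) = ((1 / (2 * hShift ħ ξ k) : ℝ) : ℂ) := by
    have : 2 * η * η' / (η + η') = 1 / (2 * hShift ħ ξ k) := by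
      have h1 : η = 1 / (ħ * ξ) := by rw [← hη, one_div_one_div]
      have h2 : η' = 1 / (ħ * (ξ + k)) := by rw [← hη', one_div_one_div]
      have h3 : ξ + k + ξ ≠ 0 := by positivity
      have h4 : ξ + k / 2 ≠ 0 := by positivity
      rw [h1, h2, hShift]
      field_simp
      ring
    rw [← this]; push_cast; rfl
  have hS : (hShift ħ ξ k : ℂ) ≠ 0 := by
    exact_mod_cast (lt_vertexStrip hħ hξ hk).2.2.ne'
  have hψ' : ∀ l : ℝ, ψ l =
      Complex.exp (-((((s : ℤ) : ℝ) * hShift ħ ξ k : ℝ) * l)) * χ l := fun l => by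
    rw [hψ, e]
    congr 2
    push_cast
    field_simp
  have key := hh.integral_shift hχ hψ'
  rw [hT', LinearMap.smul_apply, smul_eq_mul]
  simp only [hs]
  rw [key, ← hT₀]
  have e2 : T₀.toLinearMap ψ = T₀ ψ := rfl
  rw [e2]
  field_simp

end

end FreeField

/-! ### The scaling limit of the discrete bosons -/

namespace ScalingLimit

section

variable {ħ ξ k t : ℝ} {m : ℝ → ℤ}

theorem exp_rpow_sub (x ε : ℝ) :
    Real.exp (ħ * ε / 2) ^ x - Real.exp (ħ * ε / 2) ^ (-x) = 2 * Real.sinh (ħ * (x * ε) / 2) := by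
  rw [← Real.exp_mul, ← Real.exp_mul, Real.sinh_eq]
  ring_nf

theorem exp_sub_inv (ε : ℝ) :
    Real.exp (ħ * ε / 2) - (Real.exp (ħ * ε / 2))⁻¹ = 2 * Real.sinh (ħ * ε / 2) := by
  rw [← Real.exp_neg, Real.sinh_eq]; ring

/-- The numerator depends on `n * ε`, which converges in the limit. The scale sits in the
denominator `sinh(ħε/2)`, which behaves like `ħε/2` and is balanced by the prefactors. -/
theorem qNum_exp (x ε : ℝ) (n : ℤ) : qNum (Real.exp (ħ * ε / 2)) (x * n) =
    Real.sinh (ħ * x * (n * ε) / 2) / Real.sinh (ħ * ε / 2) := by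
  rw [qNum, exp_rpow_sub, exp_sub_inv, mul_div_mul_left _ _ two_ne_zero]
  ring_nf

theorem qNum_exp_abs (x : ℝ) {ε : ℝ} (hε : 0 < ε) (n : ℤ) :
    qNum (Real.exp (ħ * ε / 2)) (x * |(n : ℝ)|) =
      Real.sinh (ħ * x * |n * ε| / 2) / Real.sinh (ħ * ε / 2) := by
  rw [qNum, exp_rpow_sub, exp_sub_inv, mul_div_mul_left _ _ two_ne_zero, abs_mul, abs_of_pos hε]
  ring_nf

theorem tendsto_sinh_half_div (ħ : ℝ) :
    Tendsto (fun ε : ℝ => 2 * Real.sinh (ħ * ε / 2) / ε) (𝓝[>] 0) (𝓝 ħ) := by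
  have h : HasDerivAt (fun ε : ℝ => 2 * Real.sinh (ħ * ε / 2)) ħ 0 := by
    have h1 : HasDerivAt (fun ε : ℝ => ħ * ε / 2) (ħ / 2) 0 := by
      simpa using ((hasDerivAt_id (0 : ℝ)).const_mul ħ).div_const 2
    exact (h1.sinh.const_mul 2).congr_deriv (by simp; ring)
  have h2 := h.tendsto_slope_zero_right
  refine h2.congr fun ε => ?_
  simp [div_eq_inv_mul]

theorem eventually_pos_nhdsGT : ∀ᶠ ε : ℝ in 𝓝[>] 0, 0 < ε := eventually_mem_nhdsWithin

theorem sinh_half_ne_zero (hħ : 0 < ħ) {ε : ℝ} (hε : ε ≠ 0) : Real.sinh (ħ * ε / 2) ≠ 0 := by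
  rw [Real.sinh_ne_zero]
  exact div_ne_zero (mul_ne_zero hħ.ne' hε) two_ne_zero

theorem sinh_coeff_ne_zero (hħ : 0 < ħ) {B t : ℝ} (hB : B ≠ 0) (ht : t ≠ 0) :
    Real.sinh (ħ * B * t / 2) ≠ 0 := by
  rw [Real.sinh_ne_zero]
  exact div_ne_zero (mul_ne_zero (mul_ne_zero hħ.ne' hB) ht) two_ne_zero

theorem tendsto_sinh_coeff (A : ℝ) {y : ℝ → ℝ} {s : ℝ} (hy : Tendsto y (𝓝[>] 0) (𝓝 s)) :
    Tendsto (fun ε => Real.sinh (ħ * A * y ε / 2)) (𝓝[>] 0) (𝓝 (Real.sinh (ħ * A * s / 2))) :=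
  (Real.continuous_sinh.tendsto _).comp ((hy.const_mul (ħ * A)).div_const 2)

theorem tendsto_prefactor (hħ : 0 < ħ) :
    Tendsto (fun ε : ℝ => ε * (1 / (Real.exp (ħ * ε / 2) - (Real.exp (ħ * ε / 2))⁻¹)))
      (𝓝[>] 0) (𝓝 (1 / ħ)) := by
  have h := (tendsto_sinh_half_div ħ).inv₀ hħ.ne'
  rw [← one_div] at h
  refine h.congr fun ε => ?_
  rw [exp_sub_inv, inv_div, mul_one_div]

theorem tendsto_primeRatio (hħ : 0 < ħ) (hξ : 0 < ξ) (hk : 0 < k) (ht : t ≠ 0)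
    (hm : Tendsto (fun ε : ℝ => m ε * ε) (𝓝[>] 0) (𝓝 t)) :
    Tendsto (fun ε : ℝ => qNum (Real.exp (ħ * ε / 2)) ((ξ + k - k) * m ε) /
        qNum (Real.exp (ħ * ε / 2)) ((ξ + k) * m ε))
      (𝓝[>] 0) (𝓝 (FreeField.primeRatio ħ ξ k t)) := by
  have h := (tendsto_sinh_coeff (ħ := ħ) ξ hm).div (tendsto_sinh_coeff (ħ := ħ) (ξ + k) hm)
    (sinh_coeff_ne_zero hħ (by positivity) ht)
  refine h.congr' ?_
  filter_upwards [eventually_pos_nhdsGT] with ε hε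
  rw [add_sub_cancel_right, qNum_exp, qNum_exp,
    div_div_div_cancel_right₀ (sinh_half_ne_zero hħ hε.ne')]
  rfl

theorem tendsto_qCommutator (hħ : 0 < ħ) (hξ : 0 < ξ) (ht : t ≠ 0)
    (hm : Tendsto (fun ε : ℝ => m ε * ε) (𝓝[>] 0) (𝓝 t)) (j : Fin 3) :
    Tendsto (fun ε : ℝ => ε / 4 * qCommutator (Real.exp (ħ * ε / 2)) (ξ + k) k j (m ε))
      (𝓝[>] 0) (𝓝 (FreeField.commutator ħ ξ k j t)) := by
  have key : ∀ K : ℝ, Tendsto (fun ε : ℝ => ε / 4 * (qNum (Real.exp (ħ * ε / 2)) (2 * m ε) *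
      qNum (Real.exp (ħ * ε / 2)) (K * m ε) / m ε)) (𝓝[>] 0)
      (𝓝 (1 / ħ ^ 2 * (Real.sinh (ħ * t) * Real.sinh (ħ * K * t / 2) / t))) := by
    intro K
    have h := (((tendsto_sinh_half_div ħ).inv₀ hħ.ne').pow 2).mul
      (((tendsto_sinh_coeff (ħ := ħ) 2 hm).mul (tendsto_sinh_coeff (ħ := ħ) K hm)).div hm ht)
    have e : (ħ⁻¹) ^ 2 * (Real.sinh (ħ * 2 * t / 2) * Real.sinh (ħ * K * t / 2) / t) =
        1 / ħ ^ 2 * (Real.sinh (ħ * t) * Real.sinh (ħ * K * t / 2) / t) := by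
      rw [inv_pow, one_div]; congr 4; ring
    rw [e] at h
    refine h.congr' ?_
    filter_upwards [eventually_pos_nhdsGT] with ε hε
    have h0 := sinh_half_ne_zero hħ hε.ne'
    have hε := hε.ne'
    simp only [Pi.div_apply]
    rw [qNum_exp, qNum_exp]
    generalize Real.sinh (ħ * 2 * (m ε * ε) / 2) = a
    generalize Real.sinh (ħ * K * (m ε * ε) / 2) = b
    -- For `m ε = 0` both sides vanish by the convention on division.
    rcases eq_or_ne (m ε : ℝ) 0 with hz | hz
    · simp [hz]
    · field_simp
      try ring
  fin_cases j
  · have h := (key k).mul ((tendsto_sinh_coeff (ħ := ħ) (ξ + k) hm).div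
      (tendsto_sinh_coeff (ħ := ħ) ξ hm) (sinh_coeff_ne_zero hħ hξ.ne' ht))
    have e : 1 / ħ ^ 2 * (Real.sinh (ħ * t) * Real.sinh (ħ * k * t / 2) / t) *
        (Real.sinh (ħ * (ξ + k) * t / 2) / Real.sinh (ħ * ξ * t / 2)) =
        FreeField.commutator ħ ξ k 0 t := by
      rw [FreeField.commutator_zero_apply]
      have h1 := sinh_coeff_ne_zero hħ hξ.ne' ht
      field_simp
    rw [e] at h
    refine h.congr' ?_
    filter_upwards [eventually_pos_nhdsGT] with ε hε
    simp only [Pi.div_apply, qCommutator, Fin.zero_eta, Matrix.cons_val_zero]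
    rw [add_sub_cancel_right, qNum_exp (ξ + k), qNum_exp ξ,
      div_div_div_cancel_right₀ (sinh_half_ne_zero hħ hε.ne'), mul_assoc]
  · have h := key (k + 2)
    rw [← FreeField.commutator_one_apply] at h
    exact h
  · have h := (key k).neg
    rw [← FreeField.commutator_two_apply] at h
    refine h.congr fun ε => ?_
    simp [qCommutator]

theorem exp_zpow_neg (α : ℂ) (ε : ℝ) (n : ℤ) : Complex.exp (-(Complex.I * α * ε)) ^ (-n) =
    Complex.exp (Complex.I * α * ((n * ε : ℝ) : ℂ)) := by
  rw [← Complex.exp_int_mul]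
  congr 1
  push_cast
  ring

theorem exp_rpow_abs (D : ℝ) {ε : ℝ} (hε : 0 < ε) (n : ℤ) :
    ((Real.exp (ħ * ε / 2) ^ (D * |(n : ℝ)|) : ℝ) : ℂ) =
      Complex.exp (ħ * D / 2 * (|n * ε| : ℝ)) := by
  rw [← Real.exp_mul, abs_mul, abs_of_pos hε]
  push_cast
  ring_nf

theorem tendsto_exp_phase (α : ℂ) (D : ℝ) {y : ℝ → ℝ} (hy : Tendsto y (𝓝[>] 0) (𝓝 t)) :
    Tendsto (fun ε => Complex.exp (Complex.I * α * (y ε : ℝ) + ħ * D / 2 * (|y ε| : ℝ)))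
      (𝓝[>] 0) (𝓝 (Complex.exp (Complex.I * α * t + ħ * D / 2 * |t|))) :=
  ((by fun_prop : Continuous fun x : ℝ =>
    Complex.exp (Complex.I * α * x + ħ * D / 2 * (|x| : ℝ))).tendsto t).comp hy

theorem tendsto_qFieldCoeff (hħ : 0 < ħ) (ht : t ≠ 0)
    (hm : Tendsto (fun ε : ℝ => m ε * ε) (𝓝[>] 0) (𝓝 t)) {A B C D : ℝ} (hB : B ≠ 0) (hC : C ≠ 0)
    (α : ℂ) : Tendsto (fun ε : ℝ => 2 / (ε : ℂ) *
        qFieldCoeff (Real.exp (ħ * ε / 2)) A B C (Complex.exp (-(Complex.I * α * ε))) D (m ε))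
      (𝓝[>] 0) (𝓝 (FreeField.fieldCoeff ħ A B C α D t)) := by
  have hr := ((tendsto_sinh_half_div ħ).mul ((tendsto_sinh_coeff (ħ := ħ) A hm).div
    ((tendsto_sinh_coeff (ħ := ħ) B hm).mul (tendsto_sinh_coeff (ħ := ħ) C hm))
    (mul_ne_zero (sinh_coeff_ne_zero hħ hB ht) (sinh_coeff_ne_zero hħ hC ht)))).ofReal
  have h := hr.mul (tendsto_exp_phase (ħ := ħ) α D hm)
  rw [Complex.ofReal_mul] at h
  refine h.congr' ?_
  filter_upwards [eventually_pos_nhdsGT] with ε hε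
  have h0 := sinh_half_ne_zero hħ hε.ne'
  rw [qFieldCoeff, exp_zpow_neg, exp_rpow_abs D hε, qNum_exp, qNum_exp, qNum_exp,
    mul_assoc _ (Complex.exp _) (Complex.exp _), ← Complex.exp_add, ← mul_assoc]
  congr 1
  have e : (2 / (ε : ℂ)) = ((2 / ε : ℝ) : ℂ) := by push_cast; rfl
  rw [e, ← Complex.ofReal_mul]
  congr 1
  simp only [Pi.div_apply]
  generalize Real.sinh (ħ * A * (m ε * ε) / 2) = a
  generalize Real.sinh (ħ * B * (m ε * ε) / 2) = b
  generalize Real.sinh (ħ * C * (m ε * ε) / 2) = c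
  -- Where a denominator vanishes both sides are zero by convention, so no eventual non-vanishing
  -- has to be shown.
  rcases eq_or_ne b 0 with rfl | h1
  · simp
  rcases eq_or_ne c 0 with rfl | h2
  · simp
  field_simp

theorem tendsto_qHalfFieldCoeff (hħ : 0 < ħ) (ht : t ≠ 0)
    (hm : Tendsto (fun ε : ℝ => m ε * ε) (𝓝[>] 0) (𝓝 t)) (s : ℤˣ) {A B C : ℝ} (hB : B ≠ 0)
    (α : ℂ) : Tendsto (fun ε : ℝ => 2 / (ε : ℂ) *
        qHalfFieldCoeff (Real.exp (ħ * ε / 2)) s A B (Complex.exp (-(Complex.I * α * ε))) C (m ε))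
      (𝓝[>] 0) (𝓝 (FreeField.halfFieldCoeff ħ s A B α C t)) := by
  have hs0 : ((s : ℤ) : ℝ) ≠ 0 := by
    rcases FreeField.units_int_cases s with rfl | rfl <;> simp
  have hst := hm.const_mul ((s : ℤ) : ℝ)
  have hiff : ∀ {ε : ℝ}, 0 < ε → (0 < (s : ℤ) * m ε ↔ 0 < ((s : ℤ) : ℝ) * (m ε * ε)) := by
    intro ε hε
    rw [← mul_assoc, mul_pos_iff_of_pos_right hε]
    exact_mod_cast Iff.rfl
  rw [FreeField.halfFieldCoeff]
  split_ifs with h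
  · have hr := (((tendsto_sinh_half_div ħ).const_mul 2).mul
      ((tendsto_sinh_coeff (ħ := ħ) A hm.abs).div (tendsto_sinh_coeff (ħ := ħ) B hm.abs)
        (sinh_coeff_ne_zero hħ hB (abs_ne_zero.2 ht)))).ofReal
    have h' := hr.mul (tendsto_exp_phase (ħ := ħ) α C hm)
    have e : ((2 * ħ * (Real.sinh (ħ * A * |t| / 2) / Real.sinh (ħ * B * |t| / 2)) : ℝ) : ℂ) =
        2 * ħ * (Real.sinh (ħ * A * |t| / 2) / Real.sinh (ħ * B * |t| / 2) : ℝ) := by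
      push_cast; ring
    rw [e] at h'
    refine h'.congr' ?_
    filter_upwards [eventually_pos_nhdsGT, hst.eventually (lt_mem_nhds h)] with ε hε hε'
    have h0 := sinh_half_ne_zero hħ hε.ne'
    rw [qHalfFieldCoeff, if_pos ((hiff hε).2 hε'), exp_zpow_neg, exp_rpow_abs C hε,
      qNum_exp_abs A hε, qNum_exp_abs B hε, exp_sub_inv, mul_assoc _ (Complex.exp _),
      ← Complex.exp_add, ← mul_assoc, div_div_div_cancel_right₀ h0]
    congr 1
    have e : (2 / (ε : ℂ)) = ((2 / ε : ℝ) : ℂ) := by push_cast; rfl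
    rw [e, ← Complex.ofReal_mul]
    congr 1
    simp only [Pi.div_apply]
    ring
  -- Since `t ≠ 0`, the sign of `s m(ε)` is eventually that of `s t`, here negative, and the
  -- coefficient is cut off.
  · have h1 : ((s : ℤ) : ℝ) * t < 0 := lt_of_le_of_ne (not_lt.1 h) (mul_ne_zero hs0 ht)
    refine tendsto_const_nhds.congr' ?_
    filter_upwards [eventually_pos_nhdsGT, hst.eventually (gt_mem_nhds h1)] with ε hε hε'
    rw [qHalfFieldCoeff, if_neg fun h2 => lt_asymm hε' ((hiff hε).1 h2), mul_zero]

theorem holds (hħ : 0 < ħ) (hξ : 0 < ξ) (hk : 0 < k) : Holds ħ ξ k :=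
  ⟨tendsto_prefactor hħ, fun _ ht _ hm => ⟨tendsto_qCommutator hħ hξ ht hm,
    tendsto_primeRatio hħ hξ hk ht hm, fun _ _ _ _ hB hC => tendsto_qFieldCoeff hħ ht hm hB hC,
    fun s _ _ _ hB => tendsto_qHalfFieldCoeff hħ ht hm s hB⟩⟩

end

end ScalingLimit

/-! ### The free field realization -/

theorem theorem4p2 (ħ ξ k η η' : ℝ) (hħ : 0 < ħ) (hξ : 0 < ξ) (hk : 0 < k)
    (hη : 1 / η = ħ * ξ) (hη' : 1 / η' = ħ * (ξ + k)) :
    ScalingLimit.Holds ħ ξ k ∧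
    FreeField.IsBosonicFockSpace ħ ξ k ∧
    ∃ σ : ℝ, FreeField.ContractionsConverge ħ ξ k σ ∧
      CurrentAlgebra.Realizes ħ η η' k σ FreeField.bras (FreeField.Fock ħ ξ k : Set FreeField.State)
        (FreeField.eCurrent ħ ξ k) (FreeField.fCurrent ħ ξ k) (FreeField.hCurrent ħ ξ k) := by
  refine ⟨ScalingLimit.holds hħ hξ hk, FreeField.isBosonicFockSpace hħ hξ hk,
    FreeField.vertexStrip ħ ξ k, FreeField.contractionsConverge hħ hξ hk
      (FreeField.contractionBound_le_vertexStrip hħ hξ hk), ?_⟩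
  exact
    { entire_E := by
        rintro _ ⟨v, hv, rfl⟩ Φ hΦ
        exact ((FreeField.isVertexCurrent_E hħ hξ hk).entireOnStrips hħ hξ hk hv hΦ).diff
      entire_F := by
        rintro _ ⟨v, hv, rfl⟩ Φ hΦ
        exact ((FreeField.isVertexCurrent_F hħ hξ hk).entireOnStrips hħ hξ hk hv hΦ).diff
      entire_H := by
        rintro s _ ⟨v, hv, rfl⟩ Φ hΦ
        exact ((FreeField.isVertexCurrent_H hħ hξ hk s).entireOnStrips hħ hξ hk hv hΦ).diff
      modes_E := by
        rintro _ ⟨v, hv, rfl⟩ Φ hΦ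
        obtain ⟨T, hT, -⟩ := ((FreeField.isVertexCurrent_E hħ hξ hk).entireOnStrips
          hħ hξ hk hv hΦ).exists_isGeneratingFunction
        exact ⟨T, hT⟩
      modes_F := by
        rintro _ ⟨v, hv, rfl⟩ Φ hΦ
        obtain ⟨T, hT, -⟩ := ((FreeField.isVertexCurrent_F hħ hξ hk).entireOnStrips
          hħ hξ hk hv hΦ).exists_isGeneratingFunction
        exact ⟨T, hT⟩
      modes_H := FreeField.modes_H hħ hξ hk hη hη'
      rel_H_pos_neg := FreeField.exchange_H_pos_neg hħ hξ hk hη hη'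
      rel_H_same := fun s => FreeField.exchange_H_same hħ hξ hk hη hη' s
      rel_H_E := fun s => FreeField.exchange_HE hħ hξ hk hη s
      rel_H_F := fun s => FreeField.exchange_HF hħ hξ hk hη' s
      rel_E_E := FreeField.exchange_EE hħ hξ hk hη
      rel_F_F := FreeField.exchange_FF hħ hξ hk hη'
      rel_E_F := FreeField.relation_EF hħ hξ hk }
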